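/- Let $m>0$, $0<\alpha<1$. For $\beta\in\mathbb{R}$ and $\varphi\in H^{1/2}(\mathbb{R}^3)$ (complex-valued) put $$\mathcal{E}_\beta(\varphi)=\frac12\langle\varphi,\sqrt{-\Delta+m^2}\,\varphi\rangle+\frac14\int_{\mathbb{R}^3}\int_{\mathbb{R}^3}\Big(\frac{\beta}{|x-y|^{\alpha}}-\frac{1}{|x-y|}\Big)|\varphi(x)|^2|\varphi(y)|^2\,dx\,dy,$$ where $\langle\cdot,\cdot\rangle$ is the $L^2$ product and $\sqrt{-\Delta+m^2}$ is understood through the Fourier transform as a quadratic form, and for $N>0$ let $$E(\beta,N)=\inf\Big\{\mathcal{E}_\beta(\varphi):\ \varphi\in H^{1/2}(\mathbb{R}^3),\ \int_{\mathbb{R}^3}|\varphi|^2\,dx=N\Big\}\in[-\infty,\infty).$$ A minimizer for $E(\beta,N)$ is a $\varphi\in H^{1/2}(\mathbb{R}^3)$ with $\int_{\mathbb{R}^3}|\varphi|^2\,dx=N$ and $\mathcal{E}_\beta(\varphi)=E(\beta,N)$. Let the critical mass $N_c$ be defined by $$\frac{N_c}{2}=\inf_{\psi\in H^{1/2}(\mathbb{R}^3),\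 \psi\not\equiv0}\frac{\langle\psi,\sqrt{-\Delta}\,\psi\rangle\,\langle\psi,\psi\rangle}{\int_{\mathbb{R}^3}\big(\frac{1}{|x|}\ast|\psi|^2\big)|\psi|^2\,dx}.$$ Then: (i) If $0<N<N_c$ and $\beta\le0$, there exists at least one minimizer for $E(\beta,N)$. (ii) There exist $\beta_0>0$ and $\delta>0$ (depending only on $m$ and $\alpha$) such that, whenever $0<\beta<\beta_0$, $0<N<N_c$ and $N>N_c-\delta$, there exists at least one minimizer for $E(\beta,N)$. (iii) If $N>N_c$, then for every $\beta\in\mathbb{R}$ we have $E(\beta,N)=-\infty$, and there is no minimizer for $E(\beta,N)$. -/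

import Mathlib

noncomputable section

namespace BosonStar

open MeasureTheory
open scoped FourierTransform SchwartzMap

/-- Three-dimensional Euclidean space. -/
abbrev R3 : Type := EuclideanSpace ℝ (Fin 3)

/-- The complex Hilbert space `L²(ℝ³; ℂ)`. -/
abbrev L2 : Type := Lp ℂ 2 (volume : Measure R3)

/-- `φ ∈ H^{1/2}(ℝ³)`: the Bessel potential of order `1/2` of `φ` lies in `L²`. -/
def MemHHalf (φ : L2) : Prop :=
  TemperedDistribution.MemSobolev (1 / 2 : ℝ) 2 (φ : 𝓢'(R3, ℂ))

/-- The mass `⟨φ, φ⟩ = ∫ |φ|² dx`. -/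
def mass (φ : L2) : ℝ :=
  ∫ x : R3, ‖φ x‖ ^ 2

/-- The quadratic form `⟨φ, √(-Δ + m²) φ⟩`. In the normalisation
`𝓕 φ (ξ) = ∫ exp(-2πi x·ξ) φ(x) dx` of the Fourier transform, the operator `√(-Δ + m²)` is
multiplication by `√((2π|ξ|)² + m²)` on the Fourier side. For `m = 0` this is `⟨φ, √(-Δ) φ⟩`. -/
def kinetic (m : ℝ) (φ : L2) : ℝ :=
  ∫ ξ : R3, Real.sqrt ((2 * Real.pi * ‖ξ‖) ^ 2 + m ^ 2) * ‖(𝓕 φ : L2) ξ‖ ^ 2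

/-- The interaction energy
`I(φ) = (1/4) ∬ (β / |x - y|^α - 1 / |x - y|) |φ(x)|² |φ(y)|² dx dy`. -/
def interaction (α β : ℝ) (φ : L2) : ℝ :=
  (1 / 4) * ∫ x : R3, ∫ y : R3,
    (β / ‖x - y‖ ^ α - 1 / ‖x - y‖) * ‖φ x‖ ^ 2 * ‖φ y‖ ^ 2

/-- The energy functional `𝓔_β(φ) = (1/2) ⟨φ, √(-Δ + m²) φ⟩ + I(φ)`. -/
def energy (m α β : ℝ) (φ : L2) : ℝ :=
  (1 / 2) * kinetic m φ + interaction α β φ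

/-- `E(β, N) = inf {𝓔_β(φ) : φ ∈ H^{1/2}(ℝ³), ∫ |φ|² = N}`, as an extended real number. -/
def groundEnergy (m α β N : ℝ) : EReal :=
  ⨅ φ : {φ : L2 // MemHHalf φ ∧ mass φ = N}, (energy m α β φ.1 : EReal)

/-- `φ` is a minimizer (ground state) for `E(β, N)`. -/
def IsMinimizer (m α β N : ℝ) (φ : L2) : Prop :=
  MemHHalf φ ∧ mass φ = N ∧ (energy m α β φ : EReal) = groundEnergy m α β N

/-- `∫ (|x|⁻¹ ∗ |ψ|²) |ψ|² dx`. -/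
def newtonEnergy (ψ : L2) : ℝ :=
  ∫ x : R3, (∫ y : R3, 1 / ‖x - y‖ * ‖ψ y‖ ^ 2) * ‖ψ x‖ ^ 2

/-- The critical mass: `N_c / 2` is the infimum of
`⟨ψ, √(-Δ) ψ⟩ ⟨ψ, ψ⟩ / ∫ (|x|⁻¹ ∗ |ψ|²) |ψ|² dx` over all nonzero `ψ ∈ H^{1/2}(ℝ³)`. -/
def criticalMass : ℝ :=
  2 * ⨅ ψ : {ψ : L2 // MemHHalf ψ ∧ ψ ≠ 0}, kinetic 0 ψ.1 * mass ψ.1 / newtonEnergy ψ.1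

end BosonStar

end

noncomputable section
namespace BosonStar
open MeasureTheory Filter Topology
open scoped FourierTransform SchwartzMap ENNReal NNReal

/-! Write D_s(f) = ∬ |f(x)|² |f(y)|² / |x - y|^s dx dy. The basic estimate is a Kato inequality,
`exists_kato`: the Newton potential of |f|² is bounded everywhere by the quadratic form of √(-Δ).
Hence for 0 < s ≤ 1 all D_s are finite on H^{1/2}, the double integrals may be rearranged freely,
and N_c > 0. By `exists_riesz_le`, D_α is at most a small multiple of D_1 plus a multiple of the
squared mass, so the β-term is always subordinate to the Newton term.

Above N_c, dilate a trial function for which the Newton term beats the massless kinetic term. The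
energy behaves like -γt with γ > 0, whereas the β-term grows only like t^α and the rest mass
contributes at most mN/2; so E = -∞ and no real energy can equal it.

Below N_c the energy controls the kinetic form (`exists_coercive`), and `exists_isMinimizer` runs
the concentration-compactness method from two inequalities: E(N) < mN/2 and E(N) < E(l) + E(N - l)
for 0 < l < N. The first rules out vanishing: the kinetic term is at least mN/2, so D_1 stays
bounded below along a minimizing sequence (`exists_lt_riesz_one`), and then some ball of fixed
radius carries a fixed mass (`exists_nonvanishing`). After translation the weak limit f is nonzero
by Rellich's theorem. Writing φ = (-Δ + m²)^{-1/4} G turns the kinetic energy into ‖G‖², which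
splits along weak limits by a Hilbert space identity; the Riesz energies split by
`tendsto_riesz_split`. So mass and energy divide between f and the remainder, and the second
inequality forces the remainder to have vanishing mass.

For β ≤ 0 both inequalities come from scaling: spreading a function out gives E(N) < mN/2, and
multiplying it by a constant (`gs_scale`) then makes E(N)/N strictly decreasing.

For small β > 0 and N close to N_c the two inequalities follow from the single bound E(N) < mN/6 of
`exists_gs_lt`, since E ≥ 0 and scaling up from a mass in [N/2, N) strictly lowers the energy
(`gs_subadditive_of_lt`). The bound itself uses near-optimizers of the quotient defining N_c,
normalised to unit mass and unit massless kinetic energy. They have little mass at low frequencies,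
uniformly (`exists_mass_low_le`); otherwise deleting those frequencies would give a better quotient.
Suitably concentrated, such a function feels m only weakly, while its massless kinetic and Newton
energies almost cancel. No optimizer for N_c is needed. -/

/-! ### Densities, mass and the Fourier-side quadratic form -/

/-- The density `|f|²` as an extended nonnegative function. -/
def dens (f : L2) (x : R3) : ℝ≥0∞ := ‖f x‖ₑ ^ 2

/-- The quadratic form `∫ |ξ| |𝓕 f|² dξ` as an extended nonnegative number. -/
def kinE (f : L2) : ℝ≥0∞ := ∫⁻ ξ, ‖ξ‖ₑ * dens (𝓕 f) ξ

lemma measurable_dens (f : L2) : Measurable (dens f) :=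
  (Lp.stronglyMeasurable f).measurable.enorm.pow_const 2

lemma lintegral_dens_eq_enorm (f : L2) : ∫⁻ x, dens f x = ‖f‖ₑ ^ 2 := by
  rw [Lp.enorm_def, eLpNorm_eq_lintegral_rpow_enorm_toReal (by norm_num) (by norm_num)]
  simp only [ENNReal.toReal_ofNat, dens, ENNReal.rpow_ofNat]
  rw [← ENNReal.rpow_natCast, ← ENNReal.rpow_mul]
  norm_num

lemma lintegral_dens (f : L2) : ∫⁻ x, dens f x = ENNReal.ofReal (‖f‖ ^ 2) := by
  rw [lintegral_dens_eq_enorm, ENNReal.ofReal_pow (norm_nonneg _), ofReal_norm]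

lemma lintegral_dens_ne_top (f : L2) : ∫⁻ x, dens f x ≠ ⊤ := by
  rw [lintegral_dens]; exact ENNReal.ofReal_ne_top

lemma ofReal_norm_sq (f : L2) (x : R3) : ENNReal.ofReal (‖f x‖ ^ 2) = dens f x := by
  rw [ENNReal.ofReal_pow (norm_nonneg _), ofReal_norm, dens]

lemma toReal_dens (f : L2) (x : R3) : (dens f x).toReal = ‖f x‖ ^ 2 := by
  rw [← ofReal_norm_sq, ENNReal.toReal_ofReal (by positivity)]

lemma mass_eq (f : L2) : mass f = ‖f‖ ^ 2 := by
  unfold mass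
  simp_rw [← toReal_dens]
  rw [integral_toReal (measurable_dens f).aemeasurable
    (ae_of_all _ fun x => by simp [dens]), lintegral_dens,
    ENNReal.toReal_ofReal (by positivity)]

lemma lintegral_dens_fourier (f : L2) : ∫⁻ ξ, dens (𝓕 f) ξ = ∫⁻ x, dens f x := by
  rw [lintegral_dens, lintegral_dens, Lp.norm_fourier_eq]

/-! ### The L² Fourier transform tested against Schwartz functions -/

lemma integral_mul_fourier (f : L2) (h : 𝓢(R3, ℂ)) :
    ∫ x, h x * (𝓕 f : L2) x = ∫ x, (𝓕 h) x * f x := by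
  have := congrArg (fun u : 𝓢'(R3, ℂ) => u h) (Lp.fourier_toTemperedDistribution_eq f)
  simpa [Lp.toTemperedDistribution_apply] using this.symm

lemma integral_mul_fourierInv (f : L2) (h : 𝓢(R3, ℂ)) :
    ∫ x, h x * (𝓕⁻ f : L2) x = ∫ x, (𝓕⁻ h) x * f x := by
  have := congrArg (fun u : 𝓢'(R3, ℂ) => u h) (Lp.fourierInv_toTemperedDistribution_eq f)
  simpa [Lp.toTemperedDistribution_apply] using this.symm

/-- Two locally integrable functions with the same integrals against Schwartz functions agree. -/
lemma ae_eq_of_integral_schwartz {F G : R3 → ℂ} (hF : LocallyIntegrable F volume)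
    (hG : LocallyIntegrable G volume)
    (h : ∀ h : 𝓢(R3, ℂ), ∫ x, h x * F x = ∫ x, h x * G x) : F =ᵐ[volume] G := by
  apply ae_eq_of_integral_contDiff_smul_eq hF hG
  intro g g_smooth g_cpt
  have hg₁ : HasCompactSupport (Complex.ofRealCLM ∘ g) := g_cpt.comp_left rfl
  have hg₂ : ContDiff ℝ (⊤ : ℕ∞) (Complex.ofRealCLM ∘ g) := by fun_prop
  simpa using h (hg₁.toSchwartzMap hg₂)

lemma L2.locallyIntegrable (f : L2) : LocallyIntegrable f volume :=
  (Lp.memLp f).locallyIntegrable (by norm_num)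

/-- On integrable functions the `L²` inverse Fourier transform is given by the integral. -/
lemma fourierInv_ae_eq (g : L2) (hg : Integrable g volume) :
    (𝓕⁻ g : L2) =ᵐ[volume] (𝓕⁻ (g : R3 → ℂ)) := by
  have hc : Continuous (𝓕⁻ (g : R3 → ℂ)) := by
    rw [Real.fourierInv_eq_fourier_comp_neg]
    exact VectorFourier.fourierIntegral_continuous Real.continuous_fourierChar
      continuous_inner (hg.comp_neg)
  apply ae_eq_of_integral_schwartz (L2.locallyIntegrable _) hc.locallyIntegrable
  intro h
  rw [integral_mul_fourierInv]
  have key := VectorFourier.integral_fourierIntegral_smul_eq_flip (L := -innerₗ R3)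
    (μ := (volume : Measure R3)) (ν := (volume : Measure R3))
    (f := h) (g := g) Real.continuous_fourierChar (by
      simp only [LinearMap.neg_apply]; exact continuous_inner.neg) h.integrable hg
  simp only [smul_eq_mul] at key
  have h1 (x : R3) : (𝓕⁻ h) x
      = VectorFourier.fourierIntegral Real.fourierChar volume (-innerₗ R3) h x := by
    rw [SchwartzMap.fourierInv_coe, Real.fourierInv_eq]
    simp [VectorFourier.fourierIntegral]
  have h2 (x : R3) : 𝓕⁻ (g : R3 → ℂ) x
      = VectorFourier.fourierIntegral Real.fourierChar volume (-innerₗ R3).flip g x := by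
    rw [Real.fourierInv_eq]
    simp [VectorFourier.fourierIntegral, real_inner_comm]
  simp_rw [h1, h2]
  exact key

lemma weight_sq (ξ : R3) : (((1 + ‖ξ‖ ^ 2) ^ ((1 / 2 : ℝ) / 2) : ℝ)) ^ 2 = √(1 + ‖ξ‖ ^ 2) := by
  rw [← Real.rpow_natCast, ← Real.rpow_mul (by positivity), Real.sqrt_eq_rpow]
  norm_num

/-- The squared Bessel weight is √(1 + |ξ|²), which lies between |ξ| and 1 + |ξ|; since the mass is
finite anyway, only the weight |ξ| matters. -/
lemma memHHalf_iff (f : L2) : MemHHalf f ↔ kinE f < ⊤ := by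
  unfold MemHHalf
  rw [TemperedDistribution.memSobolev_iff_exists_smulLeftCLM_fourier,
    Lp.fourier_toTemperedDistribution_eq]
  set w : R3 → ℂ := fun x => (((1 + ‖x‖ ^ 2) ^ ((1 / 2 : ℝ) / 2) : ℝ) : ℂ) with hw
  have hwg : w.HasTemperateGrowth := by rw [hw]; fun_prop
  have hwn (ξ : R3) : ‖w ξ‖ ^ 2 = √(1 + ‖ξ‖ ^ 2) := by
    rw [← weight_sq, hw, Complex.norm_real, Real.norm_eq_abs, sq_abs]
  have hwe (ξ : R3) : ‖w ξ * (𝓕 f : L2) ξ‖ₑ ^ 2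
      = ENNReal.ofReal (√(1 + ‖ξ‖ ^ 2)) * dens (𝓕 f) ξ := by
    rw [enorm_mul, mul_pow, dens, ← hwn, ENNReal.ofReal_pow (norm_nonneg _), ofReal_norm]
  constructor
  · rintro ⟨f', hf'⟩
    have hae : (fun ξ => w ξ * (𝓕 f : L2) ξ) =ᵐ[volume] f' := by
      apply ae_eq_of_integral_schwartz _ (L2.locallyIntegrable _)
      · intro h
        have := congrArg (fun u : 𝓢'(R3, ℂ) => u h) hf'
        simp only [TemperedDistribution.smulLeftCLM_apply_apply,
          Lp.toTemperedDistribution_apply, SchwartzMap.smulLeftCLM_apply_apply hwg] at this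
        simp only [smul_eq_mul] at this
        rw [← this]
        congr 1; ext x; ring
      · exact (L2.locallyIntegrable _).continuous_smul hwg.1.continuous
    have hle : kinE f ≤ ∫⁻ ξ, dens f' ξ := by
      apply lintegral_mono_ae
      filter_upwards [hae] with ξ hξ
      rw [dens.eq_1 f', ← hξ, hwe, ← ofReal_norm]
      gcongr
      apply Real.le_sqrt_of_sq_le; linarith
    exact hle.trans_lt (lintegral_dens_ne_top f').lt_top
  · intro hk
    have hm : MemLp (fun ξ => w ξ * (𝓕 f : L2) ξ) 2 volume := by
      refine ⟨(hwg.1.continuous.aestronglyMeasurable).mul (Lp.aestronglyMeasurable _), ?_⟩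
      rw [eLpNorm_lt_top_iff_lintegral_rpow_enorm_lt_top (by norm_num) (by norm_num)]
      simp only [ENNReal.toReal_ofNat, ENNReal.rpow_ofNat, hwe]
      calc _ ≤ ∫⁻ ξ, (dens (𝓕 f) ξ + ‖ξ‖ₑ * dens (𝓕 f) ξ) := by
            apply lintegral_mono
            intro ξ
            calc _ ≤ (1 + ‖ξ‖ₑ) * dens (𝓕 f) ξ := by
                  refine mul_le_mul_left ?_ _
                  rw [← ofReal_norm, ← ENNReal.ofReal_one, ← ENNReal.ofReal_add (by simp) (by simp)]
                  apply ENNReal.ofReal_le_ofReal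
                  rw [Real.sqrt_le_left (by positivity)]
                  nlinarith [norm_nonneg ξ]
              _ = _ := by ring
        _ < ⊤ := by
            rw [lintegral_add_left (measurable_dens _), lintegral_dens_fourier]
            exact ENNReal.add_lt_top.2 ⟨(lintegral_dens_ne_top f).lt_top, hk⟩
    refine ⟨hm.toLp, ?_⟩
    ext h
    simp only [TemperedDistribution.smulLeftCLM_apply_apply,
          Lp.toTemperedDistribution_apply, SchwartzMap.smulLeftCLM_apply_apply hwg]
    apply integral_congr_ae
    filter_upwards [hm.coeFn_toLp] with x hx
    rw [hx]; simp only [smul_eq_mul]; ring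

/-! ### Splitting into low and high frequencies -/

lemma memLp_indicator_fourier (A : ℝ) (f : L2) :
    MemLp ((Metric.ball (0 : R3) A).indicator (𝓕 f : L2)) 2 volume :=
  (Lp.memLp (𝓕 f : L2)).indicator measurableSet_ball

/-- The part of `f` with frequencies in the ball of radius `A`. -/
def low (A : ℝ) (f : L2) : L2 :=
  𝓕⁻ ((memLp_indicator_fourier A f).toLp : L2)

/-- The part of `f` with frequencies outside the ball of radius `A`. -/
def high (A : ℝ) (f : L2) : L2 := f - low A f

lemma fourier_low (A : ℝ) (f : L2) :
    (𝓕 (low A f) : L2) =ᵐ[volume] (Metric.ball (0 : R3) A).indicator (𝓕 f : L2) := by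
  rw [low, FourierTransform.fourier_fourierInv_eq]
  exact MemLp.coeFn_toLp _

lemma fourier_high (A : ℝ) (f : L2) :
    (𝓕 (high A f) : L2) =ᵐ[volume] (Metric.ball (0 : R3) A)ᶜ.indicator (𝓕 f : L2) := by
  have : (𝓕 (high A f) : L2) = 𝓕 f - 𝓕 (low A f) :=
    (Lp.fourierTransformₗᵢ R3 ℂ).map_sub f (low A f)
  rw [this]
  filter_upwards [fourier_low A f, Lp.coeFn_sub (𝓕 f : L2) (𝓕 (low A f))] with x h1 h2
  rw [h2, Pi.sub_apply, h1]
  by_cases hx : x ∈ Metric.ball (0 : R3) A <;> simp only [Set.indicator, hx, Set.mem_compl_iff] <;> simp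

lemma dens_fourier_low (A : ℝ) (f : L2) :
    dens (𝓕 (low A f)) =ᵐ[volume] (Metric.ball (0 : R3) A).indicator (dens (𝓕 f)) := by
  filter_upwards [fourier_low A f] with x hx
  by_cases h : x ∈ Metric.ball (0 : R3) A <;> simp only [dens, hx, Set.indicator, h] <;> simp

lemma dens_fourier_high (A : ℝ) (f : L2) :
    dens (𝓕 (high A f)) =ᵐ[volume] (Metric.ball (0 : R3) A)ᶜ.indicator (dens (𝓕 f)) := by
  filter_upwards [fourier_high A f] with x hx
  by_cases h : x ∈ Metric.ball (0 : R3) A <;>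
    simp only [dens, hx, Set.indicator, h, Set.mem_compl_iff] <;> simp

lemma lintegral_dens_low (A : ℝ) (f : L2) :
    ∫⁻ x, dens (low A f) x = ∫⁻ ξ in Metric.ball (0 : R3) A, dens (𝓕 f) ξ := by
  rw [← lintegral_dens_fourier, lintegral_congr_ae (dens_fourier_low A f),
    lintegral_indicator measurableSet_ball]

lemma lintegral_dens_high (A : ℝ) (f : L2) :
    ∫⁻ x, dens (high A f) x = ∫⁻ ξ in (Metric.ball (0 : R3) A)ᶜ, dens (𝓕 f) ξ := by
  rw [← lintegral_dens_fourier, lintegral_congr_ae (dens_fourier_high A f),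
    lintegral_indicator measurableSet_ball.compl]

lemma low_ae_eq (A : ℝ) (f : L2) :
    low A f =ᵐ[volume] fun x => ∫ ξ in Metric.ball (0 : R3) A,
      Real.fourierChar (inner ℝ ξ x) • (𝓕 f : L2) ξ := by
  have hm := memLp_indicator_fourier A f
  have hi : Integrable (hm.toLp : L2) volume := by
    rw [integrable_congr hm.coeFn_toLp, integrable_indicator_iff measurableSet_ball]
    exact (L2.locallyIntegrable (𝓕 f)).integrableOn_isCompact (isCompact_closedBall 0 A)
      |>.mono_set Metric.ball_subset_closedBall
  refine (fourierInv_ae_eq _ hi).trans (ae_of_all _ fun x => ?_)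
  simp only [Real.fourierInv_eq]
  rw [← integral_indicator measurableSet_ball]
  apply integral_congr_ae
  filter_upwards [hm.coeFn_toLp] with ξ hξ
  rw [hξ]
  by_cases h : ξ ∈ Metric.ball (0 : R3) A <;> simp only [Set.indicator, h] <;> simp

lemma dens_low_le (A : ℝ) (f : L2) :
    ∀ᵐ x, dens (low A f) x ≤ (∫⁻ ξ in Metric.ball (0 : R3) A, ‖(𝓕 f : L2) ξ‖ₑ) ^ 2 := by
  filter_upwards [low_ae_eq A f] with x hx
  rw [dens, hx]
  gcongr
  refine (enorm_integral_le_lintegral_enorm _).trans (le_of_eq ?_)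
  congr 1; ext ξ
  rw [Circle.smul_def, enorm_smul, ← ofReal_norm ((_ : Circle) : ℂ), Circle.norm_coe]
  simp

/-! ### Translations and dilations -/

/-- The translate `x ↦ f (x + a)`. -/
def translate (a : R3) (f : L2) : L2 :=
  Lp.compMeasurePreserving (fun x => x + a) (measurePreserving_add_right volume a) f

lemma translate_ae_eq (a : R3) (f : L2) : translate a f =ᵐ[volume] fun x => f (x + a) :=
  Lp.coeFn_compMeasurePreserving f (measurePreserving_add_right volume a)

lemma dens_translate (a : R3) (f : L2) :
    dens (translate a f) =ᵐ[volume] fun x => dens f (x + a) := by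
  filter_upwards [translate_ae_eq a f] with x hx
  rw [dens, hx, dens]

lemma fourierInv_compSubConst (a : R3) (h : 𝓢(R3, ℂ)) (ξ : R3) :
    (𝓕⁻ (SchwartzMap.compSubConstCLM ℂ a (𝓕 h))) ξ
      = (Real.fourierChar (inner ℝ a ξ) : ℂ) * h ξ := by
  have h1 : h ξ = (𝓕⁻ (𝓕 h)) ξ := by rw [FourierTransform.fourierInv_fourier_eq]
  rw [h1, SchwartzMap.fourierInv_coe, SchwartzMap.fourierInv_coe, Real.fourierInv_eq,
    Real.fourierInv_eq, ← integral_add_right_eq_self _ a, ← integral_const_mul]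
  congr 1; ext x
  simp only [SchwartzMap.compSubConstCLM_apply, add_sub_cancel_right, inner_add_left,
    Circle.smul_def, smul_eq_mul, AddChar.map_add_eq_mul, Circle.coe_mul]
  ring

/-- Tested against a Schwartz function h, the shift lands on 𝓕 h, and the inverse transform of a
shifted 𝓕 h is h times a character. Only the unimodularity of that character is used later. -/
lemma fourier_translate (a : R3) (f : L2) :
    (𝓕 (translate a f) : L2) =ᵐ[volume]
      fun ξ => (Real.fourierChar (inner ℝ a ξ) : ℂ) * (𝓕 f : L2) ξ := by
  apply ae_eq_of_integral_schwartz (L2.locallyIntegrable _)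
  · have hc : Continuous fun ξ : R3 => (Real.fourierChar (inner ℝ a ξ) : ℂ) :=
      continuous_subtype_val.comp (Real.continuous_fourierChar.comp (by fun_prop))
    exact (L2.locallyIntegrable (𝓕 f)).continuous_smul hc
  intro h
  rw [integral_mul_fourier]
  have h1 : ∫ x, (𝓕 h) x * (translate a f) x = ∫ x, (𝓕 h) x * f (x + a) := by
    apply integral_congr_ae
    filter_upwards [translate_ae_eq a f] with x hx
    rw [hx]
  rw [h1, ← integral_sub_right_eq_self _ a]
  have h2 := integral_mul_fourier f (𝓕⁻ (SchwartzMap.compSubConstCLM ℂ a (𝓕 h)))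
  rw [FourierTransform.fourier_fourierInv_eq] at h2
  simp only [SchwartzMap.compSubConstCLM_apply] at h2
  simp only [sub_add_cancel]
  rw [← h2]
  congr 1; ext ξ
  rw [fourierInv_compSubConst]; ring

lemma dens_fourier_translate (a : R3) (f : L2) :
    dens (𝓕 (translate a f)) =ᵐ[volume] dens (𝓕 f) := by
  filter_upwards [fourier_translate a f] with x hx
  rw [dens, hx, dens, enorm_mul, ← ofReal_norm ((_ : Circle) : ℂ), Circle.norm_coe]
  simp

lemma lintegral_comp_smul (g : R3 → ℝ≥0∞) (hg : Measurable g) {t : ℝ} (ht : 0 < t) :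
    ∫⁻ x, g (t • x) = ENNReal.ofReal ((t ^ 3)⁻¹) * ∫⁻ x, g x := by
  have := Measure.map_addHaar_smul (volume : Measure R3) ht.ne'
  rw [← lintegral_map hg (measurable_const_smul t), this, lintegral_smul_measure]
  simp [abs_of_pos ht]

lemma memLp_comp_smul (f : L2) {t : ℝ} (ht : 0 < t) :
    MemLp (fun x => ((√(t ^ 3) : ℝ) : ℂ) * f (t • x)) 2 volume := by
  apply MemLp.const_mul
  have h := Measure.map_addHaar_smul (volume : Measure R3) ht.ne'
  have : MemLp f 2 (Measure.map (fun x : R3 => t • x) volume) := by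
    rw [h]
    exact (Lp.memLp f).smul_measure ENNReal.ofReal_ne_top
  exact this.comp_of_map (measurable_const_smul t).aemeasurable

/-- The dilation `x ↦ t^{3/2} f (t x)`. -/
def dilate {t : ℝ} (ht : 0 < t) (f : L2) : L2 := (memLp_comp_smul f ht).toLp

lemma dilate_ae_eq {t : ℝ} (ht : 0 < t) (f : L2) :
    dilate ht f =ᵐ[volume] fun x => ((√(t ^ 3) : ℝ) : ℂ) * f (t • x) :=
  MemLp.coeFn_toLp _

lemma dens_dilate {t : ℝ} (ht : 0 < t) (f : L2) :
    dens (dilate ht f) =ᵐ[volume] fun x => ENNReal.ofReal (t ^ 3) * dens f (t • x) := by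
  filter_upwards [dilate_ae_eq ht f] with x hx
  rw [← ofReal_norm_sq, hx, norm_mul, mul_pow, ENNReal.ofReal_mul (by positivity), ofReal_norm_sq,
    Complex.norm_real, Real.norm_eq_abs, sq_abs, Real.sq_sqrt (by positivity)]

lemma fourier_comp_smul (h : 𝓢(R3, ℂ)) {t : ℝ} (ht : 0 < t) (g : 𝓢(R3, ℂ))
    (hg : ∀ x, g x = h (t • x)) (x : R3) :
    (𝓕 g) x = (((t ^ 3)⁻¹ : ℝ) : ℂ) * (𝓕 h) (t⁻¹ • x) := by
  rw [SchwartzMap.fourier_coe, SchwartzMap.fourier_coe, Real.fourier_eq, Real.fourier_eq]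
  have := Measure.integral_comp_smul (volume : Measure R3)
    (fun v => Real.fourierChar (-inner ℝ v (t⁻¹ • x)) • h v) t
  simp only [finrank_euclideanSpace, Fintype.card_fin] at this
  rw [abs_of_pos (by positivity)] at this
  rw [← Complex.real_smul, ← this]
  congr 1; ext v
  rw [hg, inner_smul_left, inner_smul_right]
  simp only [conj_trivial]
  rw [mul_inv_cancel_left₀ ht.ne']

lemma fourier_dilate {t : ℝ} (ht : 0 < t) (f : L2) :
    (𝓕 (dilate ht f) : L2) =ᵐ[volume]
      fun ξ => (((√(t ^ 3))⁻¹ : ℝ) : ℂ) * (𝓕 f : L2) (t⁻¹ • ξ) := by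
  have hti : 0 < t⁻¹ := inv_pos.2 ht
  apply ae_eq_of_integral_schwartz (L2.locallyIntegrable _)
  · have := (memLp_comp_smul (𝓕 f) hti).locallyIntegrable (by norm_num)
    convert this using 4
    rw [inv_pow, Real.sqrt_inv]
  intro h
  rw [integral_mul_fourier]
  have h1 : ∫ x, (𝓕 h) x * (dilate ht f) x
      = ((√(t ^ 3) : ℝ) : ℂ) * ∫ x, (𝓕 h) x * f (t • x) := by
    rw [← integral_const_mul]
    apply integral_congr_ae
    filter_upwards [dilate_ae_eq ht f] with x hx
    rw [hx]; ring
  have h2 := Measure.integral_comp_smul (volume : Measure R3)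
    (fun x => (𝓕 h) (t⁻¹ • x) * f x) t
  have h3 := Measure.integral_comp_smul (volume : Measure R3)
    (fun ξ => h (t • ξ) * (𝓕 f : L2) ξ) t⁻¹
  simp only [finrank_euclideanSpace, Fintype.card_fin, inv_smul_smul₀ ht.ne',
    smul_inv_smul₀ ht.ne', Complex.real_smul] at h2 h3
  rw [abs_of_pos (by positivity)] at h2 h3
  set u : R3 ≃L[ℝ] R3 := ContinuousLinearEquiv.smulLeft (Units.mk0 t ht.ne') with hu
  set g : 𝓢(R3, ℂ) := SchwartzMap.compCLMOfContinuousLinearEquiv ℂ u h with hgdef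
  have hg (x : R3) : g x = h (t • x) := rfl
  have h4 := integral_mul_fourier f g
  simp_rw [fourier_comp_smul h ht g hg, hg, mul_assoc] at h4
  rw [integral_const_mul] at h4
  have h5 : ∫ ξ, h ξ * ((((√(t ^ 3))⁻¹ : ℝ) : ℂ) * (𝓕 f : L2) (t⁻¹ • ξ))
      = (((√(t ^ 3))⁻¹ : ℝ) : ℂ) * ∫ ξ, h ξ * (𝓕 f : L2) (t⁻¹ • ξ) := by
    rw [← integral_const_mul]
    congr 1; ext ξ; ring
  rw [h1, h5, h2, h3, h4]
  have hs : √(t ^ 3) ≠ 0 := by positivity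
  have hs2 : √(t ^ 3) * √(t ^ 3) = t ^ 3 := Real.mul_self_sqrt (by positivity)
  rw [← mul_assoc, ← mul_assoc, ← mul_assoc]
  congr 1
  norm_cast
  rw [inv_pow, inv_inv]
  field_simp
  rw [sq, hs2]

lemma dens_fourier_dilate {t : ℝ} (ht : 0 < t) (f : L2) :
    dens (𝓕 (dilate ht f)) =ᵐ[volume]
      fun ξ => ENNReal.ofReal ((t⁻¹) ^ 3) * dens (𝓕 f) (t⁻¹ • ξ) := by
  filter_upwards [fourier_dilate ht f] with x hx
  rw [← ofReal_norm_sq, hx, norm_mul, mul_pow, ENNReal.ofReal_mul (by positivity), ofReal_norm_sq,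
    Complex.norm_real, Real.norm_eq_abs, sq_abs, inv_pow, Real.sq_sqrt (by positivity), inv_pow]

lemma norm_dilate {t : ℝ} (ht : 0 < t) (f : L2) : ‖dilate ht f‖ = ‖f‖ := by
  have h : ∫⁻ x, dens (dilate ht f) x = ∫⁻ x, dens f x := by
    rw [lintegral_congr_ae (dens_dilate ht f), lintegral_const_mul' _ _ ENNReal.ofReal_ne_top,
      lintegral_comp_smul _ (measurable_dens f) ht, ← mul_assoc,
      ← ENNReal.ofReal_mul (by positivity), mul_inv_cancel₀ (by positivity)]
    simp
  rw [lintegral_dens_eq_enorm, lintegral_dens_eq_enorm] at h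
  have h2 := congrArg ENNReal.toReal h
  simp only [ENNReal.toReal_pow, toReal_enorm] at h2
  exact (pow_left_inj₀ (norm_nonneg _) (norm_nonneg _) two_ne_zero).1 h2

lemma norm_translate (a : R3) (f : L2) : ‖translate a f‖ = ‖f‖ :=
  Lp.norm_compMeasurePreserving f _

/-! ### Riesz kernels and Kato's inequality -/

/-- The Riesz kernel `1 / |z|^s`, with value `0` at the origin. -/
def ker (s : ℝ) (z : R3) : ℝ≥0∞ := ENNReal.ofReal (1 / ‖z‖ ^ s)

@[fun_prop]
lemma measurable_ker (s : ℝ) : Measurable (ker s) := by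
  unfold ker; fun_prop

lemma ker_smul (s : ℝ) {t : ℝ} (ht : 0 < t) (z : R3) :
    ker s (t • z) = ENNReal.ofReal (t ^ (-s)) * ker s z := by
  unfold ker
  rw [← ENNReal.ofReal_mul (by positivity), norm_smul, Real.norm_eq_abs, abs_of_pos ht,
    Real.mul_rpow ht.le (norm_nonneg _), Real.rpow_neg ht.le]
  congr 1
  rw [one_div, mul_inv, one_div]

lemma lintegral_ker_ball_lt_top {s : ℝ} (hs : s < 3) :
    ∫⁻ z in Metric.ball (0 : R3) 1, ker s z < ⊤ := by
  have h : IntegrableOn (fun z : R3 => (fun r : ℝ => 1 / r ^ s) ‖z‖) (Metric.ball 0 1) volume := by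
    rw [integrableOn_fun_norm_addHaar volume (f := fun r : ℝ => 1 / r ^ s)]
    simp only [finrank_euclideanSpace, Fintype.card_fin]
    have h2 : IntegrableOn (fun r : ℝ => r ^ (2 - s)) (Set.Ioo 0 1) volume :=
      (intervalIntegral.integrableOn_Ioo_rpow_iff zero_lt_one).2 (by linarith)
    refine h2.congr_fun (fun r hr => ?_) measurableSet_Ioo
    simp only [smul_eq_mul]
    rw [Real.rpow_sub hr.1, Real.rpow_two]
    ring_nf
  exact h.lintegral_lt_top

lemma exists_lintegral_ker_ball_le {s : ℝ} (hs : s < 3) :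
    ∃ C : ℝ≥0, ∀ A : ℝ, 0 < A →
      ∫⁻ z in Metric.ball (0 : R3) A, ker s z ≤ C * ENNReal.ofReal (A ^ (3 - s)) := by
  refine ⟨(∫⁻ z in Metric.ball (0 : R3) 1, ker s z).toNNReal, fun A hA => ?_⟩
  rw [ENNReal.coe_toNNReal (lintegral_ker_ball_lt_top hs).ne]
  rw [← lintegral_indicator measurableSet_ball, ← lintegral_indicator measurableSet_ball]
  have h := lintegral_comp_smul ((Metric.ball (0 : R3) A).indicator (ker s))
    ((measurable_ker s).indicator measurableSet_ball) hA
  have h2 : ∀ z : R3, (Metric.ball (0 : R3) A).indicator (ker s) (A • z)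
      = ENNReal.ofReal (A ^ (-s)) * (Metric.ball (0 : R3) 1).indicator (ker s) z := by
    intro z
    have hz : A • z ∈ Metric.ball (0 : R3) A ↔ z ∈ Metric.ball (0 : R3) 1 := by
      simp only [mem_ball_zero_iff, norm_smul, Real.norm_eq_abs, abs_of_pos hA]
      constructor
      · intro h; by_contra hc; push Not at hc; nlinarith
      · intro h; nlinarith
    by_cases hm : z ∈ Metric.ball (0 : R3) 1
    · rw [Set.indicator_of_mem (hz.2 hm), Set.indicator_of_mem hm, ker_smul s hA]
    · rw [Set.indicator_of_notMem (fun h => hm (hz.1 h)), Set.indicator_of_notMem hm, mul_zero]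
  simp_rw [h2] at h
  rw [lintegral_const_mul' _ _ ENNReal.ofReal_ne_top] at h
  have h3 := congrArg (fun x => ENNReal.ofReal (A ^ 3) * x) h
  rw [← mul_assoc, ← mul_assoc, ← ENNReal.ofReal_mul (by positivity),
    ← ENNReal.ofReal_mul (by positivity), mul_inv_cancel₀ (by positivity), ENNReal.ofReal_one,
    one_mul] at h3
  rw [← h3, mul_comm]
  apply le_of_eq
  congr 2
  rw [Real.rpow_sub hA, Real.rpow_neg hA.le]
  norm_cast

lemma lintegral_mul_sq_le {α : Type*} [MeasurableSpace α] {μ : Measure α} {f g : α → ℝ≥0∞}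
    (hf : AEMeasurable f μ) (hg : AEMeasurable g μ) :
    (∫⁻ a, f a * g a ∂μ) ^ 2 ≤ (∫⁻ a, f a ^ 2 ∂μ) * ∫⁻ a, g a ^ 2 ∂μ := by
  have h := ENNReal.lintegral_mul_le_Lp_mul_Lq μ
    (Real.HolderConjugate.two_two) hf hg
  simp only [Pi.mul_apply, ENNReal.rpow_two] at h
  calc _ ≤ ((∫⁻ a, f a ^ 2 ∂μ) ^ (1 / 2 : ℝ) * (∫⁻ a, g a ^ 2 ∂μ) ^ (1 / 2 : ℝ)) ^ 2 := by gcongr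
    _ = _ := by
      rw [mul_pow, ← ENNReal.rpow_natCast, ← ENNReal.rpow_natCast, ← ENNReal.rpow_mul,
        ← ENNReal.rpow_mul]
      norm_num

lemma lintegral_Ioi_inv_sq {c : ℝ} (hc : 0 < c) :
    ∫⁻ R in Set.Ioi c, ENNReal.ofReal (1 / R ^ 2) = ENNReal.ofReal (1 / c) := by
  have e : ∀ R ∈ Set.Ioi c, (1 / R ^ 2 : ℝ) = R ^ (-2 : ℝ) := fun R hR => by
    rw [Real.rpow_neg (hc.trans hR).le, Real.rpow_two, one_div]
  rw [setLIntegral_congr_fun measurableSet_Ioi (fun R hR => by rw [e R hR])]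
  rw [← ofReal_integral_eq_lintegral_ofReal (integrableOn_Ioi_rpow_of_lt (by norm_num) hc),
    integral_Ioi_rpow_of_lt (by norm_num) hc]
  · congr 1
    norm_num
    rw [Real.rpow_neg_one]
  · filter_upwards [ae_restrict_mem measurableSet_Ioi] with R hR
    exact Real.rpow_nonneg (hc.trans hR).le _

lemma dens_le_of_add {f g h : L2} (hfg : f = g + h) :
    ∀ᵐ x, dens f x ≤ 2 * dens g x + 2 * dens h x := by
  filter_upwards [Lp.coeFn_add g h] with x hx
  rw [hfg, ← ofReal_norm_sq, ← ofReal_norm_sq, ← ofReal_norm_sq, hx]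
  have e : 2 * ENNReal.ofReal (‖g x‖ ^ 2) + 2 * ENNReal.ofReal (‖h x‖ ^ 2)
      = ENNReal.ofReal (2 * ‖g x‖ ^ 2 + 2 * ‖h x‖ ^ 2) := by
    rw [ENNReal.ofReal_add (by positivity) (by positivity), ENNReal.ofReal_mul (by norm_num),
      ENNReal.ofReal_mul (by norm_num), ENNReal.ofReal_ofNat]
  rw [e]
  apply ENNReal.ofReal_le_ofReal
  have := norm_add_le (g x) (h x)
  simp only [Pi.add_apply]
  nlinarith [norm_nonneg (g x + h x), norm_nonneg (g x), norm_nonneg (h x),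
    sq_nonneg (‖g x‖ - ‖h x‖)]

lemma low_add_high (A : ℝ) (f : L2) : f = low A f + high A f := by
  rw [high]; abel

lemma volume_ball_eq (a : R3) {R : ℝ} (hR : 0 < R) :
    volume (Metric.ball a R) = ENNReal.ofReal (R ^ 3) * volume (Metric.ball (0 : R3) 1) := by
  rw [Measure.addHaar_ball volume a hR.le]; simp

lemma volume_ball_one_ne_top : volume (Metric.ball (0 : R3) 1) ≠ ⊤ :=
  (measure_ball_lt_top).ne

/-- Cut the frequencies at 1/R, the scale dual to the ball. The low part is bounded pointwise
through its Fourier integral, and the volume R³ times the factor 1/R from Cauchy–Schwarz gives R².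
The high part is simply estimated in L². -/
lemma exists_lintegral_ball_dens_le :
    ∃ C : ℝ≥0, ∀ (f : L2) (a : R3) (R : ℝ), 0 < R →
      ∫⁻ y in Metric.ball a R, dens f y ≤
        C * ENNReal.ofReal (R ^ 2) *
          (∫⁻ ξ in Metric.ball (0 : R3) R⁻¹, ‖ξ‖ₑ ^ 2 * dens (𝓕 f) ξ) +
        2 * ∫⁻ ξ in (Metric.ball (0 : R3) R⁻¹)ᶜ, dens (𝓕 f) ξ := by
  obtain ⟨C, hC⟩ := exists_lintegral_ker_ball_le (s := 2) (by norm_num)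
  refine ⟨2 * (volume (Metric.ball (0 : R3) 1)).toNNReal * C, fun f a R hR => ?_⟩
  have hRi : 0 < R⁻¹ := inv_pos.2 hR
  have hB : ∫⁻ y in Metric.ball a R, dens (low R⁻¹ f) y ≤
      volume (Metric.ball a R) * (∫⁻ ξ in Metric.ball (0 : R3) R⁻¹, ‖(𝓕 f : L2) ξ‖ₑ) ^ 2 := by
    calc _ ≤ ∫⁻ y in Metric.ball a R,
          (∫⁻ ξ in Metric.ball (0 : R3) R⁻¹, ‖(𝓕 f : L2) ξ‖ₑ) ^ 2 :=
          lintegral_mono_ae (ae_restrict_of_ae (dens_low_le R⁻¹ f))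
      _ = _ := by rw [setLIntegral_const, mul_comm]
  have hCS : (∫⁻ ξ in Metric.ball (0 : R3) R⁻¹, ‖(𝓕 f : L2) ξ‖ₑ) ^ 2 ≤
      (C * ENNReal.ofReal R⁻¹) * ∫⁻ ξ in Metric.ball (0 : R3) R⁻¹, ‖ξ‖ₑ ^ 2 * dens (𝓕 f) ξ := by
    -- Insert 1 = |ξ|⁻¹ |ξ| before Cauchy–Schwarz: |ξ|⁻² is integrable at the origin in dimension
    -- three, with integral proportional to the radius R⁻¹.
    have h0 : ∫⁻ ξ in Metric.ball (0 : R3) R⁻¹, ‖(𝓕 f : L2) ξ‖ₑ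
        = ∫⁻ ξ in Metric.ball (0 : R3) R⁻¹, ker 1 ξ * (‖ξ‖ₑ * ‖(𝓕 f : L2) ξ‖ₑ) := by
      apply lintegral_congr_ae
      apply ae_restrict_of_ae
      filter_upwards [Measure.ae_ne (volume : Measure R3) 0] with ξ hξ
      rw [← mul_assoc, ker, Real.rpow_one, ← ofReal_norm ξ, ← ENNReal.ofReal_mul (by positivity),
        one_div, inv_mul_cancel₀ (norm_ne_zero_iff.2 hξ)]
      simp
    rw [h0]
    refine (lintegral_mul_sq_le (by fun_prop) ?_).trans ?_
    · exact (measurable_enorm.mul (Lp.stronglyMeasurable (𝓕 f : L2)).measurable.enorm).aemeasurable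
    · simp_rw [mul_pow]
      refine mul_le_mul_left ?_ _
      have := hC R⁻¹ hRi
      norm_num at this
      refine le_trans (le_of_eq ?_) this
      congr 1; ext ξ
      rw [ker, ker, ← ENNReal.ofReal_pow (by positivity)]
      simp
  calc ∫⁻ y in Metric.ball a R, dens f y
      ≤ ∫⁻ y in Metric.ball a R, (2 * dens (low R⁻¹ f) y + 2 * dens (high R⁻¹ f) y) :=
        lintegral_mono_ae (ae_restrict_of_ae (dens_le_of_add (low_add_high R⁻¹ f)))
    _ = 2 * (∫⁻ y in Metric.ball a R, dens (low R⁻¹ f) y)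
        + 2 * ∫⁻ y in Metric.ball a R, dens (high R⁻¹ f) y := by
        rw [lintegral_add_left ((measurable_dens _).const_mul _),
          lintegral_const_mul _ (measurable_dens _), lintegral_const_mul _ (measurable_dens _)]
    _ ≤ 2 * (volume (Metric.ball a R) * ((C * ENNReal.ofReal R⁻¹) *
          ∫⁻ ξ in Metric.ball (0 : R3) R⁻¹, ‖ξ‖ₑ ^ 2 * dens (𝓕 f) ξ))
        + 2 * ∫⁻ ξ in (Metric.ball (0 : R3) R⁻¹)ᶜ, dens (𝓕 f) ξ := by
        rw [← lintegral_dens_high]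
        gcongr
        · exact hB.trans (by gcongr)
        · exact Measure.restrict_le_self
    _ = _ := by
        congr 1
        rw [volume_ball_eq a hR]
        push_cast
        rw [ENNReal.coe_toNNReal volume_ball_one_ne_top]
        have : ENNReal.ofReal (R ^ 2) = ENNReal.ofReal (R ^ 3) * ENNReal.ofReal R⁻¹ := by
          rw [← ENNReal.ofReal_mul (by positivity)]
          congr 1; field_simp
        rw [this]; ring

/-- Layer-cake form of the Newton kernel, 1/|z| = ∫_{|z|}^∞ dR/R², which reduces Kato's inequality
to the masses of balls. -/
lemma ker_one_le (z : R3) :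
    ker 1 z ≤ ∫⁻ R in Set.Ioi (0 : ℝ), (Set.Ioi ‖z‖).indicator (fun R => ENNReal.ofReal (1 / R ^ 2)) R := by
  by_cases hz : z = 0
  · simp [ker, hz]
  have hz' : 0 < ‖z‖ := norm_pos_iff.2 hz
  rw [setLIntegral_indicator measurableSet_Ioi, Set.inter_eq_left.2 (Set.Ioi_subset_Ioi hz'.le),
    lintegral_Ioi_inv_sq hz', ker, Real.rpow_one]

lemma measurableSet_low_radii (ξ : R3) :
    MeasurableSet {R : ℝ | ξ ∈ Metric.ball (0 : R3) R⁻¹} := by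
  simp only [mem_ball_zero_iff]
  exact measurableSet_lt measurable_const measurable_inv

/-- The admissible radii lie in (0, 1/|ξ|), so the integral is at most |ξ|² · 1/|ξ|. -/
lemma lintegral_low_weight_le (ξ : R3) :
    ∫⁻ R in Set.Ioi (0 : ℝ), {R : ℝ | ξ ∈ Metric.ball (0 : R3) R⁻¹}.indicator (fun _ => ‖ξ‖ₑ ^ 2) R
      ≤ ‖ξ‖ₑ := by
  by_cases hξ : ξ = 0
  · simp [hξ]
  have hz : 0 < ‖ξ‖ := norm_pos_iff.2 hξ
  have hms := measurableSet_low_radii ξ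
  rw [lintegral_indicator hms, setLIntegral_const, Measure.restrict_apply hms]
  have hsub : {R : ℝ | ξ ∈ Metric.ball (0 : R3) R⁻¹} ∩ Set.Ioi 0 ⊆ Set.Ioo 0 ‖ξ‖⁻¹ := by
    rintro R ⟨h1, h2⟩
    simp only [mem_ball_zero_iff, Set.mem_ofPred_eq] at h1
    exact ⟨h2, by rwa [lt_inv_comm₀ h2 hz]⟩
  calc _ ≤ ‖ξ‖ₑ ^ 2 * volume (Set.Ioo 0 ‖ξ‖⁻¹) := by gcongr
    _ = ‖ξ‖ₑ := by
      rw [Real.volume_Ioo, ← ofReal_norm, ← ENNReal.ofReal_pow hz.le,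
        ← ENNReal.ofReal_mul (by positivity)]
      congr 1; field_simp; ring

/-- The admissible radii satisfy R ≥ 1/|ξ|, and the tail integral of 1/R² from there is |ξ|. -/
lemma lintegral_high_weight_le (ξ : R3) :
    ∫⁻ R in Set.Ioi (0 : ℝ), {R : ℝ | ξ ∈ (Metric.ball (0 : R3) R⁻¹)ᶜ}.indicator
      (fun R => ENNReal.ofReal (1 / R ^ 2)) R ≤ ‖ξ‖ₑ := by
  have hms : MeasurableSet {R : ℝ | ξ ∈ (Metric.ball (0 : R3) R⁻¹)ᶜ} :=
    (measurableSet_low_radii ξ).compl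
  rw [setLIntegral_indicator hms]
  by_cases hξ : ξ = 0
  · have : {R : ℝ | ξ ∈ (Metric.ball (0 : R3) R⁻¹)ᶜ} ∩ Set.Ioi 0 = ∅ := by
      ext R
      simp only [hξ, Set.mem_inter_iff, Set.mem_ofPred_eq, Set.mem_compl_iff, mem_ball_zero_iff,
        norm_zero, not_lt, Set.mem_Ioi, Set.mem_empty_iff_false, iff_false, not_and]
      intro h1
      simpa using h1
    rw [this]; simp
  have hz : 0 < ‖ξ‖ := norm_pos_iff.2 hξ
  have hsub : {R : ℝ | ξ ∈ (Metric.ball (0 : R3) R⁻¹)ᶜ} ∩ Set.Ioi 0 ⊆ Set.Ici ‖ξ‖⁻¹ := by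
    rintro R ⟨h1, h2⟩
    simp only [Set.mem_compl_iff, mem_ball_zero_iff, not_lt, Set.mem_ofPred_eq] at h1
    exact (inv_le_comm₀ h2 hz).1 h1
  calc _ ≤ ∫⁻ R in Set.Ici ‖ξ‖⁻¹, ENNReal.ofReal (1 / R ^ 2) := lintegral_mono_set hsub
    _ = ‖ξ‖ₑ := by
      rw [setLIntegral_congr Ioi_ae_eq_Ici.symm, lintegral_Ioi_inv_sq (inv_pos.2 hz),
        one_div, inv_inv, ofReal_norm]

lemma measurableSet_uncurry_ball :
    MeasurableSet {p : ℝ × R3 | p.2 ∈ Metric.ball (0 : R3) p.1⁻¹} := by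
  simp only [mem_ball_zero_iff]
  exact measurableSet_lt (by fun_prop) (by fun_prop)

/-- A Hardy-type inequality of Kato: `∫ |f(y)|² / |a - y| dy` is bounded by the form of `√(-Δ)`. -/
theorem exists_kato :
    ∃ C : ℝ≥0, ∀ (f : L2) (a : R3), ∫⁻ y, ker 1 (a - y) * dens f y ≤ C * kinE f := by
  obtain ⟨C, hC⟩ := exists_lintegral_ball_dens_le
  refine ⟨C + 2, fun f a => ?_⟩
  have hd := measurable_dens f
  have hdf := measurable_dens (𝓕 f)
  have hlow (R : ℝ) : ∫⁻ ξ in Metric.ball (0 : R3) R⁻¹, ‖ξ‖ₑ ^ 2 * dens (𝓕 f) ξ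
      = ∫⁻ ξ, {R : ℝ | ξ ∈ Metric.ball (0 : R3) R⁻¹}.indicator (fun _ => ‖ξ‖ₑ ^ 2) R
        * dens (𝓕 f) ξ := by
    rw [← lintegral_indicator measurableSet_ball]
    congr 1; ext ξ
    by_cases h : ξ ∈ Metric.ball (0 : R3) R⁻¹ <;> simp only [Set.indicator, h, Set.mem_ofPred_eq] <;> simp
  have hhigh (R : ℝ) : ENNReal.ofReal (1 / R ^ 2) * ∫⁻ ξ in (Metric.ball (0 : R3) R⁻¹)ᶜ, dens (𝓕 f) ξ
      = ∫⁻ ξ, {R : ℝ | ξ ∈ (Metric.ball (0 : R3) R⁻¹)ᶜ}.indicator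
        (fun R => ENNReal.ofReal (1 / R ^ 2)) R * dens (𝓕 f) ξ := by
    rw [← lintegral_const_mul _ hdf, ← lintegral_indicator measurableSet_ball.compl]
    congr 1; ext ξ
    by_cases h : ξ ∈ Metric.ball (0 : R3) R⁻¹ <;>
      simp only [Set.indicator, h, Set.mem_ofPred_eq, Set.mem_compl_iff] <;> simp
  have m1 : Measurable (Function.uncurry fun (R : ℝ) (ξ : R3) =>
      {R : ℝ | ξ ∈ Metric.ball (0 : R3) R⁻¹}.indicator (fun _ => ‖ξ‖ₑ ^ 2) R * dens (𝓕 f) ξ) := by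
    apply Measurable.mul _ (hdf.comp measurable_snd)
    exact Measurable.indicator (f := fun p : ℝ × R3 => ‖p.2‖ₑ ^ 2) (by fun_prop)
      measurableSet_uncurry_ball
  have m2 : Measurable (Function.uncurry fun (R : ℝ) (ξ : R3) =>
      {R : ℝ | ξ ∈ (Metric.ball (0 : R3) R⁻¹)ᶜ}.indicator
        (fun R => ENNReal.ofReal (1 / R ^ 2)) R * dens (𝓕 f) ξ) := by
    apply Measurable.mul _ (hdf.comp measurable_snd)
    exact Measurable.indicator (f := fun p : ℝ × R3 => ENNReal.ofReal (1 / p.1 ^ 2)) (by fun_prop)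
      measurableSet_uncurry_ball.compl
  have m3 : Measurable (Function.uncurry fun (y : R3) (R : ℝ) =>
      (Set.Ioi ‖a - y‖).indicator (fun R => ENNReal.ofReal (1 / R ^ 2)) R * dens f y) := by
    apply Measurable.mul _ (hd.comp measurable_fst)
    exact Measurable.indicator (f := fun p : R3 × ℝ => ENNReal.ofReal (1 / p.2 ^ 2)) (by fun_prop)
      (s := {p : R3 × ℝ | ‖a - p.1‖ < p.2}) (measurableSet_lt (by fun_prop) (by fun_prop))
  -- Integrate the ball estimate against dR/R² and exchange the R- and ξ-integrals. Low and high
  -- frequencies each contribute weight at most |ξ|, which gives the constant C + 2.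
  calc ∫⁻ y, ker 1 (a - y) * dens f y
      ≤ ∫⁻ y, ∫⁻ R in Set.Ioi (0 : ℝ),
          (Set.Ioi ‖a - y‖).indicator (fun R => ENNReal.ofReal (1 / R ^ 2)) R * dens f y := by
        apply lintegral_mono
        intro y
        simp only
        rw [lintegral_mul_const _ (Measurable.indicator (by fun_prop) measurableSet_Ioi)]
        exact mul_le_mul_left (ker_one_le _) _
    _ = ∫⁻ R in Set.Ioi (0 : ℝ), ∫⁻ y,
          (Set.Ioi ‖a - y‖).indicator (fun R => ENNReal.ofReal (1 / R ^ 2)) R * dens f y :=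
        lintegral_lintegral_swap m3.aemeasurable
    _ = ∫⁻ R in Set.Ioi (0 : ℝ), ENNReal.ofReal (1 / R ^ 2) * ∫⁻ y in Metric.ball a R, dens f y := by
        congr 1; ext R
        rw [← lintegral_const_mul _ hd, ← lintegral_indicator measurableSet_ball]
        congr 1; ext y
        have : R ∈ Set.Ioi ‖a - y‖ ↔ y ∈ Metric.ball a R := by
          rw [Metric.mem_ball, dist_comm, dist_eq_norm]; rfl
        by_cases h : y ∈ Metric.ball a R
        · rw [Set.indicator_of_mem (this.2 h), Set.indicator_of_mem h]
        · rw [Set.indicator_of_notMem (fun h' => h (this.1 h')), Set.indicator_of_notMem h, zero_mul]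
    _ ≤ ∫⁻ R in Set.Ioi (0 : ℝ),
          (C * (∫⁻ ξ, {R : ℝ | ξ ∈ Metric.ball (0 : R3) R⁻¹}.indicator (fun _ => ‖ξ‖ₑ ^ 2) R
            * dens (𝓕 f) ξ) +
          2 * ∫⁻ ξ, {R : ℝ | ξ ∈ (Metric.ball (0 : R3) R⁻¹)ᶜ}.indicator
            (fun R => ENNReal.ofReal (1 / R ^ 2)) R * dens (𝓕 f) ξ) := by
        apply setLIntegral_mono' measurableSet_Ioi
        intro R hR
        have hR' : (0 : ℝ) < R := hR
        rw [← hlow, ← hhigh]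
        refine (mul_le_mul_right (hC f a R hR') _).trans (le_of_eq ?_)
        have : ENNReal.ofReal (1 / R ^ 2) * ENNReal.ofReal (R ^ 2) = 1 := by
          rw [← ENNReal.ofReal_mul (by positivity), one_div, inv_mul_cancel₀ (by positivity),
            ENNReal.ofReal_one]
        calc _ = C * (ENNReal.ofReal (1 / R ^ 2) * ENNReal.ofReal (R ^ 2)) *
              (∫⁻ ξ in Metric.ball (0 : R3) R⁻¹, ‖ξ‖ₑ ^ 2 * dens (𝓕 f) ξ) +
              2 * (ENNReal.ofReal (1 / R ^ 2) *
                ∫⁻ ξ in (Metric.ball (0 : R3) R⁻¹)ᶜ, dens (𝓕 f) ξ) := by ring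
          _ = _ := by rw [this, mul_one]
    _ = C * (∫⁻ R in Set.Ioi (0 : ℝ), ∫⁻ ξ,
          {R : ℝ | ξ ∈ Metric.ball (0 : R3) R⁻¹}.indicator (fun _ => ‖ξ‖ₑ ^ 2) R * dens (𝓕 f) ξ) +
        2 * ∫⁻ R in Set.Ioi (0 : ℝ), ∫⁻ ξ, {R : ℝ | ξ ∈ (Metric.ball (0 : R3) R⁻¹)ᶜ}.indicator
            (fun R => ENNReal.ofReal (1 / R ^ 2)) R * dens (𝓕 f) ξ := by
        have m1' := m1.lintegral_prod_right' (ν := volume)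
        have m2' := m2.lintegral_prod_right' (ν := volume)
        simp only [Function.uncurry] at m1' m2'
        rw [lintegral_add_left (m1'.const_mul _), lintegral_const_mul _ m1',
          lintegral_const_mul _ m2']
    _ ≤ C * kinE f + 2 * kinE f := by
        rw [lintegral_lintegral_swap m1.aemeasurable, lintegral_lintegral_swap m2.aemeasurable]
        gcongr
        · apply lintegral_mono
          intro ξ
          simp only
          rw [lintegral_mul_const _ (measurable_const.indicator (measurableSet_low_radii ξ))]
          exact mul_le_mul_left (lintegral_low_weight_le ξ) _
        · apply lintegral_mono
          intro ξ
          have hms : MeasurableSet {R : ℝ | ξ ∈ (Metric.ball (0 : R3) R⁻¹)ᶜ} :=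
            (measurableSet_low_radii ξ).compl
          simp only
          rw [lintegral_mul_const _ (Measurable.indicator (by fun_prop) hms)]
          exact mul_le_mul_left (lintegral_high_weight_le ξ) _
    _ = _ := by push_cast; ring

/-! ### Riesz potentials and Riesz energies -/

/-- The Riesz potential of `g`. -/
def pot (s : ℝ) (g : R3 → ℝ≥0∞) (x : R3) : ℝ≥0∞ := ∫⁻ y, ker s (x - y) * g y

/-- The mutual Riesz energy of `g` and `h`. -/
def bil (s : ℝ) (g h : R3 → ℝ≥0∞) : ℝ≥0∞ := ∫⁻ x, g x * pot s h x

/-- The Riesz energy of `|f|²`. -/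
def rieszE (s : ℝ) (f : L2) : ℝ≥0∞ := bil s (dens f) (dens f)

/-- The Riesz energy of `|f|²` as a real number. -/
def riesz (s : ℝ) (f : L2) : ℝ := (rieszE s f).toReal

lemma measurable_ker_sub (s : ℝ) : Measurable (fun p : R3 × R3 => ker s (p.1 - p.2)) :=
  (measurable_ker s).comp (measurable_fst.sub measurable_snd)

lemma measurable_pot (s : ℝ) {g : R3 → ℝ≥0∞} (hg : Measurable g) : Measurable (pot s g) :=
  ((measurable_ker_sub s).mul (hg.comp measurable_snd)).lintegral_prod_right'

lemma ker_neg (s : ℝ) (z : R3) : ker s (-z) = ker s z := by simp [ker]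

lemma ker_sub_comm (s : ℝ) (x y : R3) : ker s (x - y) = ker s (y - x) := by
  rw [← ker_neg, neg_sub]

lemma bil_comm (s : ℝ) {g h : R3 → ℝ≥0∞} (hg : Measurable g) (hh : Measurable h) :
    bil s g h = bil s h g := by
  have hk := measurable_ker_sub s
  unfold bil pot
  have e1 : ∀ x, g x * ∫⁻ y, ker s (x - y) * h y = ∫⁻ y, g x * (ker s (x - y) * h y) := fun x =>
    (lintegral_const_mul _ ((hk.comp (measurable_const.prodMk measurable_id)).mul hh)).symm
  have e2 : ∀ x, h x * ∫⁻ y, ker s (x - y) * g y = ∫⁻ y, h x * (ker s (x - y) * g y) := fun x =>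
    (lintegral_const_mul _ ((hk.comp (measurable_const.prodMk measurable_id)).mul hg)).symm
  simp_rw [e1, e2]
  rw [lintegral_lintegral_swap (f := fun x y => g x * (ker s (x - y) * h y))
    ((hg.comp measurable_fst).mul (hk.mul (hh.comp measurable_snd))).aemeasurable]
  congr 1; ext x; congr 1; ext y
  rw [ker_sub_comm]; ring

lemma pot_mono (s : ℝ) {g h : R3 → ℝ≥0∞} (hgh : g ≤ᵐ[volume] h) (x : R3) :
    pot s g x ≤ pot s h x := by
  apply lintegral_mono_ae
  filter_upwards [hgh] with y hy
  gcongr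

lemma bil_mono (s : ℝ) {g g' h h' : R3 → ℝ≥0∞} (hg : g ≤ᵐ[volume] g') (hh : h ≤ᵐ[volume] h') :
    bil s g h ≤ bil s g' h' := by
  apply lintegral_mono_ae
  filter_upwards [hg] with x hx
  gcongr
  exact pot_mono s hh x

lemma bil_congr (s : ℝ) {g g' h h' : R3 → ℝ≥0∞} (hg : g =ᵐ[volume] g') (hh : h =ᵐ[volume] h') :
    bil s g h = bil s g' h' :=
  le_antisymm (bil_mono s hg.le hh.le) (bil_mono s hg.symm.le hh.symm.le)

lemma pot_add (s : ℝ) {g h : R3 → ℝ≥0∞} (hg : Measurable g) (x : R3) :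
    pot s (g + h) x = pot s g x + pot s h x := by
  unfold pot
  simp only [Pi.add_apply, mul_add]
  exact lintegral_add_left (((measurable_ker s).comp (measurable_const.sub measurable_id)).mul hg) _

lemma bil_add_left (s : ℝ) {g g' h : R3 → ℝ≥0∞} (hg : Measurable g) (hh : Measurable h) :
    bil s (g + g') h = bil s g h + bil s g' h := by
  unfold bil
  simp only [Pi.add_apply, add_mul]
  exact lintegral_add_left (hg.mul (measurable_pot s hh)) _

lemma bil_add_right (s : ℝ) {g h h' : R3 → ℝ≥0∞} (hg : Measurable g) (hh : Measurable h) :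
    bil s g (h + h') = bil s g h + bil s g h' := by
  unfold bil
  simp only [pot_add s hh, mul_add]
  exact lintegral_add_left (hg.mul (measurable_pot s hh)) _

lemma pot_const_mul (s : ℝ) {c : ℝ≥0∞} (hc : c ≠ ⊤) (g : R3 → ℝ≥0∞) (x : R3) :
    pot s (fun y => c * g y) x = c * pot s g x := by
  unfold pot
  rw [← lintegral_const_mul' _ _ hc]
  congr 1; ext y; ring

lemma bil_const_mul_left (s : ℝ) {c : ℝ≥0∞} (hc : c ≠ ⊤) (g h : R3 → ℝ≥0∞) :
    bil s (fun y => c * g y) h = c * bil s g h := by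
  unfold bil
  rw [← lintegral_const_mul' _ _ hc]
  congr 1; ext y; ring

lemma bil_const_mul_right (s : ℝ) {c : ℝ≥0∞} (hc : c ≠ ⊤) (g h : R3 → ℝ≥0∞) :
    bil s g (fun y => c * h y) = c * bil s g h := by
  unfold bil
  simp_rw [pot_const_mul s hc]
  rw [← lintegral_const_mul' _ _ hc]
  congr 1; ext y; ring

lemma bil_le_of_pot_le (s : ℝ) {g h : R3 → ℝ≥0∞} (hg : Measurable g) {K : ℝ≥0∞}
    (hK : ∀ x, pot s h x ≤ K) : bil s g h ≤ (∫⁻ x, g x) * K := by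
  rw [← lintegral_mul_const _ hg]
  apply lintegral_mono
  intro x
  exact mul_le_mul_right (hK x) _

/-- Split at r₀: for r ≤ r₀ write r^{-α} = r^{1-α} r⁻¹, and for r ≥ r₀ use monotonicity. The free
parameter r₀ decides how much of the Newton kernel is spent. -/
lemma rpow_inv_le {α : ℝ} (hα0 : 0 < α) (hα1 : α ≤ 1) {r r₀ : ℝ} (hr : 0 ≤ r) (hr₀ : 0 < r₀) :
    1 / r ^ α ≤ r₀ ^ (1 - α) * (1 / r ^ (1 : ℝ)) + r₀ ^ (-α) := by
  rcases hr.eq_or_lt with rfl | hr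
  · rw [Real.zero_rpow hα0.ne', Real.zero_rpow one_ne_zero]
    simp only [div_zero, mul_zero, zero_add]
    positivity
  rcases le_total r r₀ with h | h
  · have h1 : 1 / r ^ α = r ^ (1 - α) * (1 / r ^ (1 : ℝ)) := by
      rw [Real.rpow_sub hr]; field_simp
    have h2 : r ^ (1 - α) ≤ r₀ ^ (1 - α) := Real.rpow_le_rpow hr.le h (by linarith)
    rw [h1]
    have h3 : 0 ≤ r₀ ^ (-α) := by positivity
    have h4 : 0 ≤ 1 / r ^ (1 : ℝ) := by positivity
    nlinarith
  · have h1 : 1 / r ^ α = r ^ (-α) := by rw [Real.rpow_neg hr.le, one_div]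
    have h2 : r ^ (-α) ≤ r₀ ^ (-α) := Real.rpow_le_rpow_of_nonpos hr₀ h (by linarith)
    rw [h1]
    have : 0 ≤ r₀ ^ (1 - α) * (1 / r ^ (1 : ℝ)) := by positivity
    linarith

lemma ker_le {α : ℝ} (hα0 : 0 < α) (hα1 : α ≤ 1) {r₀ : ℝ} (hr₀ : 0 < r₀) (z : R3) :
    ker α z ≤ ENNReal.ofReal (r₀ ^ (1 - α)) * ker 1 z + ENNReal.ofReal (r₀ ^ (-α)) := by
  unfold ker
  rw [← ENNReal.ofReal_mul (by positivity), ← ENNReal.ofReal_add (by positivity) (by positivity)]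
  exact ENNReal.ofReal_le_ofReal (rpow_inv_le hα0 hα1 (norm_nonneg _) hr₀)

lemma pot_le {α : ℝ} (hα0 : 0 < α) (hα1 : α ≤ 1) {r₀ : ℝ} (hr₀ : 0 < r₀) {g : R3 → ℝ≥0∞}
    (hg : Measurable g) (x : R3) :
    pot α g x ≤ ENNReal.ofReal (r₀ ^ (1 - α)) * pot 1 g x
      + ENNReal.ofReal (r₀ ^ (-α)) * ∫⁻ y, g y := by
  have hk : Measurable fun y => ker 1 (x - y) :=
    (measurable_ker 1).comp (measurable_const.sub measurable_id)
  have hkg : Measurable fun y => ker 1 (x - y) * g y := hk.mul hg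
  unfold pot
  rw [← lintegral_const_mul _ hkg, ← lintegral_const_mul _ hg,
    ← lintegral_add_left (hkg.const_mul _)]
  apply lintegral_mono
  intro y
  simp only
  calc _ ≤ (ENNReal.ofReal (r₀ ^ (1 - α)) * ker 1 (x - y) + ENNReal.ofReal (r₀ ^ (-α))) * g y :=
        mul_le_mul_left (ker_le hα0 hα1 hr₀ _) _
    _ = _ := by ring

lemma bil_le {α : ℝ} (hα0 : 0 < α) (hα1 : α ≤ 1) {r₀ : ℝ} (hr₀ : 0 < r₀) {g h : R3 → ℝ≥0∞}
    (hg : Measurable g) (hh : Measurable h) :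
    bil α g h ≤ ENNReal.ofReal (r₀ ^ (1 - α)) * bil 1 g h
      + ENNReal.ofReal (r₀ ^ (-α)) * ((∫⁻ x, g x) * ∫⁻ y, h y) := by
  have hp : Measurable fun x => g x * pot 1 h x := hg.mul (measurable_pot 1 hh)
  unfold bil
  calc _ ≤ ∫⁻ x, (ENNReal.ofReal (r₀ ^ (1 - α)) * (g x * pot 1 h x)
        + ENNReal.ofReal (r₀ ^ (-α)) * (g x * ∫⁻ y, h y)) := by
        apply lintegral_mono
        intro x
        simp only
        calc _ ≤ g x * (ENNReal.ofReal (r₀ ^ (1 - α)) * pot 1 h x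
              + ENNReal.ofReal (r₀ ^ (-α)) * ∫⁻ y, h y) :=
              mul_le_mul_right (pot_le hα0 hα1 hr₀ hh x) _
          _ = _ := by ring
    _ = _ := by
        rw [lintegral_add_left (hp.const_mul _), lintegral_const_mul _ hp,
          lintegral_const_mul _ (hg.mul_const _), lintegral_mul_const _ hg]

/-- The potentials of densities with bounded mass and bounded kinetic energy are bounded. -/
lemma exists_pot_dens_le :
    ∃ C : ℝ≥0, ∀ (s : ℝ), 0 < s → s ≤ 1 → ∀ (f : L2) (a : R3),
      pot s (dens f) a ≤ C * kinE f + ∫⁻ y, dens f y := by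
  obtain ⟨C, hC⟩ := exists_kato
  refine ⟨C, fun s hs0 hs1 f a => ?_⟩
  have := pot_le hs0 hs1 one_pos (measurable_dens f) a
  simp only [Real.one_rpow, ENNReal.ofReal_one, one_mul] at this
  exact this.trans (add_le_add_left (hC f a) _)

lemma rieszE_lt_top {s : ℝ} (hs0 : 0 < s) (hs1 : s ≤ 1) {f : L2} (hf : kinE f < ⊤) :
    rieszE s f < ⊤ := by
  obtain ⟨C, hC⟩ := exists_pot_dens_le
  refine (bil_le_of_pot_le s (measurable_dens f) (hC s hs0 hs1 f)).trans_lt ?_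
  apply ENNReal.mul_lt_top (lintegral_dens_ne_top f).lt_top
  exact ENNReal.add_lt_top.2 ⟨ENNReal.mul_lt_top (by simp) hf, (lintegral_dens_ne_top f).lt_top⟩

lemma lintegral_riesz_integrand (s : ℝ) (f : L2) :
    ∫⁻ p : R3 × R3, ENNReal.ofReal (1 / ‖p.1 - p.2‖ ^ s * ‖f p.1‖ ^ 2 * ‖f p.2‖ ^ 2)
      ∂(volume.prod volume) = rieszE s f := by
  have hd := measurable_dens f
  have hk := measurable_ker_sub s
  have e : ∀ p : R3 × R3, ENNReal.ofReal (1 / ‖p.1 - p.2‖ ^ s * ‖f p.1‖ ^ 2 * ‖f p.2‖ ^ 2)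
      = dens f p.1 * (ker s (p.1 - p.2) * dens f p.2) := fun p => by
    rw [ENNReal.ofReal_mul (by positivity), ENNReal.ofReal_mul (by positivity), ofReal_norm_sq,
      ofReal_norm_sq, ker]
    ring
  have hm : Measurable fun p : R3 × R3 => dens f p.1 * (ker s (p.1 - p.2) * dens f p.2) :=
    (hd.comp measurable_fst).mul (hk.mul (hd.comp measurable_snd))
  simp_rw [e]
  rw [lintegral_prod _ hm.aemeasurable]
  unfold rieszE bil pot
  congr 1; ext x
  have hm2 : Measurable fun y => ker s (x - y) * dens f y :=
    ((measurable_ker s).comp (measurable_const.sub measurable_id)).mul hd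
  exact lintegral_const_mul (dens f x) hm2

lemma measurable_riesz_integrand (s : ℝ) (f : L2) :
    Measurable (fun p : R3 × R3 => 1 / ‖p.1 - p.2‖ ^ s * ‖f p.1‖ ^ 2 * ‖f p.2‖ ^ 2) := by
  have hf := (Lp.stronglyMeasurable f).measurable
  have h1 : Measurable fun p : R3 × R3 => ‖f p.1‖ := (hf.comp measurable_fst).norm
  have h2 : Measurable fun p : R3 × R3 => ‖f p.2‖ := (hf.comp measurable_snd).norm
  fun_prop

/-- Absolute integrability on the product space turns the iterated Bochner integrals in the
definitions into genuine double integrals, so that the interaction separates into its two Riesz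
energies. -/
lemma integrable_riesz_integrand {s : ℝ} (hs0 : 0 < s) (hs1 : s ≤ 1) {f : L2} (hf : kinE f < ⊤) :
    Integrable (fun p : R3 × R3 => 1 / ‖p.1 - p.2‖ ^ s * ‖f p.1‖ ^ 2 * ‖f p.2‖ ^ 2)
      (volume.prod volume) := by
  refine ⟨(measurable_riesz_integrand s f).aestronglyMeasurable, ?_⟩
  rw [hasFiniteIntegral_iff_ofReal (ae_of_all _ fun p => by positivity),
    lintegral_riesz_integrand]
  exact rieszE_lt_top hs0 hs1 hf

lemma integral_riesz_integrand (s : ℝ) (f : L2) :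
    ∫ p : R3 × R3, 1 / ‖p.1 - p.2‖ ^ s * ‖f p.1‖ ^ 2 * ‖f p.2‖ ^ 2 ∂(volume.prod volume)
      = riesz s f := by
  rw [integral_eq_lintegral_of_nonneg_ae (ae_of_all _ fun p => by positivity)
    (measurable_riesz_integrand s f).aestronglyMeasurable, lintegral_riesz_integrand, riesz]

lemma newtonEnergy_eq {f : L2} (hf : kinE f < ⊤) : newtonEnergy f = riesz 1 f := by
  rw [← integral_riesz_integrand, integral_prod _ (integrable_riesz_integrand one_pos le_rfl hf)]
  unfold newtonEnergy
  congr 1; ext x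
  rw [← integral_mul_const]
  congr 1; ext y
  rw [Real.rpow_one]; ring

lemma interaction_eq {α : ℝ} (hα0 : 0 < α) (hα1 : α ≤ 1) (β : ℝ) {f : L2} (hf : kinE f < ⊤) :
    interaction α β f = 1 / 4 * (β * riesz α f - riesz 1 f) := by
  have h1 := integrable_riesz_integrand one_pos le_rfl hf
  have hα := integrable_riesz_integrand hα0 hα1 hf
  rw [← integral_riesz_integrand, ← integral_riesz_integrand, ← integral_const_mul,
    ← integral_sub (hα.const_mul β) h1]
  have h2 := integral_prod _ ((hα.const_mul β).sub h1)
  simp only [Pi.sub_apply] at h2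
  rw [h2]
  unfold interaction
  congr 2; ext x; congr 1; ext y
  simp only [Real.rpow_one]
  ring

lemma mass_nonneg (f : L2) : 0 ≤ mass f := by rw [mass_eq]; positivity

lemma mass_pos {f : L2} (hf : f ≠ 0) : 0 < mass f := by
  rw [mass_eq]; have := norm_pos_iff.2 hf; positivity

lemma toReal_lintegral_dens (f : L2) : (∫⁻ x, dens f x).toReal = mass f := by
  rw [lintegral_dens, mass_eq, ENNReal.toReal_ofReal (by positivity)]

lemma lintegral_dens_eq_mass (f : L2) : ∫⁻ x, dens f x = ENNReal.ofReal (mass f) := by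
  rw [lintegral_dens, mass_eq]

lemma riesz_nonneg (s : ℝ) (f : L2) : 0 ≤ riesz s f := ENNReal.toReal_nonneg

/-! ### The relativistic symbol and the kinetic form -/

/-- The symbol of `√(-Δ + m²)`. -/
def symb (m : ℝ) (ξ : R3) : ℝ := √((2 * Real.pi * ‖ξ‖) ^ 2 + m ^ 2)

lemma symb_nonneg (m : ℝ) (ξ : R3) : 0 ≤ symb m ξ := Real.sqrt_nonneg _

lemma symb_zero (ξ : R3) : symb 0 ξ = 2 * Real.pi * ‖ξ‖ := by
  unfold symb
  rw [zero_pow two_ne_zero, add_zero, Real.sqrt_sq (by positivity)]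

lemma symb_zero_le (m : ℝ) (ξ : R3) : symb 0 ξ ≤ symb m ξ := by
  unfold symb
  apply Real.sqrt_le_sqrt
  nlinarith [sq_nonneg m]

lemma le_symb (m : ℝ) (ξ : R3) : m ≤ symb m ξ := by
  unfold symb
  apply Real.le_sqrt_of_sq_le
  nlinarith [sq_nonneg (2 * Real.pi * ‖ξ‖)]

lemma symb_le {m : ℝ} (hm : 0 ≤ m) (ξ : R3) : symb m ξ ≤ symb 0 ξ + m := by
  rw [symb_zero]
  unfold symb
  rw [Real.sqrt_le_left (by positivity)]
  have : 0 ≤ 2 * Real.pi * ‖ξ‖ := by positivity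
  nlinarith

@[fun_prop]
lemma continuous_symb (m : ℝ) : Continuous (symb m) := by unfold symb; fun_prop

lemma kinetic_eq (m : ℝ) (f : L2) : kinetic m f = ∫ ξ, symb m ξ * ‖(𝓕 f : L2) ξ‖ ^ 2 := rfl

lemma integrable_normSq (f : L2) : Integrable (fun x => ‖f x‖ ^ 2) volume :=
  (Lp.memLp f).integrable_norm_pow two_ne_zero

lemma integrable_symb_zero {f : L2} (hf : MemHHalf f) :
    Integrable (fun ξ => symb 0 ξ * ‖(𝓕 f : L2) ξ‖ ^ 2) volume := by
  rw [memHHalf_iff] at hf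
  have : Integrable (fun ξ : R3 => ‖ξ‖ * ‖(𝓕 f : L2) ξ‖ ^ 2) volume := by
    refine ⟨?_, ?_⟩
    · exact (continuous_norm.aestronglyMeasurable).mul (integrable_normSq (𝓕 f)).1
    · rw [hasFiniteIntegral_iff_ofReal (ae_of_all _ fun p => by positivity)]
      refine lt_of_eq_of_lt ?_ hf
      unfold kinE
      congr 1; ext ξ
      rw [ENNReal.ofReal_mul (norm_nonneg _), ofReal_norm_sq, ofReal_norm]
  convert this.const_mul (2 * Real.pi) using 2 with ξ
  rw [symb_zero]; ring

lemma integrable_symb (m : ℝ) {f : L2} (hf : MemHHalf f) :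
    Integrable (fun ξ => symb m ξ * ‖(𝓕 f : L2) ξ‖ ^ 2) volume := by
  have hm : symb m = symb |m| := by unfold symb; simp
  rw [hm]
  apply ((integrable_symb_zero hf).add ((integrable_normSq (𝓕 f)).const_mul |m|)).mono'
  · exact ((continuous_symb _).aestronglyMeasurable).mul (integrable_normSq (𝓕 f)).1
  · apply ae_of_all
    intro ξ
    have h0 := symb_nonneg |m| ξ
    rw [Real.norm_eq_abs, abs_of_nonneg (by positivity)]
    have := symb_le (abs_nonneg m) ξ
    simp only [Pi.add_apply]
    nlinarith [sq_nonneg ‖(𝓕 f : L2) ξ‖]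

lemma mass_fourier (f : L2) : mass (𝓕 f) = mass f := by
  rw [mass_eq, mass_eq, Lp.norm_fourier_eq]

/-- Membership in H^{1/2} is not needed: if the form is infinite, the Bochner integral and `toReal`
are both 0. -/
lemma kinetic_zero (f : L2) : kinetic 0 f = 2 * Real.pi * (kinE f).toReal := by
  rw [kinetic_eq, kinE, ← integral_toReal]
  · rw [← integral_const_mul]
    congr 1; ext ξ
    rw [symb_zero, ENNReal.toReal_mul, toReal_dens, toReal_enorm]; ring
  · exact (measurable_enorm.mul (measurable_dens _)).aemeasurable
  · exact ae_of_all _ fun ξ => ENNReal.mul_lt_top (by simp) (by simp [dens])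

lemma kinetic_nonneg (m : ℝ) (f : L2) : 0 ≤ kinetic m f := by
  rw [kinetic_eq]
  exact integral_nonneg fun ξ => mul_nonneg (symb_nonneg _ _) (by positivity)

lemma kinE_eq {f : L2} (hf : MemHHalf f) :
    kinE f = ENNReal.ofReal (kinetic 0 f / (2 * Real.pi)) := by
  rw [kinetic_zero, mul_div_cancel_left₀ _ (by positivity),
    ENNReal.ofReal_toReal ((memHHalf_iff f).1 hf).ne]

lemma kinetic_zero_le (m : ℝ) {f : L2} (hf : MemHHalf f) : kinetic 0 f ≤ kinetic m f := by
  rw [kinetic_eq, kinetic_eq]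
  apply integral_mono (integrable_symb_zero hf) (integrable_symb m hf)
  intro ξ
  exact mul_le_mul_of_nonneg_right (symb_zero_le m ξ) (by positivity)

lemma mul_mass_le_kinetic (m : ℝ) {f : L2} (hf : MemHHalf f) : m * mass f ≤ kinetic m f := by
  rw [← mass_fourier, mass, kinetic_eq, ← integral_const_mul]
  apply integral_mono ((integrable_normSq _).const_mul m) (integrable_symb m hf)
  intro ξ
  exact mul_le_mul_of_nonneg_right (le_symb m ξ) (by positivity)

lemma kinetic_le {m : ℝ} (hm : 0 ≤ m) {f : L2} (hf : MemHHalf f) :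
    kinetic m f ≤ kinetic 0 f + m * mass f := by
  rw [← mass_fourier, mass, kinetic_eq, kinetic_eq, ← integral_const_mul,
    ← integral_add (integrable_symb_zero hf) ((integrable_normSq _).const_mul m)]
  apply integral_mono (integrable_symb m hf)
    ((integrable_symb_zero hf).add ((integrable_normSq _).const_mul m))
  intro ξ
  have := mul_le_mul_of_nonneg_right (symb_le hm ξ) (sq_nonneg ‖(𝓕 f : L2) ξ‖)
  rwa [add_mul] at this

/-! ### Riesz energies controlled by kinetic energy and mass -/

lemma exists_riesz_one_le :
    ∃ C : ℝ, 0 < C ∧ ∀ f : L2, MemHHalf f → riesz 1 f ≤ C * kinetic 0 f * mass f := by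
  obtain ⟨C, hC⟩ := exists_kato
  -- Kato's constant is only known to be nonnegative; adding 1 makes the new constant positive. The
  -- factor 2π is the ratio of `kinetic 0` to `kinE`.
  refine ⟨(C + 1) / (2 * Real.pi), by positivity, fun f hf => ?_⟩
  have h := bil_le_of_pot_le 1 (measurable_dens f) (hC f)
  rw [kinE_eq hf, lintegral_dens_eq_mass] at h
  have h2 := ENNReal.toReal_mono (ENNReal.mul_ne_top (by simp) (ENNReal.mul_ne_top (by simp) (by simp))) h
  have hk := kinetic_nonneg 0 f
  have hm := mass_nonneg f
  rw [ENNReal.toReal_mul, ENNReal.toReal_mul, ENNReal.toReal_ofReal hm,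
    ENNReal.toReal_ofReal (by positivity)] at h2
  change riesz 1 f ≤ _ at h2
  simp only [ENNReal.coe_toReal] at h2
  refine h2.trans ?_
  have : (C + 1) / (2 * Real.pi) * kinetic 0 f * mass f
    = mass f * (C * (kinetic 0 f / (2 * Real.pi))) + mass f * (kinetic 0 f / (2 * Real.pi)) := by
    field_simp
  rw [this]
  have : 0 ≤ mass f * (kinetic 0 f / (2 * Real.pi)) := by positivity
  linarith

lemma riesz_le {α : ℝ} (hα0 : 0 < α) (hα1 : α ≤ 1) {r₀ : ℝ} (hr₀ : 0 < r₀) {f : L2}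
    (hf : MemHHalf f) :
    riesz α f ≤ r₀ ^ (1 - α) * riesz 1 f + r₀ ^ (-α) * mass f ^ 2 := by
  have h := bil_le hα0 hα1 hr₀ (measurable_dens f) (measurable_dens f)
  have ht := rieszE_lt_top one_pos le_rfl ((memHHalf_iff f).1 hf)
  have h2 := ENNReal.toReal_mono (ENNReal.add_ne_top.2 ⟨ENNReal.mul_ne_top (by simp) ht.ne,
    ENNReal.mul_ne_top (by simp) (ENNReal.mul_ne_top (lintegral_dens_ne_top f)
      (lintegral_dens_ne_top f))⟩) h
  change riesz α f ≤ _ at h2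
  rw [ENNReal.toReal_add (ENNReal.mul_ne_top (by simp) ht.ne)
    (ENNReal.mul_ne_top (by simp) (ENNReal.mul_ne_top (lintegral_dens_ne_top f)
      (lintegral_dens_ne_top f))), ENNReal.toReal_mul, ENNReal.toReal_mul, ENNReal.toReal_mul,
    ENNReal.toReal_ofReal (by positivity), ENNReal.toReal_ofReal (by positivity),
    toReal_lintegral_dens, ← sq] at h2
  exact h2

lemma exists_riesz_le {α : ℝ} (hα0 : 0 < α) (hα1 : α < 1) {κ : ℝ} (hκ : 0 < κ) :
    ∃ C : ℝ, 0 < C ∧ ∀ f : L2, MemHHalf f → riesz α f ≤ κ * riesz 1 f + C * mass f ^ 2 := by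
  have hpos : 0 < κ ^ ((1 - α)⁻¹) := by positivity
  -- The cut-off radius r₀ = κ^{1/(1-α)} is the one with r₀^{1-α} = κ; this is where α < 1 enters.
  refine ⟨(κ ^ ((1 - α)⁻¹)) ^ (-α), by positivity, fun f hf => ?_⟩
  have := riesz_le hα0 hα1.le hpos hf
  rwa [← Real.rpow_mul hκ.le, inv_mul_cancel₀ (by linarith), Real.rpow_one] at this

/-! ### Behaviour under scalar multiples, translations and dilations -/

section Transformations

lemma dens_smul (c : ℝ) (f : L2) :
    dens ((c : ℂ) • f) =ᵐ[volume] fun x => ENNReal.ofReal (c ^ 2) * dens f x := by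
  filter_upwards [Lp.coeFn_smul (c : ℂ) f] with x hx
  rw [← ofReal_norm_sq, hx, Pi.smul_apply, norm_smul, mul_pow, ENNReal.ofReal_mul (by positivity),
    ofReal_norm_sq, Complex.norm_real, Real.norm_eq_abs, sq_abs]

lemma mass_smul (c : ℝ) (f : L2) : mass ((c : ℂ) • f) = c ^ 2 * mass f := by
  rw [mass_eq, mass_eq, norm_smul, mul_pow, Complex.norm_real, Real.norm_eq_abs, sq_abs]

lemma MemHHalf.smul (c : ℂ) {f : L2} (hf : MemHHalf f) : MemHHalf (c • f) := by
  have := TemperedDistribution.MemSobolev.smul c hf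
  unfold MemHHalf
  rw [← Lp.toTemperedDistributionCLM_apply] at this ⊢
  rwa [map_smul]

lemma kinetic_congr {m : ℝ} {f g : L2} (h : dens (𝓕 f) =ᵐ[volume] dens (𝓕 g)) :
    kinetic m f = kinetic m g := by
  rw [kinetic_eq, kinetic_eq]
  apply integral_congr_ae
  filter_upwards [h] with ξ hξ
  rw [← toReal_dens, ← toReal_dens, hξ]

lemma kinetic_smul (m c : ℝ) (f : L2) : kinetic m ((c : ℂ) • f) = c ^ 2 * kinetic m f := by
  have : (𝓕 ((c : ℂ) • f) : L2) = (c : ℂ) • 𝓕 f := FourierTransform.fourier_smul _ _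
  rw [kinetic_eq, kinetic_eq, this, ← integral_const_mul]
  apply integral_congr_ae
  filter_upwards [dens_smul c (𝓕 f)] with ξ hξ
  rw [← toReal_dens, hξ, ENNReal.toReal_mul, toReal_dens, ENNReal.toReal_ofReal (by positivity)]
  ring

lemma riesz_smul (s c : ℝ) (f : L2) : riesz s ((c : ℂ) • f) = c ^ 4 * riesz s f := by
  unfold riesz rieszE
  rw [bil_congr s (dens_smul c f) (dens_smul c f), bil_const_mul_left s ENNReal.ofReal_ne_top,
    bil_const_mul_right s ENNReal.ofReal_ne_top, ENNReal.toReal_mul, ENNReal.toReal_mul,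
    ENNReal.toReal_ofReal (by positivity)]
  ring

lemma memHHalf_of_dens {f g : L2} (hf : MemHHalf f) (h : dens (𝓕 g) =ᵐ[volume] dens (𝓕 f)) :
    MemHHalf g := by
  rw [memHHalf_iff] at hf ⊢
  refine lt_of_eq_of_lt ?_ hf
  apply lintegral_congr_ae
  filter_upwards [h] with ξ hξ
  rw [hξ]

lemma MemHHalf.translate (a : R3) {f : L2} (hf : MemHHalf f) : MemHHalf (translate a f) :=
  memHHalf_of_dens hf (dens_fourier_translate a f)

lemma mass_translate (a : R3) (f : L2) : mass (translate a f) = mass f := by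
  rw [mass_eq, mass_eq, norm_translate]

lemma kinetic_translate (m : ℝ) (a : R3) (f : L2) : kinetic m (translate a f) = kinetic m f :=
  kinetic_congr (dens_fourier_translate a f)

lemma riesz_translate (s : ℝ) (a : R3) (f : L2) : riesz s (translate a f) = riesz s f := by
  unfold riesz rieszE
  rw [bil_congr s (dens_translate a f) (dens_translate a f)]
  congr 1
  unfold bil
  rw [← lintegral_add_right_eq_self (fun x => dens f x * pot s (dens f) x) a]
  congr 1; ext x
  congr 1
  unfold pot
  rw [← lintegral_add_right_eq_self (fun y => ker s (x + a - y) * dens f y) a]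
  simp

lemma MemHHalf.dilate {t : ℝ} (ht : 0 < t) {f : L2} (hf : MemHHalf f) :
    MemHHalf (dilate ht f) := by
  rw [memHHalf_iff] at hf ⊢
  have hti : 0 < t⁻¹ := inv_pos.2 ht
  unfold kinE at hf ⊢
  have : ∫⁻ ξ, ‖ξ‖ₑ * dens (𝓕 (BosonStar.dilate ht f)) ξ
      = ∫⁻ ξ, (ENNReal.ofReal (t⁻¹ ^ 3) * ENNReal.ofReal t) *
        (fun η : R3 => ‖η‖ₑ * dens (𝓕 f) η) (t⁻¹ • ξ) := by
    apply lintegral_congr_ae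
    filter_upwards [dens_fourier_dilate ht f] with ξ hξ
    rw [hξ, enorm_smul, ← ofReal_norm t⁻¹, Real.norm_of_nonneg hti.le]
    have : ENNReal.ofReal t * ENNReal.ofReal t⁻¹ = 1 := by
      rw [← ENNReal.ofReal_mul ht.le, mul_inv_cancel₀ ht.ne', ENNReal.ofReal_one]
    calc _ = ENNReal.ofReal (t⁻¹ ^ 3) * (‖ξ‖ₑ * dens (𝓕 f) (t⁻¹ • ξ)) * 1 := by ring
      _ = _ := by rw [← this]; ring
  have hm : Measurable fun η : R3 => ‖η‖ₑ * dens (𝓕 f) η := measurable_enorm.mul (measurable_dens _)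
  rw [this, lintegral_const_mul' _ _ (ENNReal.mul_ne_top (by simp) (by simp)),
    lintegral_comp_smul _ hm hti]
  exact ENNReal.mul_lt_top (ENNReal.mul_lt_top (by simp) (by simp))
    (ENNReal.mul_lt_top (by simp) hf)

lemma mass_dilate {t : ℝ} (ht : 0 < t) (f : L2) : mass (dilate ht f) = mass f := by
  rw [mass_eq, mass_eq, norm_dilate]

lemma symb_smul {t : ℝ} (ht : 0 < t) (m : ℝ) (ξ : R3) :
    symb m (t • ξ) = t * symb (m / t) ξ := by
  unfold symb
  rw [norm_smul, Real.norm_of_nonneg ht.le]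
  have : (2 * Real.pi * (t * ‖ξ‖)) ^ 2 + m ^ 2
      = t ^ 2 * ((2 * Real.pi * ‖ξ‖) ^ 2 + (m / t) ^ 2) := by field_simp
  rw [this, Real.sqrt_mul (by positivity), Real.sqrt_sq ht.le]

/-- Frequencies are multiplied by t, and the symbol is homogeneous in (ξ, m) jointly. Dilating is
thus the same as changing the mass parameter, and concentration (t large) makes it negligible. -/
lemma kinetic_dilate (m : ℝ) {t : ℝ} (ht : 0 < t) (f : L2) :
    kinetic m (dilate ht f) = t * kinetic (m / t) f := by
  rw [kinetic_eq, kinetic_eq]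
  have hti : 0 < t⁻¹ := inv_pos.2 ht
  have h1 : ∫ ξ, symb m ξ * ‖(𝓕 (dilate ht f) : L2) ξ‖ ^ 2
      = ∫ ξ, (fun η : R3 => t⁻¹ ^ 3 * (t * (symb (m / t) η * ‖(𝓕 f : L2) η‖ ^ 2))) (t⁻¹ • ξ) := by
    apply integral_congr_ae
    filter_upwards [dens_fourier_dilate ht f] with ξ hξ
    rw [← toReal_dens, hξ, ENNReal.toReal_mul, toReal_dens, ENNReal.toReal_ofReal (by positivity),
      ← mul_assoc t, ← symb_smul ht, smul_inv_smul₀ ht.ne']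
    ring
  rw [h1, Measure.integral_comp_smul volume
    (fun η : R3 => t⁻¹ ^ 3 * (t * (symb (m / t) η * ‖(𝓕 f : L2) η‖ ^ 2)))]
  simp only [finrank_euclideanSpace, Fintype.card_fin, smul_eq_mul]
  rw [abs_of_pos (by positivity), integral_const_mul, integral_const_mul, inv_pow, inv_inv,
    mul_inv_cancel_left₀ (by positivity)]

lemma riesz_dilate (s : ℝ) {t : ℝ} (ht : 0 < t) (f : L2) :
    riesz s (dilate ht f) = t ^ s * riesz s f := by
  have hd := measurable_dens f
  have hp (x : R3) : pot s (fun y => dens f (t • y)) x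
      = ENNReal.ofReal (t ^ s) * (ENNReal.ofReal ((t ^ 3)⁻¹) * pot s (dens f) (t • x)) := by
    unfold pot
    rw [← lintegral_comp_smul (fun y => ker s (t • x - y) * dens f y)
      (((measurable_ker s).comp (measurable_const.sub measurable_id)).mul hd) ht,
      ← lintegral_const_mul' _ _ ENNReal.ofReal_ne_top]
    congr 1; ext y
    rw [← smul_sub, ker_smul s ht, ← mul_assoc, ← mul_assoc, ← ENNReal.ofReal_mul (by positivity),
      ← Real.rpow_add ht]
    simp
  have h3 : ENNReal.ofReal (t ^ 3) * ENNReal.ofReal ((t ^ 3)⁻¹) = 1 := by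
    rw [← ENNReal.ofReal_mul (by positivity), mul_inv_cancel₀ (by positivity), ENNReal.ofReal_one]
  have h : rieszE s (dilate ht f) = ENNReal.ofReal (t ^ s) * rieszE s f := by
    unfold rieszE
    rw [bil_congr s (dens_dilate ht f) (dens_dilate ht f),
      bil_const_mul_left s ENNReal.ofReal_ne_top, bil_const_mul_right s ENNReal.ofReal_ne_top]
    unfold bil
    simp_rw [hp]
    have e (x : R3) : dens f (t • x) * (ENNReal.ofReal (t ^ s) *
        (ENNReal.ofReal ((t ^ 3)⁻¹) * pot s (dens f) (t • x)))
        = (ENNReal.ofReal (t ^ s) * ENNReal.ofReal ((t ^ 3)⁻¹)) *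
          (fun z => dens f z * pot s (dens f) z) (t • x) := by ring
    simp_rw [e]
    have hm : Measurable fun z => dens f z * pot s (dens f) z := hd.mul (measurable_pot s hd)
    rw [lintegral_const_mul' _ _ (ENNReal.mul_ne_top (by simp) (by simp)),
      lintegral_comp_smul _ hm ht]
    calc _ = ENNReal.ofReal (t ^ s) * (∫⁻ z, dens f z * pot s (dens f) z)
          * (ENNReal.ofReal (t ^ 3) * ENNReal.ofReal ((t ^ 3)⁻¹))
          * (ENNReal.ofReal (t ^ 3) * ENNReal.ofReal ((t ^ 3)⁻¹)) := by ring
      _ = _ := by rw [h3]; ring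
  unfold riesz
  rw [h, ENNReal.toReal_mul, ENNReal.toReal_ofReal (by positivity)]

end Transformations

/-! ### The critical mass, and collapse above it -/

lemma riesz_pos {s : ℝ} (hs0 : 0 < s) (hs1 : s ≤ 1) {f : L2} (hf : MemHHalf f) (hf0 : f ≠ 0) :
    0 < riesz s f := by
  have hd := measurable_dens f
  refine ENNReal.toReal_pos ?_ (rieszE_lt_top hs0 hs1 ((memHHalf_iff f).1 hf)).ne
  intro h0
  have hne : ∫⁻ x, dens f x ≠ 0 := by
    rw [lintegral_dens_eq_mass]
    simpa using mass_pos hf0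
  apply hne
  rw [lintegral_eq_zero_iff hd]
  unfold rieszE bil at h0
  have hm : Measurable fun x => dens f x * pot s (dens f) x := hd.mul (measurable_pot s hd)
  rw [lintegral_eq_zero_iff hm] at h0
  by_contra hcon
  have hpot : ∀ x, pot s (dens f) x ≠ 0 := by
    intro x hx
    apply hcon
    unfold pot at hx
    have hm2 : Measurable fun y => ker s (x - y) * dens f y :=
      ((measurable_ker s).comp (measurable_const.sub measurable_id)).mul hd
    rw [lintegral_eq_zero_iff hm2] at hx
    filter_upwards [hx, Measure.ae_ne (volume : Measure R3) x] with y hy hne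
    have hk : ker s (x - y) ≠ 0 := by
      have : 0 < ‖x - y‖ := norm_pos_iff.2 (sub_ne_zero.2 hne.symm)
      simp only [ker, ne_eq, ENNReal.ofReal_eq_zero, not_le]
      positivity
    simpa [hk] using hy
  apply hcon
  filter_upwards [h0] with x hx
  simpa [hpot x] using hx

lemma energy_eq {α : ℝ} (hα0 : 0 < α) (hα1 : α ≤ 1) (m β : ℝ) {f : L2} (hf : MemHHalf f) :
    energy m α β f = 1 / 2 * kinetic m f + 1 / 4 * (β * riesz α f - riesz 1 f) := by
  rw [energy, interaction_eq hα0 hα1 β ((memHHalf_iff f).1 hf)]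

/-- A band-limited example: the inverse transform of the indicator of the unit ball. -/
lemma exists_memHHalf_ne_zero : ∃ f : L2, MemHHalf f ∧ f ≠ 0 := by
  set g : L2 := indicatorConstLp 2 (measurableSet_ball (x := (0 : R3)) (ε := 1))
    (measure_ball_lt_top).ne (1 : ℂ) with hg
  have hge : g =ᵐ[volume] (Metric.ball (0 : R3) 1).indicator fun _ => (1 : ℂ) :=
    indicatorConstLp_coeFn
  refine ⟨𝓕⁻ g, ?_, ?_⟩
  · rw [memHHalf_iff, kinE, FourierTransform.fourier_fourierInv_eq]
    have : ∫⁻ ξ, ‖ξ‖ₑ * dens g ξ ≤ ∫⁻ ξ in Metric.ball (0 : R3) 1, 1 := by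
      rw [← lintegral_indicator measurableSet_ball]
      apply lintegral_mono_ae
      filter_upwards [hge] with ξ hξ
      rw [dens, hξ]
      by_cases h : ξ ∈ Metric.ball (0 : R3) 1
      · rw [Set.indicator_of_mem h, Set.indicator_of_mem h, ← ofReal_norm]
        have : ‖ξ‖ ≤ 1 := (mem_ball_zero_iff.1 h).le
        simp only [enorm_one, one_pow, mul_one]
        exact ENNReal.ofReal_le_one.2 this
      · simp only [Set.indicator_of_notMem h]; simp
    refine this.trans_lt ?_
    rw [setLIntegral_one]
    exact measure_ball_lt_top
  · intro h0
    have h1 : g = 0 := (Lp.fourierTransformₗᵢ R3 ℂ).symm.map_eq_zero_iff.1 h0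
    have h2 : ‖g‖ = 0 := by rw [h1, norm_zero]
    rw [hg, norm_indicatorConstLp (by norm_num) (by norm_num)] at h2
    have h3 : 0 < volume.real (Metric.ball (0 : R3) 1) :=
      ENNReal.toReal_pos (Metric.measure_ball_pos _ _ one_pos).ne' measure_ball_lt_top.ne
    have h4 : 0 < volume.real (Metric.ball (0 : R3) 1) ^ (1 / (2 : ℝ≥0∞).toReal) :=
      Real.rpow_pos_of_pos h3 _
    rw [norm_one, one_mul] at h2
    exact h4.ne' h2

lemma criticalMass_pos : 0 < criticalMass := by
  obtain ⟨C, hC, h⟩ := exists_riesz_one_le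
  obtain ⟨f, hf, hf0⟩ := exists_memHHalf_ne_zero
  have : Nonempty {ψ : L2 // MemHHalf ψ ∧ ψ ≠ 0} := ⟨⟨f, hf, hf0⟩⟩
  -- Kato's inequality bounds every quotient from below by a positive constant.
  have : C⁻¹ ≤ ⨅ ψ : {ψ : L2 // MemHHalf ψ ∧ ψ ≠ 0},
      kinetic 0 ψ.1 * mass ψ.1 / newtonEnergy ψ.1 := by
    apply le_ciInf
    intro ψ
    rw [newtonEnergy_eq ((memHHalf_iff _).1 ψ.2.1),
      le_div_iff₀ (riesz_pos one_pos le_rfl ψ.2.1 ψ.2.2), inv_mul_le_iff₀ hC, ← mul_assoc]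
    exact h _ ψ.2.1
  have := inv_pos.2 hC
  unfold criticalMass
  linarith

lemma criticalMass_mul_riesz_le {f : L2} (hf : MemHHalf f) :
    criticalMass * riesz 1 f ≤ 2 * (kinetic 0 f * mass f) := by
  have hk := kinetic_nonneg 0 f
  by_cases h0 : f = 0
  · obtain ⟨C, hC, h⟩ := exists_riesz_one_le
    have := h f hf
    have hm : mass f = 0 := by rw [mass_eq, h0, norm_zero]; simp
    rw [hm, mul_zero] at this
    rw [hm, le_antisymm this (riesz_nonneg 1 f)]
    simp
  have hD := riesz_pos one_pos le_rfl hf h0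
  have hb : BddBelow (Set.range fun ψ : {ψ : L2 // MemHHalf ψ ∧ ψ ≠ 0} =>
      kinetic 0 ψ.1 * mass ψ.1 / newtonEnergy ψ.1) := by
    refine ⟨0, ?_⟩
    rintro _ ⟨ψ, rfl⟩
    simp only
    rw [newtonEnergy_eq ((memHHalf_iff _).1 ψ.2.1)]
    exact div_nonneg (mul_nonneg (kinetic_nonneg _ _) (mass_nonneg _)) (riesz_nonneg _ _)
  have h1 := ciInf_le hb ⟨f, hf, h0⟩
  simp only [newtonEnergy_eq ((memHHalf_iff _).1 hf)] at h1
  rw [le_div_iff₀ hD] at h1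
  unfold criticalMass
  linarith

lemma exists_of_criticalMass_lt {N : ℝ} (hN : criticalMass < N) :
    ∃ ψ : L2, MemHHalf ψ ∧ ψ ≠ 0 ∧ 2 * (kinetic 0 ψ * mass ψ) < N * riesz 1 ψ := by
  obtain ⟨f, hf, hf0⟩ := exists_memHHalf_ne_zero
  have : Nonempty {ψ : L2 // MemHHalf ψ ∧ ψ ≠ 0} := ⟨⟨f, hf, hf0⟩⟩
  have : (⨅ ψ : {ψ : L2 // MemHHalf ψ ∧ ψ ≠ 0},
      kinetic 0 ψ.1 * mass ψ.1 / newtonEnergy ψ.1) < N / 2 := by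
    unfold criticalMass at hN; linarith
  obtain ⟨ψ, hψ⟩ := exists_lt_of_ciInf_lt this
  refine ⟨ψ.1, ψ.2.1, ψ.2.2, ?_⟩
  rw [newtonEnergy_eq ((memHHalf_iff _).1 ψ.2.1),
    div_lt_iff₀ (riesz_pos one_pos le_rfl ψ.2.1 ψ.2.2)] at hψ
  linarith

/-- Every nonzero function in `H^{1/2}` can be rescaled to have mass `N`. -/
lemma exists_smul_mass_eq {f : L2} (hf0 : f ≠ 0) {N : ℝ} (hN : 0 ≤ N) :
    ∃ c : ℝ, c ^ 2 * mass f = N ∧ mass ((c : ℂ) • f) = N := by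
  have hm := mass_pos hf0
  have : √(N / mass f) ^ 2 * mass f = N := by
    rw [Real.sq_sqrt (by positivity), div_mul_cancel₀ _ hm.ne']
  exact ⟨√(N / mass f), this, by rw [mass_smul, this]⟩

lemma energy_dilate {α : ℝ} (hα0 : 0 < α) (hα1 : α ≤ 1) (m β : ℝ) {f : L2} (hf : MemHHalf f)
    {t : ℝ} (ht : 0 < t) :
    energy m α β (dilate ht f) =
      1 / 2 * (t * kinetic (m / t) f) + 1 / 4 * (β * (t ^ α * riesz α f) - t * riesz 1 f) := by
  rw [energy_eq hα0 hα1 m β (hf.dilate ht), kinetic_dilate, riesz_dilate, riesz_dilate,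
    Real.rpow_one]

/-- Above the critical mass the energy is unbounded from below. -/
theorem exists_energy_lt_of_criticalMass_lt {m α : ℝ} (hm : 0 < m) (hα0 : 0 < α) (hα1 : α < 1)
    (β : ℝ) {N : ℝ} (hN : criticalMass < N) (b : ℝ) :
    ∃ φ : L2, MemHHalf φ ∧ mass φ = N ∧ energy m α β φ < b := by
  have hN0 : 0 < N := criticalMass_pos.le.trans_lt hN
  obtain ⟨ψ, hψ, hψ0, hlt⟩ := exists_of_criticalMass_lt hN
  obtain ⟨c, hc, hcm⟩ := exists_smul_mass_eq hψ0 hN0.le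
  have hMψ := mass_pos hψ0
  have hc2 : 0 < c ^ 2 := by
    rcases (sq_nonneg c).lt_or_eq with h | h
    · exact h
    · rw [← h, zero_mul] at hc; exact absurd hc hN0.ne
  set φ : L2 := (c : ℂ) • ψ with hφ
  have hφH : MemHHalf φ := hψ.smul c
  have hγ : 2 * kinetic 0 φ < riesz 1 φ := by
    rw [hφ, kinetic_smul, riesz_smul]
    have h1 : 2 * (kinetic 0 ψ * mass ψ) < c ^ 2 * mass ψ * riesz 1 ψ := by rw [hc]; exact hlt
    have h2 : 2 * kinetic 0 ψ < c ^ 2 * riesz 1 ψ := by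
      by_contra hcon; push Not at hcon; nlinarith
    nlinarith
  set γ := 1 / 4 * riesz 1 φ - 1 / 2 * kinetic 0 φ with hγd
  have hγ0 : 0 < γ := by rw [hγd]; linarith
  -- This function of t bounds the energy of the t-dilate of φ from above. The bracket tends to -γ <
  -- 0 because α < 1 makes t^{α-1} vanish; the sign of β is irrelevant.
  have hlim : Tendsto (fun t : ℝ => t * (-γ + 1 / 4 * β * riesz α φ * t ^ (-(1 - α)))
      + 1 / 2 * (m * N)) atTop atBot := by
    apply tendsto_atBot_add_const_right
    have h1 : Tendsto (fun t : ℝ => -γ + 1 / 4 * β * riesz α φ * t ^ (-(1 - α))) atTop (𝓝 (-γ)) := by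
      have := (tendsto_rpow_neg_atTop (y := 1 - α) (by linarith)).const_mul (1 / 4 * β * riesz α φ)
      simpa using this.const_add (-γ)
    exact tendsto_id.atTop_mul_neg (by linarith) h1
  obtain ⟨t, ht0, htb⟩ := ((eventually_gt_atTop (0 : ℝ)).and (hlim.eventually_lt_atBot b)).exists
  refine ⟨dilate ht0 φ, hφH.dilate ht0, by rw [mass_dilate, hcm], lt_of_le_of_lt ?_ htb⟩
  rw [energy_dilate hα0 hα1.le m β hφH ht0]
  have hk := kinetic_le (m := m / t) (by positivity) hφH
  rw [hcm] at hk
  have hk2 : t * kinetic (m / t) φ ≤ t * kinetic 0 φ + m * N := by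
    calc _ ≤ t * (kinetic 0 φ + m / t * N) := by gcongr
      _ = _ := by field_simp
  have hp : t * t ^ (-(1 - α)) = t ^ α := by
    nth_rewrite 1 [← Real.rpow_one t]
    rw [← Real.rpow_add ht0]; ring_nf
  have e : t * (-γ + 1 / 4 * β * riesz α φ * t ^ (-(1 - α)))
      = -γ * t + 1 / 4 * β * riesz α φ * (t * t ^ (-(1 - α))) := by ring
  rw [e, hp, hγd]
  linarith

theorem groundEnergy_eq_bot {m α : ℝ} (hm : 0 < m) (hα0 : 0 < α) (hα1 : α < 1)
    (β : ℝ) {N : ℝ} (hN : criticalMass < N) : groundEnergy m α β N = ⊥ := by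
  rw [EReal.eq_bot_iff_forall_lt]
  intro b
  obtain ⟨φ, hφ, hφm, hb⟩ := exists_energy_lt_of_criticalMass_lt hm hα0 hα1 β hN b
  exact lt_of_le_of_lt (iInf_le (fun φ : {φ : L2 // MemHHalf φ ∧ mass φ = N} =>
    (energy m α β φ.1 : EReal)) ⟨φ, hφ, hφm⟩) (EReal.coe_lt_coe_iff.2 hb)

/-! ### Ground state energy below the critical mass: coercivity and strict subadditivity -/

/-- The ground state energy as a real number (meaningful below the critical mass). -/
def gs (m α β N : ℝ) : ℝ :=
  ⨅ φ : {φ : L2 // MemHHalf φ ∧ mass φ = N}, energy m α β φ.1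

lemma nonempty_mass_eq {N : ℝ} (hN : 0 ≤ N) :
    Nonempty {φ : L2 // MemHHalf φ ∧ mass φ = N} := by
  obtain ⟨f, hf, hf0⟩ := exists_memHHalf_ne_zero
  obtain ⟨c, _, hc⟩ := exists_smul_mass_eq hf0 hN
  exact ⟨⟨(c : ℂ) • f, hf.smul c, hc⟩⟩

/-- Below the critical mass the energy controls the kinetic energy. -/
lemma exists_coercive {m α : ℝ} (hα0 : 0 < α) (hα1 : α < 1) (β : ℝ) {N : ℝ}
    (hN0 : 0 < N) (hN : N < criticalMass) :
    ∃ c K : ℝ, 0 < c ∧ ∀ φ : L2, MemHHalf φ → mass φ ≤ N →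
      c * kinetic 0 φ - K ≤ energy m α β φ := by
  have hc0 : 0 < criticalMass := hN0.trans hN
  set q := N / criticalMass with hq
  have hq0 : 0 < q := by positivity
  have hq1 : q < 1 := (div_lt_one hc0).2 hN
  -- With D_1 ≤ 2qT, where T is the massless kinetic energy, the Newton term leaves the fraction 1 -
  -- q of T/2. This κ lets the β-term use up only half of that.
  set κ := (1 - q) / (2 * (|β| + 1)) with hκ
  have hκ0 : 0 < κ := by have : 0 < 1 - q := by linarith
                         positivity
  obtain ⟨C, hC, hCle⟩ := exists_riesz_le hα0 hα1 hκ0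
  refine ⟨(1 - q) / 4, 1 / 4 * |β| * (C * N ^ 2), by linarith, fun φ hφ hφm => ?_⟩
  rw [energy_eq hα0 hα1.le m β hφ]
  have h1 := criticalMass_mul_riesz_le hφ
  have hT := kinetic_nonneg 0 φ
  have hM := mass_nonneg φ
  have h2 : riesz 1 φ ≤ 2 * (q * kinetic 0 φ) := by
    rw [hq]
    have h3 : criticalMass * riesz 1 φ ≤ 2 * (kinetic 0 φ * N) := by
      refine h1.trans ?_; gcongr
    have : 2 * (N / criticalMass * kinetic 0 φ) = 2 * (kinetic 0 φ * N) / criticalMass := by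
      field_simp
    rw [this, le_div_iff₀ hc0]; linarith
  have h3 := hCle φ hφ
  have h4 : C * mass φ ^ 2 ≤ C * N ^ 2 := by gcongr
  have h5 := kinetic_zero_le m hφ
  have h6 : -(|β| * riesz α φ) ≤ β * riesz α φ := by
    have := neg_abs_le β
    have := riesz_nonneg α φ
    nlinarith
  have h7 : |β| * riesz α φ ≤ |β| * (κ * riesz 1 φ + C * N ^ 2) := by gcongr; linarith
  have h8 : |β| * κ ≤ (1 - q) / 2 := by
    rw [hκ, ← mul_div_assoc, div_le_div_iff₀ (by positivity) two_pos]
    nlinarith [abs_nonneg β]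
  have h9 : |β| * κ * riesz 1 φ ≤ (1 - q) / 2 * riesz 1 φ :=
    mul_le_mul_of_nonneg_right h8 (riesz_nonneg 1 φ)
  have h10 : (1 + (1 - q) / 2) * riesz 1 φ ≤ (1 + (1 - q) / 2) * (2 * (q * kinetic 0 φ)) := by
    apply mul_le_mul_of_nonneg_left h2; linarith
  -- The inequality reduces to 3q - q² ≤ 1 + q, that is, to (1 - q)² ≥ 0. The remaining coefficient
  -- 1/2 - (1 + q)/4 is the constant c = (1 - q)/4.
  have h11 : (1 + (1 - q) / 2) * (2 * (q * kinetic 0 φ)) ≤ (1 + q) * kinetic 0 φ := by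
    have : (1 + (1 - q) / 2) * (2 * q) ≤ 1 + q := by nlinarith [sq_nonneg (1 - q)]
    nlinarith
  nlinarith

section GroundState

variable {m α β N : ℝ}

lemma bddBelow_energy (hα0 : 0 < α) (hα1 : α < 1) (hN0 : 0 < N) (hN : N < criticalMass) :
    BddBelow (Set.range fun φ : {φ : L2 // MemHHalf φ ∧ mass φ = N} => energy m α β φ.1) := by
  obtain ⟨c, K, hc, h⟩ := exists_coercive (m := m) hα0 hα1 β hN0 hN
  refine ⟨-K, ?_⟩
  rintro _ ⟨φ, rfl⟩
  have := h φ.1 φ.2.1 φ.2.2.le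
  have := mul_nonneg hc.le (kinetic_nonneg 0 φ.1)
  simp only
  linarith

lemma gs_le (hα0 : 0 < α) (hα1 : α < 1) (hN0 : 0 < N) (hN : N < criticalMass) {φ : L2}
    (hφ : MemHHalf φ) (hφm : mass φ = N) : gs m α β N ≤ energy m α β φ :=
  ciInf_le (bddBelow_energy hα0 hα1 hN0 hN) ⟨φ, hφ, hφm⟩

lemma exists_energy_lt (hN0 : 0 < N) {b : ℝ} (hb : gs m α β N < b) :
    ∃ φ : L2, MemHHalf φ ∧ mass φ = N ∧ energy m α β φ < b := by
  have := nonempty_mass_eq hN0.le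
  obtain ⟨φ, hφ⟩ := exists_lt_of_ciInf_lt hb
  exact ⟨φ.1, φ.2.1, φ.2.2, hφ⟩

lemma le_gs (hN0 : 0 < N) {b : ℝ}
    (hb : ∀ φ : L2, MemHHalf φ → mass φ = N → b ≤ energy m α β φ) : b ≤ gs m α β N := by
  have := nonempty_mass_eq hN0.le
  exact le_ciInf fun φ => hb φ.1 φ.2.1 φ.2.2

lemma isMinimizer_of_energy_le (hα0 : 0 < α) (hα1 : α < 1) (hN0 : 0 < N) (hN : N < criticalMass)
    {φ : L2} (hφ : MemHHalf φ) (hφm : mass φ = N) (h : energy m α β φ ≤ gs m α β N) :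
    IsMinimizer m α β N φ := by
  refine ⟨hφ, hφm, le_antisymm ?_ ?_⟩
  · apply le_iInf
    intro ψ
    exact EReal.coe_le_coe_iff.2 (h.trans (gs_le hα0 hα1 hN0 hN ψ.2.1 ψ.2.2))
  · exact iInf_le (fun φ : {φ : L2 // MemHHalf φ ∧ mass φ = N} =>
      (energy m α β φ.1 : EReal)) ⟨φ, hφ, hφm⟩

lemma energy_smul (hα0 : 0 < α) (hα1 : α < 1) (c : ℝ) {φ : L2} (hφ : MemHHalf φ) :
    energy m α β ((c : ℂ) • φ) =
      c ^ 4 * energy m α β φ - c ^ 2 * (c ^ 2 - 1) * (1 / 2 * kinetic m φ) := by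
  rw [energy_eq hα0 hα1.le m β hφ, energy_eq hα0 hα1.le m β (hφ.smul _), kinetic_smul, riesz_smul,
    riesz_smul]
  ring

/-- Multiply a trial function by √k: the interaction scales like k² but the kinetic term only like
k, so k² times the energy overshoots by k(k - 1) times the kinetic term, which is at least mN/2. -/
lemma gs_scale (hα0 : 0 < α) (hα1 : α < 1) (hN0 : 0 < N) {k : ℝ} (hk : 1 ≤ k)
    (hkN : k * N < criticalMass) :
    gs m α β (k * N) ≤ k ^ 2 * gs m α β N - k * (k - 1) * (1 / 2 * (m * N)) := by
  have hk0 : 0 < k := by linarith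
  have key : (gs m α β (k * N) + k * (k - 1) * (1 / 2 * (m * N))) / k ^ 2 ≤ gs m α β N := by
    apply le_gs hN0
    intro φ hφ hφm
    rw [div_le_iff₀ (by positivity)]
    have hs : √k ^ 2 = k := Real.sq_sqrt hk0.le
    have h1 := gs_le (m := m) (β := β) hα0 hα1 (by positivity) hkN (hφ.smul ((√k : ℝ) : ℂ))
      (by rw [mass_smul, hs, hφm])
    rw [energy_smul hα0 hα1 _ hφ, hs] at h1
    have hs4 : √k ^ 4 = k ^ 2 := by rw [← hs, ← pow_mul, hs]
    rw [hs4] at h1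
    have h2 := mul_mass_le_kinetic m hφ
    rw [hφm] at h2
    have h3 : k * (k - 1) * (1 / 2 * (m * N)) ≤ k * (k - 1) * (1 / 2 * kinetic m φ) := by
      apply mul_le_mul_of_nonneg_left (by linarith)
      apply mul_nonneg hk0.le; linarith
    linarith
  rw [div_le_iff₀ (by positivity)] at key
  linarith

/-- Nonrelativistic limit: √(p² + M²) - M is at most p²/M pointwise and at most |p| uniformly in M,
so dominated convergence applies with only H^{1/2} regularity. -/
lemma tendsto_kinetic_sub {φ : L2} (hφ : MemHHalf φ) :
    Tendsto (fun M : ℝ => kinetic M φ - M * mass φ) atTop (𝓝 0) := by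
  have e (M : ℝ) : kinetic M φ - M * mass φ
      = ∫ ξ, (symb M ξ - M) * ‖(𝓕 φ : L2) ξ‖ ^ 2 := by
    rw [← mass_fourier, mass, kinetic_eq, ← integral_const_mul,
      ← integral_sub (integrable_symb M hφ) ((integrable_normSq _).const_mul M)]
    congr 1; ext ξ; ring
  simp_rw [e]
  have h0 : ∫ ξ : R3, (0 : ℝ) = 0 := integral_zero _ _
  rw [← h0]
  apply tendsto_integral_filter_of_dominated_convergence
    (fun ξ => symb 0 ξ * ‖(𝓕 φ : L2) ξ‖ ^ 2)
  · apply Eventually.of_forall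
    intro M
    exact (((continuous_symb M).sub continuous_const).aestronglyMeasurable).mul
      (integrable_normSq _).1
  · filter_upwards [eventually_ge_atTop 0] with M hM
    apply ae_of_all
    intro ξ
    rw [norm_mul, norm_pow, norm_norm, Real.norm_of_nonneg (by linarith [le_symb M ξ])]
    apply mul_le_mul_of_nonneg_right _ (by positivity)
    linarith [symb_le hM ξ]
  · exact integrable_symb_zero hφ
  · apply ae_of_all
    intro ξ
    rw [show (0 : ℝ) = 0 * ‖(𝓕 φ : L2) ξ‖ ^ 2 by ring]
    apply Tendsto.mul_const
    have h2 : Tendsto (fun M : ℝ => (symb 0 ξ) ^ 2 / M) atTop (𝓝 0) :=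
      tendsto_const_nhds.div_atTop tendsto_id
    apply tendsto_of_tendsto_of_tendsto_of_le_of_le' tendsto_const_nhds h2
    · exact Eventually.of_forall fun M => by linarith [le_symb M ξ]
    · filter_upwards [eventually_gt_atTop 0] with M hM
      rw [le_div_iff₀ hM]
      have h3 : symb M ξ ^ 2 = symb 0 ξ ^ 2 + M ^ 2 := by
        rw [symb_zero]; unfold symb; rw [Real.sq_sqrt (by positivity)]
      nlinarith [le_symb M ξ]

/-- Spread a function out. For the dilation factor t = m/M both the kinetic excess over mN/2 and the
Newton term carry a factor t, but the excess has the additional factor `kinetic M φ - M * mass φ`,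
which tends to 0 as M → ∞; so the Newton attraction wins. -/
lemma gs_lt_of_nonpos (hm : 0 < m) (hα0 : 0 < α) (hα1 : α < 1) (hβ : β ≤ 0) (hN0 : 0 < N)
    (hN : N < criticalMass) : gs m α β N < 1 / 2 * (m * N) := by
  obtain ⟨φ, hφ, hφm⟩ := nonempty_mass_eq hN0.le
  have hφ0 : φ ≠ 0 := by
    rintro rfl; rw [mass_eq, norm_zero] at hφm; norm_num at hφm; exact hN0.ne hφm
  have hD := riesz_pos one_pos le_rfl hφ hφ0
  obtain ⟨M, hM0, hM⟩ := ((eventually_gt_atTop (0 : ℝ)).and ((tendsto_kinetic_sub hφ).eventually_lt_const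
    (show 0 < 1 / 2 * riesz 1 φ by linarith))).exists
  have ht : 0 < m / M := by positivity
  refine (gs_le hα0 hα1 hN0 hN (hφ.dilate ht) (by rw [mass_dilate, hφm])).trans_lt ?_
  rw [energy_dilate hα0 hα1.le m β hφ ht]
  have e : m / (m / M) = M := by field_simp
  have h1 : β * ((m / M) ^ α * riesz α φ) ≤ 0 :=
    mul_nonpos_of_nonpos_of_nonneg hβ (mul_nonneg (by positivity) (riesz_nonneg _ _))
  have h2 : m / M * (kinetic M φ - M * mass φ) < m / M * (1 / 2 * riesz 1 φ) := by gcongr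
  have h3 : m / M * (M * mass φ) = m * N := by rw [hφm]; field_simp
  rw [e]
  nlinarith

/-- For an attractive long-range part, `gs` is strictly subadditive. -/
lemma gs_subadditive_of_nonpos (hm : 0 < m) (hα0 : 0 < α) (hα1 : α < 1) (hβ : β ≤ 0)
    (hN : N < criticalMass) {l : ℝ} (hl0 : 0 < l) (hlN : l < N) :
    gs m α β N < gs m α β l + gs m α β (N - l) := by
  -- Strict decrease of E(N)/N: with k = N/x, the strict bound E(x) < mx/2 turns `gs_scale` into
  -- E(N) < k² E(x) - k(k - 1) E(x) = k E(x).
  have key : ∀ x, 0 < x → x < N → x * gs m α β N < N * gs m α β x := by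
    intro x hx hxN
    have hk : 1 < N / x := (one_lt_div hx).2 hxN
    have h1 := gs_scale (m := m) (α := α) (β := β) hα0 hα1 hx hk.le
      (by rwa [div_mul_cancel₀ _ hx.ne'])
    rw [div_mul_cancel₀ _ hx.ne'] at h1
    have h2 := gs_lt_of_nonpos hm hα0 hα1 hβ hx (hxN.trans hN)
    have h3 : 0 < N / x * (N / x - 1) := mul_pos (by linarith) (by linarith)
    have h4 : gs m α β N < N / x * gs m α β x := by nlinarith
    have : N / x * gs m α β x = N * gs m α β x / x := by ring
    rw [this, lt_div_iff₀ hx] at h4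
    linarith
  have h1 := key l hl0 hlN
  have h2 := key (N - l) (by linarith) (by linarith)
  have hN0 : 0 < N := hl0.trans hlN
  by_contra hcon
  push Not at hcon
  nlinarith

lemma gs_nonneg (hα0 : 0 < α) (hα1 : α < 1) (hβ : 0 ≤ β) (hN0 : 0 < N)
    (hN : N < criticalMass) : 0 ≤ gs m α β N := by
  apply le_gs hN0
  intro φ hφ hφm
  rw [energy_eq hα0 hα1.le m β hφ]
  have h1 := criticalMass_mul_riesz_le hφ
  have h2 := kinetic_zero_le m hφ
  have h3 := mul_nonneg hβ (riesz_nonneg α φ)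
  have h4 := riesz_nonneg 1 φ
  have h5 := kinetic_nonneg 0 φ
  rw [hφm] at h1
  have h6 : riesz 1 φ ≤ 2 * kinetic 0 φ := by
    by_contra hcon
    push Not at hcon
    nlinarith
  linarith

/-- If the ground state energy is small, it is strictly subadditive. -/
lemma gs_subadditive_of_lt (hα0 : 0 < α) (hα1 : α < 1) (hβ : 0 ≤ β)
    (hN : N < criticalMass) (hE : gs m α β N < m * N / 6) {l : ℝ} (hl0 : 0 < l) (hlN : l < N) :
    gs m α β N < gs m α β l + gs m α β (N - l) := by
  -- Only the larger of the two pieces matters, since the other has nonnegative energy. For it k =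
  -- N/x ≤ 2, so scaling gives E(N) - E(x) ≤ (k - 1)((k + 1) E(x) - mN/2). As k + 1 ≤ 3, this is
  -- negative as soon as E(x) < mN/6, which explains the constant 6.
  have key : ∀ x, 0 < x → x < N → N ≤ 2 * x → gs m α β N < gs m α β x := by
    intro x hx hxN hx2
    rcases lt_or_ge (gs m α β x) (m * N / 6) with h | h
    · have hk : 1 < N / x := (one_lt_div hx).2 hxN
      have hk2 : N / x ≤ 2 := (div_le_iff₀ hx).2 hx2
      have h1 := gs_scale (m := m) (α := α) (β := β) hα0 hα1 hx hk.le
        (by rwa [div_mul_cancel₀ _ hx.ne'])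
      rw [div_mul_cancel₀ _ hx.ne'] at h1
      set k := N / x with hkd
      have hNx : N = k * x := by rw [hkd]; field_simp
      have h0 := gs_nonneg (m := m) hα0 hα1 hβ hx (hxN.trans hN)
      have e : k * (k - 1) * (1 / 2 * (m * x)) = (k - 1) * (1 / 2 * (m * N)) := by
        rw [hNx]; ring
      rw [e] at h1
      have h2 : (k + 1) * gs m α β x < 1 / 2 * (m * N) := by nlinarith
      have h3 : (k - 1) * ((k + 1) * gs m α β x) < (k - 1) * (1 / 2 * (m * N)) :=
        mul_lt_mul_of_pos_left h2 (by linarith)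
      nlinarith
    · exact hE.trans_le h
  have hl := gs_nonneg (m := m) hα0 hα1 hβ hl0 (hlN.trans hN)
  have hr := gs_nonneg (m := m) (N := N - l) hα0 hα1 hβ (by linarith) (by linarith)
  rcases le_total N (2 * l) with h | h
  · linarith [key l hl0 hlN h]
  · linarith [key (N - l) (by linarith) (by linarith) (by linarith)]

end GroundState

/-! ### Near-optimizers of the critical quotient and the bound E(N) < mN/6 -/

lemma kinE_low_le (A : ℝ) (f : L2) :
    kinE (low A f) ≤ ENNReal.ofReal A * ∫⁻ x, dens (low A f) x := by
  unfold kinE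
  rw [← lintegral_dens_fourier, ← lintegral_const_mul _ (measurable_dens _)]
  apply lintegral_mono_ae
  filter_upwards [dens_fourier_low A f] with ξ hξ
  rw [hξ]
  by_cases h : ξ ∈ Metric.ball (0 : R3) A
  · refine mul_le_mul_left ?_ _
    rw [← ofReal_norm]
    exact ENNReal.ofReal_le_ofReal (mem_ball_zero_iff.1 h).le
  · simp [Set.indicator_of_notMem h]

lemma kinE_high_le (A : ℝ) (f : L2) : kinE (high A f) ≤ kinE f := by
  unfold kinE
  apply lintegral_mono_ae
  filter_upwards [dens_fourier_high A f] with ξ hξ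
  rw [hξ]
  refine mul_le_mul_right ?_ _
  exact Set.indicator_le_self _ _ _

lemma memHHalf_high (A : ℝ) {f : L2} (hf : MemHHalf f) : MemHHalf (high A f) := by
  rw [memHHalf_iff] at hf ⊢
  exact (kinE_high_le A f).trans_lt hf

lemma mass_low_add_mass_high (A : ℝ) (f : L2) : mass (low A f) + mass (high A f) = mass f := by
  have h := lintegral_add_compl (μ := volume) (dens (𝓕 f)) (measurableSet_ball (x := (0 : R3)) (ε := A))
  rw [← lintegral_dens_low, ← lintegral_dens_high, lintegral_dens_fourier] at h
  rw [← toReal_lintegral_dens, ← toReal_lintegral_dens, ← toReal_lintegral_dens, ← h,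
    ENNReal.toReal_add (lintegral_dens_ne_top _) (lintegral_dens_ne_top _)]

lemma kinetic_zero_high_le (A : ℝ) {f : L2} (hf : MemHHalf f) :
    kinetic 0 (high A f) ≤ kinetic 0 f := by
  rw [kinetic_zero, kinetic_zero]
  have := ENNReal.toReal_mono ((memHHalf_iff f).1 hf).ne (kinE_high_le A f)
  have := Real.pi_pos
  gcongr

lemma dens_le_of_add_weighted {f g h : L2} (hfg : f = g + h) {κ : ℝ} (hκ : 0 < κ) :
    dens f ≤ᵐ[volume] (fun x => ENNReal.ofReal (1 + κ⁻¹) * dens g x)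
      + fun x => ENNReal.ofReal (1 + κ) * dens h x := by
  filter_upwards [Lp.coeFn_add g h] with x hx
  rw [hfg, Pi.add_apply, ← ofReal_norm_sq, ← ofReal_norm_sq, ← ofReal_norm_sq, hx,
    ← ENNReal.ofReal_mul (by positivity), ← ENNReal.ofReal_mul (by positivity),
    ← ENNReal.ofReal_add (by positivity) (by positivity)]
  apply ENNReal.ofReal_le_ofReal
  have h1 := norm_add_le (g x) (h x)
  have h2 : 2 * ‖g x‖ * ‖h x‖ ≤ κ⁻¹ * ‖g x‖ ^ 2 + κ * ‖h x‖ ^ 2 := by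
    have : κ⁻¹ * ‖g x‖ ^ 2 + κ * ‖h x‖ ^ 2 - 2 * ‖g x‖ * ‖h x‖
        = κ⁻¹ * (‖g x‖ - κ * ‖h x‖) ^ 2 := by field_simp; ring
    have : 0 ≤ κ⁻¹ * (‖g x‖ - κ * ‖h x‖) ^ 2 := by positivity
    linarith
  have h3 : ‖g x + h x‖ ^ 2 ≤ (‖g x‖ + ‖h x‖) ^ 2 := by gcongr
  simp only [Pi.add_apply]
  nlinarith

/-- Removing low frequencies changes the Newton energy only slightly. -/
lemma exists_riesz_le_high :
    ∃ C : ℝ, 0 < C ∧ ∀ (f : L2) (κ : ℝ), MemHHalf f → mass f = 1 → 0 < κ → κ ≤ 1 →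
      riesz 1 f ≤ (1 + κ) ^ 2 * riesz 1 (high (κ ^ 2) f) + C * κ := by
  obtain ⟨C, hC⟩ := exists_kato
  refine ⟨6 * (C + 1), by positivity, fun f κ hf hm hκ hκ1 => ?_⟩
  set l := low (κ ^ 2) f
  set h := high (κ ^ 2) f
  have hml : mass l ≤ 1 := by
    have := mass_low_add_mass_high (κ ^ 2) f
    have := mass_nonneg h
    linarith
  have hmh : mass h ≤ 1 := by
    have := mass_low_add_mass_high (κ ^ 2) f
    have := mass_nonneg l
    linarith
  -- Kato's inequality bounds the potential of the low part by its kinetic form, at most κ². The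
  -- weight 1 + κ⁻¹ in the splitting of the density then still leaves an error of order κ.
  have hpot (x : R3) : pot 1 (dens l) x ≤ ENNReal.ofReal (C * κ ^ 2) := by
    calc pot 1 (dens l) x ≤ C * kinE l := hC l x
      _ ≤ C * (ENNReal.ofReal (κ ^ 2) * 1) := by
        gcongr
        refine (kinE_low_le _ f).trans ?_
        gcongr
        rw [lintegral_dens_eq_mass]
        exact ENNReal.ofReal_le_one.2 hml
      _ = _ := by rw [mul_one, ENNReal.ofReal_mul (by positivity), ENNReal.ofReal_coe_nnreal]
  have hbl (g : L2) (hg : mass g ≤ 1) : bil 1 (dens g) (dens l) ≤ ENNReal.ofReal (C * κ ^ 2) := by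
    refine (bil_le_of_pot_le 1 (measurable_dens g) hpot).trans ?_
    rw [lintegral_dens_eq_mass]
    calc _ ≤ 1 * ENNReal.ofReal (C * κ ^ 2) := by
          gcongr; exact ENNReal.ofReal_le_one.2 hg
      _ = _ := one_mul _
  have hdec := dens_le_of_add_weighted (low_add_high (κ ^ 2) f) hκ
  have ml := measurable_dens l
  have mh := measurable_dens h
  have mf := measurable_dens f
  have hright (g : L2) (hg : mass g ≤ 1) : bil 1 (dens g) (dens f) ≤
      ENNReal.ofReal (1 + κ⁻¹) * ENNReal.ofReal (C * κ ^ 2)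
        + ENNReal.ofReal (1 + κ) * bil 1 (dens g) (dens h) := by
    refine (bil_mono 1 (Filter.EventuallyLE.refl _ _) hdec).trans ?_
    rw [bil_add_right 1 (measurable_dens g) (ml.const_mul _),
      bil_const_mul_right 1 ENNReal.ofReal_ne_top, bil_const_mul_right 1 ENNReal.ofReal_ne_top]
    gcongr
    exact hbl g hg
  have hmain : rieszE 1 f ≤ ENNReal.ofReal (1 + κ⁻¹) * ENNReal.ofReal (C * κ ^ 2)
      + ENNReal.ofReal (1 + κ) * (ENNReal.ofReal (1 + κ⁻¹) * ENNReal.ofReal (C * κ ^ 2)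
        + ENNReal.ofReal (1 + κ) * rieszE 1 h) := by
    refine (hright f hm.le).trans ?_
    rw [bil_comm 1 mf mh]
    gcongr
    exact hright h hmh
  have hRh := rieszE_lt_top one_pos le_rfl ((memHHalf_iff _).1 (memHHalf_high (κ ^ 2) hf))
  have hRe : rieszE 1 h = ENNReal.ofReal (riesz 1 h) := (ENNReal.ofReal_toReal hRh.ne).symm
  have hRn := riesz_nonneg 1 h
  rw [hRe, ← ENNReal.ofReal_mul (by positivity), ← ENNReal.ofReal_mul (by positivity),
    ← ENNReal.ofReal_add (by positivity) (by positivity), ← ENNReal.ofReal_mul (by positivity),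
    ← ENNReal.ofReal_add (by positivity) (by positivity)] at hmain
  have h2 := ENNReal.toReal_le_of_le_ofReal (by positivity) hmain
  change riesz 1 f ≤ _ at h2
  have e : (1 + κ⁻¹) * (C * κ ^ 2) + (1 + κ) * ((1 + κ⁻¹) * (C * κ ^ 2) + (1 + κ) * riesz 1 h)
      = (1 + κ) ^ 2 * riesz 1 h + C * κ * ((1 + κ) * (2 + κ)) := by field_simp; ring
  rw [e] at h2
  have h3 : (1 + κ) * (2 + κ) ≤ 6 := by nlinarith
  have h4 : C * κ * ((1 + κ) * (2 + κ)) ≤ C * κ * 6 := by gcongr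
  nlinarith

/-- Near-optimizers of the critical mass have little mass at low frequencies. -/
lemma exists_mass_low_le (hc : 0 < criticalMass) {μ : ℝ} (hμ : 0 < μ) :
    ∃ ε η : ℝ, 0 < ε ∧ 0 < η ∧ ∀ ψ : L2, MemHHalf ψ → mass ψ = 1 → kinetic 0 ψ = 1 →
      2 ≤ (1 + η) * (criticalMass * riesz 1 ψ) → mass (low ε ψ) ≤ μ := by
  obtain ⟨C, hC, h⟩ := exists_riesz_le_high
  -- B collects the errors of order κ: 3 from (1 + κ)² ≤ 1 + 3κ, and N_c C from the removal of low
  -- frequencies. The final estimate is x ≤ μ/2 + κB, with x the low-frequency mass.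
  set B := 3 + criticalMass * C with hB
  have hB0 : 0 < B := by positivity
  set κ := min 1 (μ / (2 * B)) with hκ
  have hκ0 : 0 < κ := by positivity
  have hκ1 : κ ≤ 1 := min_le_left _ _
  have hκB : κ * B ≤ μ / 2 := by
    have : κ ≤ μ / (2 * B) := min_le_right _ _
    calc κ * B ≤ μ / (2 * B) * B := by gcongr
      _ = μ / 2 := by field_simp
  refine ⟨κ ^ 2, μ / 2, by positivity, by positivity, fun ψ hψ hm hT hopt => ?_⟩
  have h1 := h ψ κ hψ hm hκ0 hκ1
  have h2 := criticalMass_mul_riesz_le (memHHalf_high (κ ^ 2) hψ)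
  have h3 := kinetic_zero_high_le (κ ^ 2) hψ
  have h4 := mass_low_add_mass_high (κ ^ 2) ψ
  rw [hT] at h3
  rw [hm] at h4
  have h5 := mass_nonneg (high (κ ^ 2) ψ)
  have h5' := mass_nonneg (low (κ ^ 2) ψ)
  set x := mass (low (κ ^ 2) ψ)
  set y := mass (high (κ ^ 2) ψ)
  -- The critical inequality applied to the high part alone gains the factor 1 - x from its smaller
  -- mass, while its kinetic energy is still at most 1. Near-optimality of ψ therefore makes x
  -- small.
  have h6 : criticalMass * riesz 1 (high (κ ^ 2) ψ) ≤ 2 * (1 - x) := by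
    refine h2.trans ?_
    have : y = 1 - x := by linarith
    rw [← this]
    have : kinetic 0 (high (κ ^ 2) ψ) * y ≤ 1 * y := by gcongr
    linarith
  have h7 : criticalMass * riesz 1 ψ ≤ (1 + κ) ^ 2 * (2 * (1 - x)) + criticalMass * C * κ := by
    calc criticalMass * riesz 1 ψ
        ≤ criticalMass * ((1 + κ) ^ 2 * riesz 1 (high (κ ^ 2) ψ) + C * κ) := by gcongr
      _ = (1 + κ) ^ 2 * (criticalMass * riesz 1 (high (κ ^ 2) ψ)) + criticalMass * C * κ := by ring
      _ ≤ _ := by gcongr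
  have h8 : 2 * (1 - μ / 2) ≤ criticalMass * riesz 1 ψ := by
    have : 0 < 1 + μ / 2 := by linarith
    by_contra hcon
    push Not at hcon
    nlinarith
  have h9 : (1 + κ) ^ 2 * (2 * (1 - x)) ≤ 2 * (1 - x) + 6 * κ := by
    have : x ≤ 1 := by linarith
    nlinarith [mul_nonneg hκ0.le h5', mul_nonneg (sub_nonneg.2 hκ1) hκ0.le]
  have h10 : κ * B = 3 * κ + criticalMass * C * κ := by rw [hB]; ring
  have : 0 ≤ criticalMass * C * κ := by positivity
  linarith

/-- Below frequency ε use √(p² + M²) ≤ |p| + M; above it use √(p² + M²) ≤ |p| + M²/(2|p|) with |p| ≥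
2πε. -/
lemma kinetic_le_low {M ε : ℝ} (hM : 0 ≤ M) (hε : 0 < ε) {f : L2} (hf : MemHHalf f) :
    kinetic M f ≤ kinetic 0 f + M * mass (low ε f) + M ^ 2 / (4 * Real.pi * ε) * mass f := by
  have hlow : mass (low ε f) = ∫ ξ, (Metric.ball (0 : R3) ε).indicator
      (fun ξ => ‖(𝓕 f : L2) ξ‖ ^ 2) ξ := by
    rw [← mass_fourier, mass]
    apply integral_congr_ae
    filter_upwards [fourier_low ε f] with ξ hξ
    rw [hξ]
    by_cases h : ξ ∈ Metric.ball (0 : R3) ε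
    · simp only [Set.indicator_of_mem h]
    · simp only [Set.indicator_of_notMem h]; simp
  have hi := (integrable_normSq (𝓕 f)).indicator (measurableSet_ball (x := (0 : R3)) (ε := ε))
  have hi2 : Integrable (fun ξ => symb 0 ξ * ‖(𝓕 f : L2) ξ‖ ^ 2 + M * (Metric.ball (0 : R3) ε).indicator
      (fun ξ => ‖(𝓕 f : L2) ξ‖ ^ 2) ξ) volume := (integrable_symb_zero hf).add (hi.const_mul M)
  rw [hlow, ← mass_fourier f, mass, kinetic_eq, kinetic_eq, ← integral_const_mul,
    ← integral_const_mul,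
    ← integral_add (integrable_symb_zero hf) (hi.const_mul M),
    ← integral_add hi2 ((integrable_normSq _).const_mul _)]
  apply integral_mono (integrable_symb M hf) (hi2.add ((integrable_normSq _).const_mul _))
  intro ξ
  simp only [Pi.add_apply]
  have hπ := Real.pi_pos
  have hn := sq_nonneg ‖(𝓕 f : L2) ξ‖
  by_cases h : ξ ∈ Metric.ball (0 : R3) ε
  · rw [Set.indicator_of_mem h, ← add_mul, ← add_mul]
    apply mul_le_mul_of_nonneg_right _ hn
    have := symb_le hM ξ
    have : 0 ≤ M ^ 2 / (4 * Real.pi * ε) := by positivity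
    linarith
  · rw [Set.indicator_of_notMem h, mul_zero, add_zero, ← add_mul]
    apply mul_le_mul_of_nonneg_right _ hn
    have h1 : ε ≤ ‖ξ‖ := by simpa using h
    set c := M ^ 2 / (4 * Real.pi * ε) with hc
    have hc0 : 0 ≤ c := by positivity
    have h2 : 2 * Real.pi * ε ≤ 2 * Real.pi * ‖ξ‖ := by gcongr
    have h3 : c * (2 * (2 * Real.pi * ε)) = M ^ 2 := by rw [hc]; field_simp; ring
    rw [symb_zero]
    unfold symb
    rw [Real.sqrt_le_left (by positivity)]
    nlinarith [mul_le_mul_of_nonneg_left h2 hc0]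

/-- Near-optimizers of the critical mass, normalised. -/
lemma exists_normalised_near_optimizer (hc : 0 < criticalMass) {η : ℝ} (hη : 0 < η) :
    ∃ ψ : L2, MemHHalf ψ ∧ mass ψ = 1 ∧ kinetic 0 ψ = 1 ∧
      2 ≤ (1 + η) * (criticalMass * riesz 1 ψ) := by
  have hlt : criticalMass < (1 + η) * criticalMass := by nlinarith
  obtain ⟨ψ, hψ, hψ0, h⟩ := exists_of_criticalMass_lt hlt
  obtain ⟨c, hcm, hm1⟩ := exists_smul_mass_eq hψ0 zero_le_one
  have hM := mass_pos hψ0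
  have hD := riesz_pos one_pos le_rfl hψ hψ0
  have hT : 0 < kinetic 0 ψ := by
    obtain ⟨C, hC, hCle⟩ := exists_riesz_one_le
    have := hCle ψ hψ
    by_contra hcon
    have h0 : kinetic 0 ψ = 0 := le_antisymm (not_lt.1 hcon) (kinetic_nonneg 0 ψ)
    rw [h0] at this
    linarith
  have hc2 : 0 < c ^ 2 := by
    rcases (sq_nonneg c).lt_or_eq with h | h
    · exact h
    · rw [← h, zero_mul] at hcm; norm_num at hcm
  -- Multiplication by c normalises the mass, and this dilation then normalises the massless kinetic
  -- energy; the quotient defining N_c is invariant under both.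
  have ht : 0 < (c ^ 2 * kinetic 0 ψ)⁻¹ := by positivity
  refine ⟨dilate ht ((c : ℂ) • ψ), (hψ.smul c).dilate ht, by rw [mass_dilate, hm1], ?_, ?_⟩
  · rw [kinetic_dilate, zero_div, kinetic_smul]
    exact inv_mul_cancel₀ (by positivity)
  · rw [riesz_dilate, riesz_smul, Real.rpow_one]
    have e : (1 + η) * (criticalMass * ((c ^ 2 * kinetic 0 ψ)⁻¹ * (c ^ 4 * riesz 1 ψ)))
        = (1 + η) * criticalMass * riesz 1 ψ * (c ^ 2) / kinetic 0 ψ := by field_simp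
    rw [e, le_div_iff₀ hT]
    have : 2 * (kinetic 0 ψ * mass ψ) * c ^ 2 ≤ (1 + η) * criticalMass * riesz 1 ψ * c ^ 2 := by
      gcongr
    have e2 : 2 * (kinetic 0 ψ * mass ψ) * c ^ 2 = 2 * kinetic 0 ψ * (c ^ 2 * mass ψ) := by ring
    rw [e2, hcm] at this
    linarith

/-- Close to the critical mass and for small repulsion, the ground state energy is small. -/
theorem exists_gs_lt {m α : ℝ} (hm : 0 < m) (hα0 : 0 < α) (hα1 : α < 1) (hc : 0 < criticalMass) :
    ∃ β₀ δ : ℝ, 0 < β₀ ∧ 0 < δ ∧ ∀ β N : ℝ, 0 < β → β < β₀ → 0 < N → criticalMass - δ < N →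
      N < criticalMass → gs m α β N < m * N / 6 := by
  -- The frequency scale ε is fixed before the near-optimizer is chosen. Hence the dilation factor t
  -- = m/ε is fixed too, and the accuracy η can be made small relative to m/t.
  obtain ⟨ε, η₀, hε, hη₀, hlow⟩ := exists_mass_low_le hc (μ := 1 / 12) (by norm_num)
  set t := m / ε with ht
  have ht0 : 0 < t := by positivity
  set η := min η₀ (m / (24 * t)) with hη
  have hη0 : 0 < η := by positivity
  have htη : t * η ≤ m / 24 := by
    calc t * η ≤ t * (m / (24 * t)) := by gcongr; exact min_le_right _ _
      _ = m / 24 := by field_simp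
  obtain ⟨ψ, hψ, hψm, hψT, hopt⟩ := exists_normalised_near_optimizer hc hη0
  have hR1 := riesz_nonneg 1 ψ
  have hRα := riesz_nonneg α ψ
  have hl := hlow ψ hψ hψm hψT (hopt.trans (by
    apply mul_le_mul_of_nonneg_right _ (by positivity)
    have : η ≤ η₀ := min_le_left _ _
    linarith))
  -- For N < N_c, the quantity b dominates N t^α D_α(ψ), the coefficient of β per unit mass; adding
  -- 1 keeps b positive. With β < m/(24b) the repulsion stays below m/24.
  set b := criticalMass * t ^ α * riesz α ψ + 1 with hb
  have hb0 : 0 < b := by positivity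
  refine ⟨m / (24 * b), criticalMass * (m / (24 * t)), by positivity, by positivity, ?_⟩
  intro β N hβ0 hβ hN0 hNδ hN
  have hs : √N ^ 2 = N := Real.sq_sqrt hN0.le
  have hs4 : √N ^ 4 = N ^ 2 := by rw [← hs, ← pow_mul, hs]
  have hφ := (hψ.dilate ht0).smul ((√N : ℝ) : ℂ)
  refine (gs_le hα0 hα1 hN0 hN hφ (by rw [mass_smul, mass_dilate, hψm, hs, mul_one])).trans_lt ?_
  rw [energy_eq hα0 hα1.le m β hφ, kinetic_smul, riesz_smul, riesz_smul, kinetic_dilate,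
    riesz_dilate, riesz_dilate, hs, hs4, Real.rpow_one]
  have hk := kinetic_le_low (M := m / t) (by positivity) hε hψ
  rw [hψm, hψT] at hk
  -- Since m/t = ε, the low frequencies cost at most t · ε/12 = m/12, and the high ones at most t ·
  -- ε/(4π) ≤ m/12, using π > 3.
  have hk2 : t * kinetic (m / t) ψ ≤ t + m / 12 + m / 12 := by
    have hπ : 3 < Real.pi := Real.pi_gt_three
    have e1 : m / t = ε := by rw [ht]; field_simp
    rw [e1] at hk ⊢
    have e2 : t * ε = m := by rw [ht]; field_simp
    have h1 : ε ^ 2 / (4 * Real.pi * ε) ≤ ε / 12 := by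
      rw [div_le_div_iff₀ (by positivity) (by norm_num)]
      nlinarith [sq_nonneg ε, mul_pos hε hε]
    calc t * kinetic ε ψ ≤ t * (1 + ε * (1 / 12) + ε / 12) := by
          gcongr
          refine hk.trans ?_
          have : ε * mass (low ε ψ) ≤ ε * (1 / 12) := by gcongr
          linarith
      _ = t + (t * ε) / 12 + (t * ε) / 12 := by ring
      _ = _ := by rw [e2]
  have hRlow : 2 * (1 - η) ≤ criticalMass * riesz 1 ψ := by
    by_contra hcon
    push Not at hcon
    nlinarith
  have hNR : 2 * (1 - η - m / (24 * t)) ≤ N * riesz 1 ψ := by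
    by_cases hneg : 1 - η - m / (24 * t) ≤ 0
    · have : 0 ≤ N * riesz 1 ψ := by positivity
      linarith
    push Not at hneg
    have h1 : criticalMass * (1 - m / (24 * t)) ≤ N := by linarith
    have h2 : 0 ≤ 1 - m / (24 * t) := by linarith
    calc 2 * (1 - η - m / (24 * t)) ≤ (1 - m / (24 * t)) * (2 * (1 - η)) := by
          have : 0 ≤ η * (m / (24 * t)) := by positivity
          nlinarith
      _ ≤ (1 - m / (24 * t)) * (criticalMass * riesz 1 ψ) := by gcongr
      _ = criticalMass * (1 - m / (24 * t)) * riesz 1 ψ := by ring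
      _ ≤ _ := by gcongr
  have htR : 2 * (t - m / 12) ≤ t * (N * riesz 1 ψ) := by
    have e : t * (m / (24 * t)) = m / 24 := by field_simp
    calc 2 * (t - m / 12) ≤ t * (2 * (1 - η - m / (24 * t))) := by
          have : t * (2 * (1 - η - m / (24 * t))) = 2 * (t - t * η - t * (m / (24 * t))) := by ring
          rw [this, e]; linarith
      _ ≤ _ := by gcongr
  have hβb : β * (N * (t ^ α * riesz α ψ)) ≤ m / 24 := by
    calc β * (N * (t ^ α * riesz α ψ)) ≤ m / (24 * b) * b := by
          apply mul_le_mul hβ.le _ (by positivity) (by positivity)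
          calc N * (t ^ α * riesz α ψ) ≤ criticalMass * (t ^ α * riesz α ψ) := by gcongr
            _ ≤ b := by rw [hb]; linarith
      _ = m / 24 := by field_simp
  -- The terms t/2 cancel; what remains per unit mass is at most m/12 + m/24 + m/96 = 13m/96 < m/6.
  have hfin : 1 / 2 * (t * kinetic (m / t) ψ)
      + 1 / 4 * (β * (N * (t ^ α * riesz α ψ)) - t * (N * riesz 1 ψ)) < m / 6 := by linarith
  have := mul_lt_mul_of_pos_left hfin hN0
  nlinarith

/-! ### Excluding vanishing: small local mass forces small Newton energy -/

lemma lintegral_dens_high_le {A : ℝ} (hA : 0 < A) (f : L2) :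
    ∫⁻ x, dens (high A f) x ≤ ENNReal.ofReal A⁻¹ * kinE f := by
  rw [lintegral_dens_high]
  unfold kinE
  rw [← lintegral_const_mul' _ _ ENNReal.ofReal_ne_top,
    ← lintegral_indicator measurableSet_ball.compl]
  apply lintegral_mono
  intro ξ
  by_cases h : ξ ∈ (Metric.ball (0 : R3) A)ᶜ
  · rw [Set.indicator_of_mem h]
    have h1 : A ≤ ‖ξ‖ := by simpa using h
    have h2 : 1 ≤ ENNReal.ofReal A⁻¹ * ‖ξ‖ₑ := by
      rw [← ofReal_norm, ← ENNReal.ofReal_mul (by positivity), ENNReal.one_le_ofReal,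
        inv_mul_eq_div, one_le_div hA]
      exact h1
    calc dens (𝓕 f) ξ = 1 * dens (𝓕 f) ξ := (one_mul _).symm
      _ ≤ (ENNReal.ofReal A⁻¹ * ‖ξ‖ₑ) * dens (𝓕 f) ξ := mul_le_mul_left h2 _
      _ = _ := by ring
  · rw [Set.indicator_of_notMem h]; exact zero_le

lemma sq_lintegral_fourier_le {A : ℝ} (hA : 0 < A) (f : L2) :
    (∫⁻ ξ in Metric.ball (0 : R3) A, ‖(𝓕 f : L2) ξ‖ₑ) ^ 2 ≤
      ENNReal.ofReal (A ^ 3) * volume (Metric.ball (0 : R3) 1) * ∫⁻ x, dens f x := by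
  have hm : Measurable fun ξ => ‖(𝓕 f : L2) ξ‖ₑ := (Lp.stronglyMeasurable (𝓕 f : L2)).measurable.enorm
  have h := lintegral_mul_sq_le (μ := volume.restrict (Metric.ball (0 : R3) A))
    (f := fun _ => 1) (g := fun ξ => ‖(𝓕 f : L2) ξ‖ₑ) aemeasurable_const hm.aemeasurable
  simp only [one_mul, one_pow, setLIntegral_one] at h
  rw [volume_ball_eq 0 hA] at h
  refine h.trans (mul_le_mul_right ?_ _)
  rw [← lintegral_dens_fourier]
  exact lintegral_mono' Measure.restrict_le_self le_rfl

lemma lintegral_ball_ker_sub (s : ℝ) (x : R3) (δ : ℝ) :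
    ∫⁻ y in Metric.ball x δ, ker s (x - y) = ∫⁻ z in Metric.ball (0 : R3) δ, ker s z := by
  rw [← lintegral_indicator measurableSet_ball, ← lintegral_indicator measurableSet_ball,
    ← lintegral_sub_left_eq_self ((Metric.ball (0 : R3) δ).indicator (ker s)) x]
  congr 1; ext y
  have : y ∈ Metric.ball x δ ↔ x - y ∈ Metric.ball (0 : R3) δ := by
    rw [mem_ball_zero_iff, Metric.mem_ball, dist_comm, dist_eq_norm]
  by_cases h : y ∈ Metric.ball x δ
  · rw [Set.indicator_of_mem h, Set.indicator_of_mem (this.1 h)]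
  · rw [Set.indicator_of_notMem h, Set.indicator_of_notMem (fun h' => h (this.2 h'))]

/-- The short-range part of the Newton energy is uniformly small on bounded sets of `H^{1/2}`. -/
lemma exists_short_range_le (K : ℝ≥0) {ε : ℝ} (hε : 0 < ε) :
    ∃ δ : ℝ, 0 < δ ∧ δ ≤ 1 ∧ ∀ f : L2, ∫⁻ x, dens f x ≤ K → kinE f ≤ K →
      ∫⁻ x, dens f x * ∫⁻ y in Metric.ball x δ, ker 1 (x - y) * dens f y ≤ ENNReal.ofReal ε := by
  obtain ⟨C, hC⟩ := exists_kato
  obtain ⟨C₁, hC₁⟩ := exists_lintegral_ker_ball_le (s := 1) (by norm_num)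
  set v := (volume (Metric.ball (0 : R3) 1)).toNNReal with hv
  have hvv : volume (Metric.ball (0 : R3) 1) = v := (ENNReal.coe_toNNReal volume_ball_one_ne_top).symm
  -- At most K/A of the mass lies above frequency A, and the potential of |f|² is at most CK, so
  -- this A keeps the high-frequency contribution below ε/2.
  set A : ℝ := 4 * C * K ^ 2 / ε + 1 with hA
  have hA0 : 0 < A := by positivity
  have hA2 : 2 * (A⁻¹ * K * (C * K)) ≤ ε / 2 := by
    have : 2 * (A⁻¹ * K * (C * K)) = 2 * C * K ^ 2 / A := by field_simp
    rw [this, div_le_iff₀ hA0, hA]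
    have : ε / 2 * (4 * C * K ^ 2 / ε + 1) = 2 * C * K ^ 2 + ε / 2 := by field_simp; ring
    rw [this]; linarith
  -- The low part has density at most A³ v K, and the kernel integrated over a ball of radius δ
  -- gives C₁δ². So Bδ² is the low-frequency contribution, and δ is chosen after A.
  set B : ℝ := 2 * (K * (A ^ 3 * v * K * C₁)) with hB
  have hB0 : 0 ≤ B := by positivity
  set δ := min 1 (ε / (2 * (B + 1))) with hδ
  have hδ0 : 0 < δ := by positivity
  have hδ1 : δ ≤ 1 := min_le_left _ _
  have hδB : B * δ ^ 2 ≤ ε / 2 := by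
    have h1 : δ ≤ ε / (2 * (B + 1)) := min_le_right _ _
    calc B * δ ^ 2 ≤ (B + 1) * δ := by
          have : δ ^ 2 ≤ δ := by nlinarith
          nlinarith
      _ ≤ (B + 1) * (ε / (2 * (B + 1))) := by gcongr
      _ = ε / 2 := by field_simp
  refine ⟨δ, hδ0, hδ1, fun f hfK hfT => ?_⟩
  have mf := measurable_dens f
  have ml := measurable_dens (low A f)
  have mh := measurable_dens (high A f)
  have mk (x : R3) : Measurable fun y => ker 1 (x - y) :=
    (measurable_ker 1).comp (measurable_const.sub measurable_id)
  have hS : ∀ x, ∫⁻ y in Metric.ball x δ, ker 1 (x - y) * dens (low A f) y ≤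
      ENNReal.ofReal (A ^ 3 * v * K * (C₁ * δ ^ 2)) := by
    intro x
    have hb : ∀ᵐ y, dens (low A f) y ≤ ENNReal.ofReal (A ^ 3) * v * K := by
      filter_upwards [dens_low_le A f] with y hy
      refine hy.trans ((sq_lintegral_fourier_le hA0 f).trans ?_)
      rw [hvv]; gcongr
    calc _ ≤ ∫⁻ y in Metric.ball x δ, ker 1 (x - y) * (ENNReal.ofReal (A ^ 3) * v * K) := by
          apply lintegral_mono_ae
          filter_upwards [ae_restrict_of_ae hb] with y hy
          gcongr
      _ = (∫⁻ y in Metric.ball x δ, ker 1 (x - y)) * (ENNReal.ofReal (A ^ 3) * v * K) :=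
          lintegral_mul_const _ (mk x)
      _ ≤ (C₁ * ENNReal.ofReal (δ ^ 2)) * (ENNReal.ofReal (A ^ 3) * v * K) := by
          rw [lintegral_ball_ker_sub]
          gcongr
          have := hC₁ δ hδ0
          norm_num at this
          exact this
      _ = _ := by
          rw [ENNReal.ofReal_mul (by positivity), ENNReal.ofReal_mul (by positivity),
            ENNReal.ofReal_mul (by positivity), ENNReal.ofReal_mul (by positivity),
            ENNReal.ofReal_coe_nnreal, ENNReal.ofReal_coe_nnreal, ENNReal.ofReal_coe_nnreal]
          ring
  have hpt : ∀ x, ∫⁻ y in Metric.ball x δ, ker 1 (x - y) * dens f y ≤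
      2 * ENNReal.ofReal (A ^ 3 * v * K * (C₁ * δ ^ 2)) + 2 * pot 1 (dens (high A f)) x := by
    intro x
    have mkl : Measurable fun y => ker 1 (x - y) * dens (low A f) y := (mk x).mul ml
    have mkh : Measurable fun y => ker 1 (x - y) * dens (high A f) y := (mk x).mul mh
    calc _ ≤ ∫⁻ y in Metric.ball x δ, (2 * (ker 1 (x - y) * dens (low A f) y)
          + 2 * (ker 1 (x - y) * dens (high A f) y)) := by
          apply lintegral_mono_ae
          filter_upwards [ae_restrict_of_ae (dens_le_of_add (low_add_high A f))] with y hy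
          calc _ ≤ ker 1 (x - y) * (2 * dens (low A f) y + 2 * dens (high A f) y) := by gcongr
            _ = _ := by ring
      _ = 2 * (∫⁻ y in Metric.ball x δ, ker 1 (x - y) * dens (low A f) y)
          + 2 * ∫⁻ y in Metric.ball x δ, ker 1 (x - y) * dens (high A f) y := by
          rw [lintegral_add_left (mkl.const_mul _), lintegral_const_mul _ mkl,
            lintegral_const_mul _ mkh]
      _ ≤ _ := by
          gcongr
          · exact hS x
          · exact lintegral_mono' Measure.restrict_le_self le_rfl
  have mp := measurable_pot 1 mh
  have mfp : Measurable fun x => dens f x * pot 1 (dens (high A f)) x := mf.mul mp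
  calc _ ≤ ∫⁻ x, (2 * (dens f x * ENNReal.ofReal (A ^ 3 * v * K * (C₁ * δ ^ 2)))
        + 2 * (dens f x * pot 1 (dens (high A f)) x)) := by
        apply lintegral_mono
        intro x
        calc _ ≤ dens f x * (2 * ENNReal.ofReal (A ^ 3 * v * K * (C₁ * δ ^ 2))
              + 2 * pot 1 (dens (high A f)) x) := mul_le_mul_right (hpt x) _
          _ = _ := by ring
    _ = 2 * ((∫⁻ x, dens f x) * ENNReal.ofReal (A ^ 3 * v * K * (C₁ * δ ^ 2)))
        + 2 * bil 1 (dens f) (dens (high A f)) := by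
        rw [lintegral_add_left ((mf.mul_const _).const_mul _),
          lintegral_const_mul _ (mf.mul_const _), lintegral_mul_const _ mf,
          lintegral_const_mul _ mfp, bil]
    _ ≤ 2 * (K * ENNReal.ofReal (A ^ 3 * v * K * (C₁ * δ ^ 2)))
        + 2 * ((ENNReal.ofReal A⁻¹ * K) * (C * K)) := by
        gcongr
        rw [bil_comm 1 mf mh]
        refine (bil_le_of_pot_le 1 mh (hC f)).trans ?_
        gcongr
        exact (lintegral_dens_high_le hA0 f).trans (by gcongr)
    _ = ENNReal.ofReal (B * δ ^ 2 + 2 * (A⁻¹ * K * (C * K))) := by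
        have e : B * δ ^ 2 = 2 * (K * (A ^ 3 * v * K * (C₁ * δ ^ 2))) := by rw [hB]; ring
        rw [e, ENNReal.ofReal_add (by positivity) (by positivity),
          ENNReal.ofReal_mul zero_le_two, ENNReal.ofReal_mul zero_le_two,
          ENNReal.ofReal_mul (p := (K : ℝ)) (by positivity),
          ENNReal.ofReal_mul (p := A⁻¹ * K) (by positivity),
          ENNReal.ofReal_mul (p := A⁻¹) (by positivity),
          ENNReal.ofReal_mul (p := (C : ℝ)) (by positivity)]
        simp only [ENNReal.ofReal_ofNat, ENNReal.ofReal_coe_nnreal]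
    _ ≤ ENNReal.ofReal ε := ENNReal.ofReal_le_ofReal (by linarith)

/-- If the mass of `f` in every ball of a fixed radius is small, so is its Newton energy. -/
lemma exists_nonvanishing (K : ℝ≥0) {ε : ℝ} (hε : 0 < ε) :
    ∃ R c : ℝ, 0 < R ∧ 0 < c ∧ ∀ f : L2, ∫⁻ x, dens f x ≤ K → kinE f ≤ K →
      (∀ a, ∫⁻ y in Metric.ball a R, dens f y ≤ ENNReal.ofReal c) →
      rieszE 1 f ≤ ENNReal.ofReal ε := by
  obtain ⟨δ, hδ0, hδ1, hδ⟩ := exists_short_range_le K (ε := ε / 3) (by positivity)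
  -- The kernel is cut at δ and at R into three ranges, each allotted ε/3: the short range is
  -- uniformly small, the middle range is controlled by the local mass bound c, and the long range
  -- by K²/R.
  set R : ℝ := 3 * K ^ 2 / ε + 1 with hR
  have hR0 : 0 < R := by positivity
  have hR2 : K * (R⁻¹ * K) ≤ ε / 3 := by
    have : K * (R⁻¹ * K) = K ^ 2 / R := by field_simp
    rw [this, div_le_iff₀ hR0, hR]
    have : ε / 3 * (3 * (K : ℝ) ^ 2 / ε + 1) = K ^ 2 + ε / 3 := by field_simp
    rw [this]; linarith
  set c : ℝ := ε * δ / (3 * (K + 1)) with hc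
  have hc0 : 0 < c := by positivity
  have hc2 : K * (δ⁻¹ * c) ≤ ε / 3 := by
    have : (K : ℝ) * (δ⁻¹ * c) = ε / 3 * (K / (K + 1)) := by rw [hc]; field_simp
    rw [this]
    have : (K : ℝ) / (K + 1) ≤ 1 := by rw [div_le_one (by positivity)]; linarith
    nlinarith
  refine ⟨R, c, hR0, hc0, fun f hfK hfT hv => ?_⟩
  have mf := measurable_dens f
  have mk (x : R3) : Measurable fun y => ker 1 (x - y) :=
    (measurable_ker 1).comp (measurable_const.sub measurable_id)
  have hker (x y : R3) : ker 1 (x - y) * dens f y ≤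
      (Metric.ball x δ).indicator (fun y => ker 1 (x - y) * dens f y) y
      + (ENNReal.ofReal δ⁻¹ * (Metric.ball x R).indicator (dens f) y
        + ENNReal.ofReal R⁻¹ * dens f y) := by
    have hball : ∀ r : ℝ, y ∈ Metric.ball x r ↔ ‖x - y‖ < r := fun r => by
      rw [Metric.mem_ball, dist_comm, dist_eq_norm]
    have hle : ∀ r : ℝ, 0 < r → y ∉ Metric.ball x r → ker 1 (x - y) ≤ ENNReal.ofReal r⁻¹ := by
      intro r hr hy
      rw [hball, not_lt] at hy
      rw [ker, Real.rpow_one, one_div]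
      exact ENNReal.ofReal_le_ofReal (inv_anti₀ hr hy)
    by_cases h1 : y ∈ Metric.ball x δ
    · rw [Set.indicator_of_mem h1]; exact le_self_add
    by_cases h2 : y ∈ Metric.ball x R
    · rw [Set.indicator_of_mem h2]
      exact le_add_left (le_add_right (mul_le_mul_left (hle δ hδ0 h1) _))
    · exact le_add_left (le_add_left (mul_le_mul_left (hle R hR0 h2) _))
  have hpot (x : R3) : pot 1 (dens f) x ≤ (∫⁻ y in Metric.ball x δ, ker 1 (x - y) * dens f y)
      + ENNReal.ofReal (δ⁻¹ * c + R⁻¹ * K) := by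
    have mkf : Measurable fun y => ker 1 (x - y) * dens f y := (mk x).mul mf
    calc pot 1 (dens f) x ≤ ∫⁻ y, ((Metric.ball x δ).indicator (fun y => ker 1 (x - y) * dens f y) y
          + (ENNReal.ofReal δ⁻¹ * (Metric.ball x R).indicator (dens f) y
            + ENNReal.ofReal R⁻¹ * dens f y)) := lintegral_mono (hker x)
      _ = (∫⁻ y in Metric.ball x δ, ker 1 (x - y) * dens f y)
          + (ENNReal.ofReal δ⁻¹ * (∫⁻ y in Metric.ball x R, dens f y)
            + ENNReal.ofReal R⁻¹ * ∫⁻ y, dens f y) := by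
          rw [lintegral_add_left (mkf.indicator measurableSet_ball),
            lintegral_indicator measurableSet_ball,
            lintegral_add_left ((mf.indicator measurableSet_ball).const_mul _),
            lintegral_const_mul _ (mf.indicator measurableSet_ball),
            lintegral_indicator measurableSet_ball, lintegral_const_mul _ mf]
      _ ≤ (∫⁻ y in Metric.ball x δ, ker 1 (x - y) * dens f y)
          + (ENNReal.ofReal δ⁻¹ * ENNReal.ofReal c + ENNReal.ofReal R⁻¹ * K) := by
          gcongr
          exact hv x
      _ = _ := by
          rw [ENNReal.ofReal_add (by positivity) (by positivity),
            ENNReal.ofReal_mul (p := δ⁻¹) (by positivity),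
            ENNReal.ofReal_mul (p := R⁻¹) (by positivity), ENNReal.ofReal_coe_nnreal]
  calc rieszE 1 f ≤ ∫⁻ x, (dens f x * (∫⁻ y in Metric.ball x δ, ker 1 (x - y) * dens f y)
        + dens f x * ENNReal.ofReal (δ⁻¹ * c + R⁻¹ * K)) := by
        apply lintegral_mono
        intro x
        simp only
        rw [← mul_add]
        exact mul_le_mul_right (hpot x) _
    _ = (∫⁻ x, dens f x * ∫⁻ y in Metric.ball x δ, ker 1 (x - y) * dens f y)
        + (∫⁻ x, dens f x) * ENNReal.ofReal (δ⁻¹ * c + R⁻¹ * K) := by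
        rw [lintegral_add_right _ (mf.mul_const _), lintegral_mul_const _ mf]
    _ ≤ ENNReal.ofReal (ε / 3) + K * ENNReal.ofReal (δ⁻¹ * c + R⁻¹ * K) := by
        gcongr
        exact hδ f hfK hfT
    _ = ENNReal.ofReal (ε / 3 + K * (δ⁻¹ * c + R⁻¹ * K)) := by
        rw [ENNReal.ofReal_add (p := ε / 3) (by positivity) (by positivity),
          ENNReal.ofReal_mul (p := (K : ℝ)) (by positivity), ENNReal.ofReal_coe_nnreal]
    _ ≤ ENNReal.ofReal ε := ENNReal.ofReal_le_ofReal (by rw [mul_add]; linarith)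

/-! ### H^{1/2} as the image of L² under (-Δ + m²)^{-1/4} -/

lemma symb_pos {m : ℝ} (hm : 0 < m) (ξ : R3) : 0 < symb m ξ := hm.trans_le (le_symb m ξ)

lemma memLp_top_invSqrtSymb {m : ℝ} (hm : 0 < m) :
    MemLp (fun ξ : R3 => (((√(symb m ξ))⁻¹ : ℝ) : ℂ)) ∞ volume := by
  apply memLp_top_of_bound (C := (√m)⁻¹)
  · apply Measurable.aestronglyMeasurable
    exact Complex.measurable_ofReal.comp ((continuous_symb m).measurable.sqrt.inv)
  · apply ae_of_all
    intro ξ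
    rw [Complex.norm_real, Real.norm_of_nonneg (by positivity)]
    exact inv_anti₀ (Real.sqrt_pos.2 hm) (Real.sqrt_le_sqrt (le_symb m ξ))

/-- The operator `(-Δ + m²)^{-1/4}`, applied to a function given on the Fourier side. -/
def invSqrt {m : ℝ} (hm : 0 < m) : L2 →L[ℂ] L2 :=
  ((Lp.fourierTransformₗᵢ R3 ℂ).symm.toContinuousLinearEquiv : L2 →L[ℂ] L2) ∘L
    (ContinuousLinearMap.lsmul ℂ ℂ).holderL volume ∞ 2 2 (memLp_top_invSqrtSymb hm).toLp

lemma fourier_invSqrt {m : ℝ} (hm : 0 < m) (G : L2) :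
    (𝓕 (invSqrt hm G) : L2) =ᵐ[volume] fun ξ => (((√(symb m ξ))⁻¹ : ℝ) : ℂ) * G ξ := by
  have h : (𝓕 (invSqrt hm G) : L2)
      = (ContinuousLinearMap.lsmul ℂ ℂ).holder 2 (memLp_top_invSqrtSymb hm).toLp G :=
    (Lp.fourierTransformₗᵢ R3 ℂ).apply_symm_apply _
  rw [h]
  filter_upwards [ContinuousLinearMap.coeFn_holder (r := 2) (ContinuousLinearMap.lsmul ℂ ℂ)
    (memLp_top_invSqrtSymb hm).toLp G, (memLp_top_invSqrtSymb hm).coeFn_toLp] with ξ h1 h2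
  rw [h1, h2]
  simp

lemma symb_mul_normSq_fourier_invSqrt {m : ℝ} (hm : 0 < m) (G : L2) :
    ∀ᵐ ξ, symb m ξ * ‖(𝓕 (invSqrt hm G) : L2) ξ‖ ^ 2 = ‖G ξ‖ ^ 2 := by
  filter_upwards [fourier_invSqrt hm G] with ξ hξ
  have := symb_pos hm ξ
  rw [hξ, norm_mul, mul_pow, Complex.norm_real, Real.norm_of_nonneg (by positivity), inv_pow,
    Real.sq_sqrt this.le, mul_inv_cancel_left₀ this.ne']

/-- The reason for parametrising by G: the kinetic form becomes a Hilbert norm, so weak convergence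
of G splits it exactly, while boundedness of `invSqrt` carries weak convergence down to the
functions themselves. -/
lemma kinetic_invSqrt {m : ℝ} (hm : 0 < m) (G : L2) : kinetic m (invSqrt hm G) = ‖G‖ ^ 2 := by
  rw [kinetic_eq, ← mass_eq, mass]
  exact integral_congr_ae (symb_mul_normSq_fourier_invSqrt hm G)

lemma memHHalf_invSqrt {m : ℝ} (hm : 0 < m) (G : L2) : MemHHalf (invSqrt hm G) := by
  rw [memHHalf_iff]
  refine lt_of_le_of_lt ?_ (lintegral_dens_ne_top G).lt_top
  apply lintegral_mono_ae
  filter_upwards [symb_mul_normSq_fourier_invSqrt hm G] with ξ hξ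
  rw [← ofReal_norm_sq G, ← hξ, ENNReal.ofReal_mul (symb_nonneg _ _), ofReal_norm_sq, ← ofReal_norm]
  gcongr
  have h1 := symb_zero_le m ξ
  rw [symb_zero] at h1
  have := Real.pi_gt_three
  nlinarith [norm_nonneg ξ]

lemma exists_eq_invSqrt {m : ℝ} (hm : 0 < m) {f : L2} (hf : MemHHalf f) :
    ∃ G : L2, f = invSqrt hm G := by
  have hms : AEStronglyMeasurable (fun ξ => ((√(symb m ξ) : ℝ) : ℂ) * (𝓕 f : L2) ξ) volume := by
    apply AEStronglyMeasurable.mul _ (Lp.aestronglyMeasurable _)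
    apply Continuous.aestronglyMeasurable
    fun_prop
  have hL : MemLp (fun ξ => ((√(symb m ξ) : ℝ) : ℂ) * (𝓕 f : L2) ξ) 2 volume := by
    rw [memLp_two_iff_integrable_sq_norm hms]
    refine (integrable_symb m hf).congr (ae_of_all _ fun ξ => ?_)
    simp only
    rw [norm_mul, mul_pow, Complex.norm_real, Real.norm_of_nonneg (by positivity),
      Real.sq_sqrt (symb_nonneg _ _)]
  refine ⟨hL.toLp, ?_⟩
  apply (Lp.fourierTransformₗᵢ R3 ℂ).injective
  change (𝓕 f : L2) = 𝓕 (invSqrt hm hL.toLp)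
  apply Lp.ext
  filter_upwards [fourier_invSqrt hm hL.toLp, hL.coeFn_toLp] with ξ h1 h2
  have : (√(symb m ξ) : ℂ) ≠ 0 := by
    exact_mod_cast (Real.sqrt_pos.2 (symb_pos hm ξ)).ne'
  rw [h1, h2, Complex.ofReal_inv, inv_mul_cancel_left₀ this]

/-! ### Weak convergence and Rellich's theorem -/

/-- Weak convergence of sequences in `L²`. -/
def WeakTo (f : ℕ → L2) (g : L2) : Prop :=
  ∀ h : L2, Tendsto (fun n => inner ℂ h (f n)) atTop (𝓝 (inner ℂ h g))

/-- Sequential Banach–Alaoglu in the dual of the separable space L², transported back by the Riesz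
representation; conjugation is needed because the latter is conjugate-linear. -/
lemma exists_weakTo_subseq (f : ℕ → L2) {K : ℝ} (hK : ∀ n, ‖f n‖ ≤ K) :
    ∃ (k : ℕ → ℕ) (g : L2), StrictMono k ∧ WeakTo (fun n => f (k n)) g := by
  have : Fact ((2 : ℝ≥0∞) ≠ ∞) := ⟨by norm_num⟩
  have hs := WeakDual.isSeqCompact_closedBall ℂ L2 0 K
  let x : ℕ → WeakDual ℂ L2 := fun n => StrongDual.toWeakDual (InnerProductSpace.toDual ℂ L2 (f n))
  have hx : ∀ n, x n ∈ WeakDual.toStrongDual ⁻¹' Metric.closedBall (0 : StrongDual ℂ L2) K := by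
    intro n
    simp only [Set.mem_preimage, mem_closedBall_zero_iff]
    change ‖InnerProductSpace.toDual ℂ L2 (f n)‖ ≤ K
    rw [LinearIsometryEquiv.norm_map]
    exact hK n
  obtain ⟨L, _, k, hk, hlim⟩ := hs hx
  refine ⟨k, (InnerProductSpace.toDual ℂ L2).symm (WeakDual.toStrongDual L), hk, fun h => ?_⟩
  have h1 : Tendsto (fun n => x (k n) h) atTop (𝓝 (L h)) :=
    ((WeakDual.eval_continuous h).tendsto L).comp hlim
  have h2 : ∀ n, x (k n) h = inner ℂ (f (k n)) h := fun n => rfl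
  have h3 : L h = inner ℂ ((InnerProductSpace.toDual ℂ L2).symm (WeakDual.toStrongDual L)) h := by
    rw [InnerProductSpace.toDual_symm_apply]; rfl
  simp_rw [h2, h3] at h1
  have h4 := (Complex.continuous_conj.tendsto _).comp h1
  simpa only [Function.comp_def, inner_conj_symm] using h4

lemma WeakTo.map {f : ℕ → L2} {g : L2} (h : WeakTo f g) (T : L2 →L[ℂ] L2) :
    WeakTo (fun n => T (f n)) (T g) := by
  intro v
  simp only [← ContinuousLinearMap.adjoint_inner_left]
  exact h _

lemma WeakTo.sub_limit {f : ℕ → L2} {g : L2} (h : WeakTo f g) : WeakTo (fun n => f n - g) 0 := by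
  intro v
  have := (h v).sub_const (inner ℂ v g)
  simpa [inner_sub_right] using this

lemma WeakTo.tendsto_norm_split {f : ℕ → L2} {g : L2} (h : WeakTo f g) :
    Tendsto (fun n => ‖f n‖ ^ 2 - ‖g‖ ^ 2 - ‖f n - g‖ ^ 2) atTop (𝓝 0) := by
  have h1 := (Complex.continuous_re.tendsto _).comp (h.sub_limit g)
  have h2 : ∀ n, ‖f n‖ ^ 2 - ‖g‖ ^ 2 - ‖f n - g‖ ^ 2 = 2 * (inner ℂ g (f n - g)).re := by
    intro n
    have h3 := norm_add_sq (𝕜 := ℂ) g (f n - g)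
    rw [add_sub_cancel] at h3
    rw [h3]
    simp only [RCLike.re_to_complex]
    ring
  simp_rw [h2]
  simpa using h1.const_mul 2

lemma WeakTo.fourier {f : ℕ → L2} {g : L2} (h : WeakTo f g) :
    WeakTo (fun n => (𝓕 (f n) : L2)) (𝓕 g) :=
  h.map ((Lp.fourierTransformₗᵢ R3 ℂ).toContinuousLinearEquiv : L2 →L[ℂ] L2)

/-- The truncated inverse Fourier integral at x is the inner product of 𝓕(u n) with the conjugate
character cut off to the ball, an L² function; weak convergence of the transforms thus gives
pointwise convergence. -/
lemma tendsto_low_integral {u : ℕ → L2} (hu : WeakTo u 0) (A : ℝ) (x : R3) :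
    Tendsto (fun n => ∫ ξ in Metric.ball (0 : R3) A,
      Real.fourierChar (inner ℝ ξ x) • (𝓕 (u n) : L2) ξ) atTop (𝓝 0) := by
  have hc : Continuous fun ξ : R3 => (starRingEnd ℂ) (Real.fourierChar (inner ℝ ξ x) : ℂ) :=
    Complex.continuous_conj.comp
      (continuous_subtype_val.comp (Real.continuous_fourierChar.comp (by fun_prop)))
  have hL : MemLp ((Metric.ball (0 : R3) A).indicator
      fun ξ : R3 => (starRingEnd ℂ) (Real.fourierChar (inner ℝ ξ x) : ℂ)) 2 volume := by
    rw [memLp_indicator_iff_restrict measurableSet_ball]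
    have : IsFiniteMeasure (volume.restrict (Metric.ball (0 : R3) A)) :=
      ⟨by rw [Measure.restrict_apply_univ]; exact measure_ball_lt_top⟩
    apply MemLp.of_bound hc.aestronglyMeasurable 1
    apply ae_of_all
    intro ξ
    rw [RCLike.norm_conj, Circle.norm_coe]
  have h := hu.fourier hL.toLp
  have e : ∀ n, inner ℂ (hL.toLp : L2) (𝓕 (u n) : L2) = ∫ ξ in Metric.ball (0 : R3) A,
      Real.fourierChar (inner ℝ ξ x) • (𝓕 (u n) : L2) ξ := by
    intro n
    rw [L2.inner_def, ← integral_indicator measurableSet_ball]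
    apply integral_congr_ae
    filter_upwards [hL.coeFn_toLp] with ξ hξ
    rw [hξ]
    by_cases h : ξ ∈ Metric.ball (0 : R3) A
    · rw [Set.indicator_of_mem h, Set.indicator_of_mem h, RCLike.inner_apply, Circle.smul_def,
        smul_eq_mul]
      simp [mul_comm]
    · rw [Set.indicator_of_notMem h, Set.indicator_of_notMem h]; simp
  simp_rw [e] at h
  have h0 : (𝓕 (0 : L2) : L2) = 0 := (Lp.fourierTransformₗᵢ R3 ℂ).map_zero
  rwa [h0, inner_zero_right] at h

/-- Rellich's theorem: weak convergence in `L²` with bounded kinetic energy implies strong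
convergence on balls. -/
lemma tendsto_lintegral_ball {u : ℕ → L2} (hu : WeakTo u 0) (K : ℝ≥0)
    (hK : ∀ n, ∫⁻ x, dens (u n) x ≤ K) (hT : ∀ n, kinE (u n) ≤ K) (R : ℝ) :
    Tendsto (fun n => ∫⁻ x in Metric.ball (0 : R3) R, dens (u n) x) atTop (𝓝 0) := by
  -- For a fixed cut-off the low parts tend to 0 pointwise almost everywhere under a uniform bound,
  -- so dominated convergence applies on the bounded ball.
  have hlow : ∀ A : ℝ, 0 < A → Tendsto
      (fun n => ∫⁻ x in Metric.ball (0 : R3) R, dens (low A (u n)) x) atTop (𝓝 0) := by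
    intro A hA
    have h0 : ∫⁻ x in Metric.ball (0 : R3) R, (0 : ℝ≥0∞) = 0 := lintegral_zero
    rw [← h0]
    apply tendsto_lintegral_of_dominated_convergence
      (fun _ => ENNReal.ofReal (A ^ 3) * volume (Metric.ball (0 : R3) 1) * K)
    · intro n; exact measurable_dens _
    · intro n
      apply ae_restrict_of_ae
      filter_upwards [dens_low_le A (u n)] with x hx
      refine hx.trans ((sq_lintegral_fourier_le hA (u n)).trans ?_)
      gcongr
      exact hK n
    · rw [setLIntegral_const]
      exact ENNReal.mul_ne_top (ENNReal.mul_ne_top (ENNReal.mul_ne_top ENNReal.ofReal_ne_top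
        volume_ball_one_ne_top) ENNReal.coe_ne_top) measure_ball_lt_top.ne
    · apply ae_restrict_of_ae
      have hall : ∀ᵐ x, ∀ n, low A (u n) x = ∫ ξ in Metric.ball (0 : R3) A,
          Real.fourierChar (inner ℝ ξ x) • (𝓕 (u n) : L2) ξ :=
        ae_all_iff.2 fun n => low_ae_eq A (u n)
      filter_upwards [hall] with x hx
      have h1 := tendsto_low_integral hu A x
      have h2 := ((ENNReal.continuous_pow 2).tendsto _).comp ((continuous_enorm.tendsto _).comp h1)
      simp only [Function.comp_def, enorm_zero, ne_eq, OfNat.ofNat_ne_zero, not_false_eq_true,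
        zero_pow] at h2
      simpa only [dens, hx] using h2
  rw [ENNReal.tendsto_nhds_zero]
  intro ε hε
  obtain ⟨e, he0, heε⟩ := ENNReal.lt_iff_exists_nnreal_btwn.1 hε
  have he0' : (0 : ℝ) < e := by exact_mod_cast ENNReal.coe_pos.1 he0
  -- High frequencies carry mass at most K/A uniformly in n, so this A makes their contribution at
  -- most e/2; the low part supplies the other half.
  set A : ℝ := 4 * K / e + 1 with hA
  have hA0 : 0 < A := by positivity
  have hA2 : 2 * (A⁻¹ * K) ≤ e / 2 := by
    have : 2 * (A⁻¹ * K) = 2 * K / A := by field_simp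
    rw [this, div_le_iff₀ hA0, hA]
    have : (e : ℝ) / 2 * (4 * K / e + 1) = 2 * K + e / 2 := by field_simp; ring
    rw [this]; linarith
  have hev := (ENNReal.tendsto_nhds_zero.1 (hlow A hA0)) (ENNReal.ofReal (e / 4))
    (by simpa using he0')
  filter_upwards [hev] with n hn
  calc ∫⁻ x in Metric.ball (0 : R3) R, dens (u n) x
      ≤ ∫⁻ x in Metric.ball (0 : R3) R, (2 * dens (low A (u n)) x + 2 * dens (high A (u n)) x) :=
        lintegral_mono_ae (ae_restrict_of_ae (dens_le_of_add (low_add_high A (u n))))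
    _ = 2 * (∫⁻ x in Metric.ball (0 : R3) R, dens (low A (u n)) x)
        + 2 * ∫⁻ x in Metric.ball (0 : R3) R, dens (high A (u n)) x := by
        rw [lintegral_add_left ((measurable_dens _).const_mul _),
          lintegral_const_mul _ (measurable_dens _), lintegral_const_mul _ (measurable_dens _)]
    _ ≤ 2 * ENNReal.ofReal (e / 4) + 2 * (ENNReal.ofReal A⁻¹ * K) := by
        gcongr
        refine (lintegral_mono' Measure.restrict_le_self le_rfl).trans ?_
        refine (lintegral_dens_high_le hA0 (u n)).trans ?_
        gcongr
        exact hT n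
    _ = ENNReal.ofReal (2 * (e / 4) + 2 * (A⁻¹ * K)) := by
        rw [ENNReal.ofReal_add (by positivity) (by positivity), ENNReal.ofReal_mul zero_le_two,
          ENNReal.ofReal_mul zero_le_two, ENNReal.ofReal_mul (p := A⁻¹) (by positivity)]
        simp only [ENNReal.ofReal_ofNat, ENNReal.ofReal_coe_nnreal]
    _ ≤ ENNReal.ofReal e := ENNReal.ofReal_le_ofReal (by linarith)
    _ = e := ENNReal.ofReal_coe_nnreal
    _ ≤ ε := heε.le

/-! ### Brezis–Lieb splitting of the Riesz energies -/

/-- The cross term in the expansion of `|f + u|²`. -/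
def cross (f u : L2) (x : R3) : ℝ≥0∞ := 2 * (‖f x‖ₑ * ‖u x‖ₑ)

lemma measurable_enorm_L2 (f : L2) : Measurable fun x => ‖f x‖ₑ :=
  (Lp.stronglyMeasurable f).enorm

lemma measurable_cross (f u : L2) : Measurable (cross f u) :=
  ((measurable_enorm_L2 f).mul (measurable_enorm_L2 u)).const_mul 2

lemma ofReal_cross (f u : L2) (x : R3) : cross f u x = ENNReal.ofReal (2 * (‖f x‖ * ‖u x‖)) := by
  rw [cross, ENNReal.ofReal_mul zero_le_two, ENNReal.ofReal_mul (norm_nonneg _), ofReal_norm,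
    ofReal_norm, ENNReal.ofReal_ofNat]

lemma dens_add_le (f u : L2) : dens (f + u) ≤ᵐ[volume] dens f + dens u + cross f u := by
  filter_upwards [Lp.coeFn_add f u] with x hx
  simp only [Pi.add_apply] at hx ⊢
  rw [← ofReal_norm_sq, ← ofReal_norm_sq f, ← ofReal_norm_sq u, ofReal_cross, hx,
    ← ENNReal.ofReal_add (by positivity) (by positivity),
    ← ENNReal.ofReal_add (by positivity) (by positivity)]
  apply ENNReal.ofReal_le_ofReal
  have := pow_le_pow_left₀ (norm_nonneg _) (norm_add_le (f x) (u x)) 2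
  linarith

lemma le_dens_add (f u : L2) : dens f + dens u ≤ᵐ[volume] dens (f + u) + cross f u := by
  filter_upwards [Lp.coeFn_add f u] with x hx
  simp only [Pi.add_apply] at hx ⊢
  rw [← ofReal_norm_sq, ← ofReal_norm_sq u, ← ofReal_norm_sq (f + u), ofReal_cross, hx,
    ← ENNReal.ofReal_add (by positivity) (by positivity),
    ← ENNReal.ofReal_add (by positivity) (by positivity)]
  apply ENNReal.ofReal_le_ofReal
  have h := abs_norm_sub_norm_le (f x) (-u x)
  rw [norm_neg, sub_neg_eq_add] at h
  have := sq_le_sq' (by linarith [abs_nonneg (‖f x‖ - ‖u x‖), norm_nonneg (f x + u x)]) h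
  rw [sq_abs] at this
  linarith

/-- Replace |f + u|² by |f|² + |u|² in one argument of the bilinear energy at a time. Each cross
term then meets a density with bounded potential, so only its total integral enters. Since `ℝ≥0∞`
has no usable subtraction, the converse bound is a separate lemma. -/
lemma rieszE_add_le (s : ℝ) (f u : L2) {P : ℝ≥0∞} (hf : ∀ x, pot s (dens f) x ≤ P)
    (hu : ∀ x, pot s (dens u) x ≤ P) (hfu : ∀ x, pot s (dens (f + u)) x ≤ P) :
    rieszE s (f + u) ≤ rieszE s f + rieszE s u
      + (2 * bil s (dens f) (dens u) + 3 * ((∫⁻ x, cross f u x) * P)) := by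
  have mf := measurable_dens f
  have mu := measurable_dens u
  have mg := measurable_dens (f + u)
  have mc := measurable_cross f u
  calc rieszE s (f + u) ≤ bil s (dens (f + u)) (dens f + dens u + cross f u) :=
        bil_mono s (ae_of_all _ fun _ => le_rfl) (dens_add_le f u)
    _ = bil s (dens (f + u)) (dens f + dens u) + bil s (cross f u) (dens (f + u)) := by
        rw [bil_add_right s mg (mf.add mu), bil_comm s mg mc]
    _ ≤ bil s (dens f + dens u + cross f u) (dens f + dens u)
        + bil s (cross f u) (dens (f + u)) := by
        gcongr
        exact bil_mono s (dens_add_le f u) (ae_of_all _ fun _ => le_rfl)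
    _ = rieszE s f + rieszE s u + (2 * bil s (dens f) (dens u) + (bil s (cross f u) (dens f)
        + bil s (cross f u) (dens u) + bil s (cross f u) (dens (f + u)))) := by
        rw [bil_add_left s (mf.add mu) (mf.add mu), bil_add_left s mf (mf.add mu),
          bil_add_right s mf mf, bil_add_right s mu mf, bil_add_right s mc mf,
          bil_comm s mu mf, rieszE, rieszE]
        ring
    _ ≤ _ := by
        gcongr
        calc _ ≤ (∫⁻ x, cross f u x) * P + (∫⁻ x, cross f u x) * P + (∫⁻ x, cross f u x) * P :=
              add_le_add (add_le_add (bil_le_of_pot_le s mc hf) (bil_le_of_pot_le s mc hu))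
                (bil_le_of_pot_le s mc hfu)
          _ = _ := by ring

/-- Same scheme with the reverse triangle inequality; the mutual energy of |f|² and |u|² has the
favourable sign and needs no estimate here. -/
lemma le_rieszE_add (s : ℝ) (f u : L2) {P : ℝ≥0∞} (hf : ∀ x, pot s (dens f) x ≤ P)
    (hu : ∀ x, pot s (dens u) x ≤ P) (hfu : ∀ x, pot s (dens (f + u)) x ≤ P) :
    rieszE s f + rieszE s u ≤ rieszE s (f + u) + 3 * ((∫⁻ x, cross f u x) * P) := by
  have mf := measurable_dens f
  have mu := measurable_dens u
  have mg := measurable_dens (f + u)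
  have mc := measurable_cross f u
  calc rieszE s f + rieszE s u
      ≤ rieszE s f + bil s (dens f) (dens u) + (bil s (dens u) (dens f) + rieszE s u) :=
        add_le_add le_self_add le_add_self
    _ = bil s (dens f + dens u) (dens f + dens u) := by
        rw [bil_add_left s mf (mf.add mu), bil_add_right s mf mf, bil_add_right s mu mf, rieszE,
          rieszE]
    _ ≤ bil s (dens (f + u) + cross f u) (dens f + dens u) :=
        bil_mono s (le_dens_add f u) (ae_of_all _ fun _ => le_rfl)
    _ = bil s (dens (f + u)) (dens f + dens u)
        + (bil s (cross f u) (dens f) + bil s (cross f u) (dens u)) := by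
        rw [bil_add_left s mg (mf.add mu), bil_add_right s mc mf]
    _ ≤ bil s (dens (f + u)) (dens (f + u) + cross f u)
        + (bil s (cross f u) (dens f) + bil s (cross f u) (dens u)) := by
        gcongr
        exact bil_mono s (ae_of_all _ fun _ => le_rfl) (le_dens_add f u)
    _ = rieszE s (f + u) + (bil s (cross f u) (dens (f + u))
        + bil s (cross f u) (dens f) + bil s (cross f u) (dens u)) := by
        rw [bil_add_right s mg mg, bil_comm s mg mc, rieszE]
        ring
    _ ≤ _ := by
        gcongr
        calc _ ≤ (∫⁻ x, cross f u x) * P + (∫⁻ x, cross f u x) * P + (∫⁻ x, cross f u x) * P :=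
              add_le_add (add_le_add (bil_le_of_pot_le s mc hfu) (bil_le_of_pot_le s mc hf))
                (bil_le_of_pot_le s mc hu)
          _ = _ := by ring

lemma exists_lintegral_compl_ball_le (f : L2) {ε : ℝ≥0∞} (hε : 0 < ε) :
    ∃ R : ℝ, 0 < R ∧ ∫⁻ x in (Metric.ball (0 : R3) R)ᶜ, dens f x ≤ ε := by
  have h : Tendsto (fun n : ℕ => ∫⁻ x, (Metric.ball (0 : R3) n)ᶜ.indicator (dens f) x) atTop
      (𝓝 (∫⁻ _ : R3, (0 : ℝ≥0∞))) := by
    apply tendsto_lintegral_of_dominated_convergence (dens f)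
    · intro n; exact (measurable_dens f).indicator measurableSet_ball.compl
    · intro n; exact ae_of_all _ fun x => Set.indicator_le_self _ _ _
    · exact lintegral_dens_ne_top f
    · apply ae_of_all
      intro x
      apply tendsto_const_nhds.congr'
      filter_upwards [eventually_gt_atTop ⌈‖x‖⌉₊] with n hn
      rw [Set.indicator_of_notMem]
      simp only [Set.mem_compl_iff, Metric.mem_ball, dist_zero_right, not_not]
      exact Nat.lt_of_ceil_lt hn
  rw [lintegral_zero, ENNReal.tendsto_nhds_zero] at h
  obtain ⟨n, hn, hn0⟩ := ((h ε hε).and (eventually_gt_atTop 0)).exists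
  refine ⟨n, by exact_mod_cast hn0, ?_⟩
  rwa [← lintegral_indicator measurableSet_ball.compl]

lemma exists_pos_mul_le (M : ℝ≥0) {ε : ℝ≥0∞} (hε : 0 < ε) :
    ∃ d : ℝ≥0∞, 0 < d ∧ M * d ≤ ε := by
  refine ⟨ε / (M + 1), ENNReal.div_pos hε.ne' (by simp), ?_⟩
  calc (M : ℝ≥0∞) * (ε / (M + 1)) ≤ (M + 1) * (ε / (M + 1)) := by gcongr; exact le_self_add
    _ ≤ ε := ENNReal.mul_div_le

lemma sq_lintegral_cross_le (f u : L2) (S : Set R3) :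
    (∫⁻ x in S, cross f u x) ^ 2 ≤ 4 * ((∫⁻ x in S, dens f x) * ∫⁻ x in S, dens u x) := by
  have mf := measurable_enorm_L2 f
  have mu := measurable_enorm_L2 u
  have hfu : Measurable fun x => ‖f x‖ₑ * ‖u x‖ₑ := mf.mul mu
  unfold cross
  rw [lintegral_const_mul _ hfu, mul_pow]
  have := lintegral_mul_sq_le (μ := volume.restrict S) mf.aemeasurable mu.aemeasurable
  calc _ = 4 * (∫⁻ x in S, ‖f x‖ₑ * ‖u x‖ₑ) ^ 2 := by norm_num
    _ ≤ _ := by gcongr; exact this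

/-- Cauchy–Schwarz inside and outside a large ball: inside, u n is small by Rellich; outside, f has
a small tail. -/
lemma tendsto_lintegral_cross (f : L2) {u : ℕ → L2} (hu : WeakTo u 0) (K : ℝ≥0)
    (hf : ∫⁻ x, dens f x ≤ K) (hK : ∀ n, ∫⁻ x, dens (u n) x ≤ K) (hT : ∀ n, kinE (u n) ≤ K) :
    Tendsto (fun n => ∫⁻ x, cross f (u n) x) atTop (𝓝 0) := by
  rw [ENNReal.tendsto_nhds_zero]
  intro ε hε
  have hε2 : 0 < (ε / 2) ^ 2 := by
    have : 0 < ε / 2 := ENNReal.half_pos hε.ne'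
    positivity
  obtain ⟨d, hd0, hd⟩ := exists_pos_mul_le (4 * K) hε2
  push_cast at hd
  obtain ⟨R, hR0, hR⟩ := exists_lintegral_compl_ball_le f hd0
  filter_upwards [ENNReal.tendsto_nhds_zero.1 (tendsto_lintegral_ball hu K hK hT R) d hd0] with n hn
  have hin : ∫⁻ x in Metric.ball (0 : R3) R, cross f (u n) x ≤ ε / 2 := by
    rw [← ENNReal.pow_le_pow_left_iff two_ne_zero]
    refine (sq_lintegral_cross_le f (u n) _).trans (le_trans ?_ hd)
    rw [mul_assoc]
    gcongr
    exact (lintegral_mono' Measure.restrict_le_self le_rfl).trans hf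
  have hout : ∫⁻ x in (Metric.ball (0 : R3) R)ᶜ, cross f (u n) x ≤ ε / 2 := by
    rw [← ENNReal.pow_le_pow_left_iff two_ne_zero]
    refine (sq_lintegral_cross_le f (u n) _).trans (le_trans ?_ hd)
    rw [mul_assoc, mul_comm (K : ℝ≥0∞)]
    gcongr
    exact (lintegral_mono' Measure.restrict_le_self le_rfl).trans (hK n)
  rw [← lintegral_add_compl _ (measurableSet_ball (x := (0 : R3)) (ε := R)), ← ENNReal.add_halves ε]
  exact add_le_add hin hout

lemma bil_separated_le {s : ℝ} (hs : 0 < s) {g h : R3 → ℝ≥0∞} (hg : Measurable g)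
    (hh : Measurable h) {R D : ℝ} (hD : 0 < D) :
    bil s ((Metric.ball (0 : R3) R).indicator g) ((Metric.ball (0 : R3) (R + D))ᶜ.indicator h)
      ≤ ENNReal.ofReal (D ^ (-s)) * ((∫⁻ x, g x) * ∫⁻ x, h x) := by
  unfold bil
  calc _ ≤ ∫⁻ x, g x * (ENNReal.ofReal (D ^ (-s)) * ∫⁻ y, h y) := by
        apply lintegral_mono
        intro x
        beta_reduce
        by_cases hx : x ∈ Metric.ball (0 : R3) R
        · rw [Set.indicator_of_mem hx]
          gcongr
          unfold pot
          rw [← lintegral_const_mul _ hh]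
          apply lintegral_mono
          intro y
          by_cases hy : y ∈ Metric.ball (0 : R3) (R + D)
          · have hy' : y ∉ (Metric.ball (0 : R3) (R + D))ᶜ := fun h => h hy
            simp only [Set.indicator_of_notMem hy', mul_zero]
            exact zero_le
          · simp only [Set.indicator_of_mem (show y ∈ (Metric.ball (0 : R3) (R + D))ᶜ from hy)]
            gcongr
            unfold ker
            apply ENNReal.ofReal_le_ofReal
            rw [mem_ball_zero_iff] at hx hy
            have h1 : D ≤ ‖x - y‖ := by
              have := norm_sub_norm_le y x
              rw [norm_sub_rev] at this
              linarith
            rw [Real.rpow_neg hD.le, one_div]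
            gcongr
        · rw [Set.indicator_of_notMem hx, zero_mul]
          exact zero_le
    _ = _ := by
        rw [lintegral_mul_const _ hg]; ring

/-- Three contributions: the tail of f outside a ball of radius R; the mass of u n inside radius R +
D, which vanishes by Rellich; and the two separated pieces, for which the kernel is at most D^{-s}.
The first two use the uniform bound on potentials. -/
lemma tendsto_bil_dens {s : ℝ} (hs0 : 0 < s) (hs1 : s ≤ 1) (f : L2) {u : ℕ → L2}
    (hu : WeakTo u 0) (K : ℝ≥0) (hf : ∫⁻ x, dens f x ≤ K) (hfT : kinE f ≤ K)
    (hK : ∀ n, ∫⁻ x, dens (u n) x ≤ K) (hT : ∀ n, kinE (u n) ≤ K) :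
    Tendsto (fun n => bil s (dens f) (dens (u n))) atTop (𝓝 0) := by
  obtain ⟨C, hC⟩ := exists_pot_dens_le
  have hP : ∀ g : L2, ∫⁻ x, dens g x ≤ K → kinE g ≤ K → ∀ x,
      pot s (dens g) x ≤ ((C * K + K : ℝ≥0) : ℝ≥0∞) := by
    intro g h1 h2 x
    refine (hC s hs0 hs1 g x).trans ?_
    push_cast
    gcongr
  set P : ℝ≥0 := C * K + K
  rw [ENNReal.tendsto_nhds_zero]
  intro ε hε
  have hε3 : 0 < ε / 3 := ENNReal.div_pos hε.ne' (by norm_num)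
  obtain ⟨d, hd0, hd⟩ := exists_pos_mul_le P hε3
  obtain ⟨d', hd'0, hd'⟩ := exists_pos_mul_le (K * K) hε3
  obtain ⟨R, hR0, hR⟩ := exists_lintegral_compl_ball_le f hd0
  obtain ⟨D, hD0, hD⟩ : ∃ D : ℝ, 0 < D ∧ ENNReal.ofReal (D ^ (-s)) ≤ d' := by
    have h1 : Tendsto (fun D : ℝ => ENNReal.ofReal (D ^ (-s))) atTop (𝓝 0) := by
      have := ENNReal.tendsto_ofReal (tendsto_rpow_neg_atTop hs0)
      rwa [ENNReal.ofReal_zero] at this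
    obtain ⟨D, h2, h3⟩ := (((ENNReal.tendsto_nhds_zero.1 h1) d' hd'0).and
      (eventually_gt_atTop 0)).exists
    exact ⟨D, h3, h2⟩
  filter_upwards [ENNReal.tendsto_nhds_zero.1
    (tendsto_lintegral_ball hu K hK hT (R + D)) d hd0] with n hn
  have mf := measurable_dens f
  have mu := measurable_dens (u n)
  have mb : ∀ r, MeasurableSet (Metric.ball (0 : R3) r) := fun r => measurableSet_ball
  set f1 := (Metric.ball (0 : R3) R).indicator (dens f) with hf1
  set f2 := (Metric.ball (0 : R3) R)ᶜ.indicator (dens f) with hf2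
  set u1 := (Metric.ball (0 : R3) (R + D)).indicator (dens (u n)) with hu1
  set u2 := (Metric.ball (0 : R3) (R + D))ᶜ.indicator (dens (u n)) with hu2
  have ef : f1 + f2 = dens f := Set.indicator_self_add_compl _ _
  have eu : u1 + u2 = dens (u n) := Set.indicator_self_add_compl _ _
  have mf1 : Measurable f1 := mf.indicator (mb _)
  have mf2 : Measurable f2 := mf.indicator (mb _).compl
  have mu1 : Measurable u1 := mu.indicator (mb _)
  have h2 : bil s f2 (dens (u n)) ≤ ε / 3 := by
    refine (bil_le_of_pot_le s mf2 (hP _ (hK n) (hT n))).trans (le_trans ?_ hd)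
    rw [mul_comm, hf2, lintegral_indicator (mb _).compl]
    gcongr
  have h11 : bil s f1 u1 ≤ ε / 3 := by
    rw [bil_comm s mf1 mu1]
    have : ∀ x, pot s f1 x ≤ P := fun x =>
      (pot_mono s (ae_of_all _ fun y => Set.indicator_le_self _ _ _) x).trans (hP f hf hfT x)
    refine (bil_le_of_pot_le s mu1 this).trans (le_trans ?_ hd)
    rw [mul_comm, hu1, lintegral_indicator (mb _)]
    gcongr
  have h12 : bil s f1 u2 ≤ ε / 3 := by
    refine (bil_separated_le hs0 mf mu hD0).trans (le_trans ?_ hd')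
    rw [mul_comm]
    push_cast
    gcongr
    exact hK n
  calc bil s (dens f) (dens (u n)) = bil s f1 u1 + bil s f1 u2 + bil s f2 (dens (u n)) := by
        rw [← bil_add_right s mf1 mu1, eu, ← bil_add_left s mf1 mu, ef]
    _ ≤ ε / 3 + ε / 3 + ε / 3 := by gcongr
    _ = ε := ENNReal.add_thirds ε

/-- The Brezis–Lieb splitting of Riesz energies along weakly convergent sequences. -/
lemma tendsto_riesz_split {s : ℝ} (hs0 : 0 < s) (hs1 : s ≤ 1) (f : L2) {u : ℕ → L2}
    (hu : WeakTo u 0) (K : ℝ≥0) (hf : ∫⁻ x, dens f x ≤ K) (hfT : kinE f ≤ K)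
    (hK : ∀ n, ∫⁻ x, dens (u n) x ≤ K) (hT : ∀ n, kinE (u n) ≤ K)
    (hgK : ∀ n, ∫⁻ x, dens (f + u n) x ≤ K) (hgT : ∀ n, kinE (f + u n) ≤ K) :
    Tendsto (fun n => riesz s (f + u n) - riesz s f - riesz s (u n)) atTop (𝓝 0) := by
  obtain ⟨C, hC⟩ := exists_pot_dens_le
  have hP : ∀ g : L2, ∫⁻ x, dens g x ≤ K → kinE g ≤ K → ∀ x,
      pot s (dens g) x ≤ ((C * K + K : ℝ≥0) : ℝ≥0∞) := by
    intro g h1 h2 x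
    refine (hC s hs0 hs1 g x).trans ?_
    push_cast
    gcongr
  set P : ℝ≥0 := C * K + K
  set err : ℕ → ℝ≥0∞ := fun n =>
    2 * bil s (dens f) (dens (u n)) + 3 * ((∫⁻ x, cross f (u n) x) * P) with herr
  have htend : Tendsto err atTop (𝓝 0) := by
    have h1 := ENNReal.Tendsto.const_mul (a := 2)
      (tendsto_bil_dens hs0 hs1 f hu K hf hfT hK hT) (Or.inr (by simp))
    have h2 := ENNReal.Tendsto.const_mul (a := 3) (ENNReal.Tendsto.mul_const (b := (P : ℝ≥0∞))
      (tendsto_lintegral_cross f hu K hf hK hT) (Or.inr (by simp))) (Or.inr (by simp))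
    simpa using h1.add h2
  have hfin : ∀ g : L2, kinE g ≤ K → rieszE s g ≠ ⊤ := fun g hg =>
    (rieszE_lt_top hs0 hs1 (hg.trans_lt (by simp))).ne
  have hev : ∀ᶠ n in atTop, err n ≠ ⊤ := by
    filter_upwards [ENNReal.tendsto_nhds_zero.1 htend 1 one_pos] with n hn
    exact (hn.trans_lt (by simp)).ne
  have hreal : Tendsto (fun n => (err n).toReal) atTop (𝓝 0) := by
    have := (ENNReal.tendsto_toReal ENNReal.zero_ne_top).comp htend
    simpa [Function.comp_def] using this
  apply squeeze_zero_norm' _ hreal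
  filter_upwards [hev] with n hn
  have a1 := rieszE_add_le s f (u n) (hP f hf hfT) (hP _ (hK n) (hT n)) (hP _ (hgK n) (hgT n))
  have a2 := le_rieszE_add s f (u n) (hP f hf hfT) (hP _ (hK n) (hT n)) (hP _ (hgK n) (hgT n))
  have a3 : rieszE s f + rieszE s (u n) ≤ rieszE s (f + u n) + err n :=
    a2.trans (by gcongr; exact le_add_self)
  have t1 := hfin f hfT
  have t2 := hfin _ (hT n)
  have t3 := hfin _ (hgT n)
  have b1 := ENNReal.toReal_mono (ENNReal.add_ne_top.2 ⟨ENNReal.add_ne_top.2 ⟨t1, t2⟩, hn⟩) a1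
  have b3 := ENNReal.toReal_mono (ENNReal.add_ne_top.2 ⟨t3, hn⟩) a3
  rw [ENNReal.toReal_add (ENNReal.add_ne_top.2 ⟨t1, t2⟩) hn, ENNReal.toReal_add t1 t2] at b1
  rw [ENNReal.toReal_add t3 hn, ENNReal.toReal_add t1 t2] at b3
  rw [Real.norm_eq_abs, abs_le]
  unfold riesz
  constructor <;> linarith

/-! ### Minimizing sequences and their compactness -/

lemma setLIntegral_ball_dens_translate (a : R3) (f : L2) (R : ℝ) :
    ∫⁻ x in Metric.ball (0 : R3) R, dens (translate a f) x
      = ∫⁻ x in Metric.ball a R, dens f x := by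
  rw [← lintegral_indicator measurableSet_ball, ← lintegral_indicator measurableSet_ball,
    ← lintegral_add_right_eq_self ((Metric.ball a R).indicator (dens f)) a]
  apply lintegral_congr_ae
  filter_upwards [dens_translate a f] with x hx
  have : x + a ∈ Metric.ball a R ↔ x ∈ Metric.ball (0 : R3) R := by
    simp [Metric.mem_ball, dist_eq_norm]
  by_cases h : x ∈ Metric.ball (0 : R3) R
  · rw [Set.indicator_of_mem h, Set.indicator_of_mem (this.2 h), hx]
  · rw [Set.indicator_of_notMem h, Set.indicator_of_notMem (mt this.1 h)]

lemma energy_translate {m α : ℝ} (hα0 : 0 < α) (hα1 : α ≤ 1) (β : ℝ) (a : R3) {f : L2}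
    (hf : MemHHalf f) : energy m α β (translate a f) = energy m α β f := by
  rw [energy_eq hα0 hα1 m β hf, energy_eq hα0 hα1 m β (hf.translate a), kinetic_translate,
    riesz_translate, riesz_translate]

/-- The kinetic term is at least mN/2, so an energy deficit η must come from the interaction: |β|
D_α + D_1 ≥ 4η. Comparing D_α with D_1 at a radius r so large that |β| N² r^{-α} < 2η leaves a lower
bound on D_1 itself. -/
lemma exists_lt_riesz_one {m α : ℝ} (hα0 : 0 < α) (hα1 : α ≤ 1) (β N : ℝ) {η : ℝ} (hη : 0 < η) :
    ∃ ε : ℝ, 0 < ε ∧ ∀ φ : L2, MemHHalf φ → mass φ = N → energy m α β φ ≤ 1 / 2 * (m * N) - η →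
      ε < riesz 1 φ := by
  obtain ⟨r, hr0, hr⟩ : ∃ r : ℝ, 0 < r ∧ |β| * N ^ 2 * r ^ (-α) < 2 * η := by
    have h1 := (tendsto_rpow_neg_atTop hα0).const_mul (|β| * N ^ 2)
    rw [mul_zero] at h1
    obtain ⟨r, h2, h3⟩ := ((h1.eventually_lt_const (show 0 < 2 * η by linarith)).and
      (eventually_gt_atTop 0)).exists
    exact ⟨r, h3, h2⟩
  have hden : 0 < 1 + |β| * r ^ (1 - α) := by positivity
  refine ⟨2 * η / (1 + |β| * r ^ (1 - α)), by positivity, fun φ hφ hφm hE => ?_⟩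
  rw [div_lt_iff₀ hden]
  rw [energy_eq hα0 hα1 m β hφ] at hE
  have h1 := mul_mass_le_kinetic m hφ
  have h2 := mul_le_mul_of_nonneg_left (riesz_le hα0 hα1 hr0 hφ) (abs_nonneg β)
  have h3 := mul_le_mul_of_nonneg_right (neg_abs_le β) (riesz_nonneg α φ)
  rw [hφm] at h1 h2
  nlinarith

/-- A minimizing sequence, translated so that a fixed amount of mass stays in a fixed ball. -/
lemma exists_minimizing_seq {m α β N : ℝ} (hα0 : 0 < α) (hα1 : α < 1)
    (hN0 : 0 < N) (hN : N < criticalMass) (hlt : gs m α β N < 1 / 2 * (m * N)) :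
    ∃ (R c K : ℝ) (ψ : ℕ → L2), 0 < c ∧ ∀ n, MemHHalf (ψ n) ∧ mass (ψ n) = N ∧
      kinetic 0 (ψ n) ≤ K ∧ energy m α β (ψ n) ≤ gs m α β N + 1 / ((n : ℝ) + 1) ∧
      ENNReal.ofReal c ≤ ∫⁻ x in Metric.ball (0 : R3) R, dens (ψ n) x := by
  set E := gs m α β N with hE
  -- Half of the gap below mN/2: every trial function within η of the infimum still has energy
  -- deficit η.
  set η := (1 / 2 * (m * N) - E) / 2 with hη
  have hη0 : 0 < η := by rw [hη]; linarith
  obtain ⟨ε, hε0, hε⟩ := exists_lt_riesz_one (m := m) hα0 hα1.le β N hη0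
  obtain ⟨q, K, hq, hK⟩ := exists_coercive (m := m) hα0 hα1 β hN0 hN
  set T := (E + η + K) / q with hT
  obtain ⟨R, c, -, hc, hR⟩ := exists_nonvanishing (N + |T|).toNNReal hε0
  have key : ∀ n : ℕ, ∃ ψ : L2, MemHHalf ψ ∧ mass ψ = N ∧ kinetic 0 ψ ≤ T ∧
      energy m α β ψ ≤ E + 1 / ((n : ℝ) + 1) ∧
      ENNReal.ofReal c ≤ ∫⁻ x in Metric.ball (0 : R3) R, dens ψ x := by
    intro n
    have hb : E < E + min η (1 / ((n : ℝ) + 1)) := by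
      have : 0 < min η (1 / ((n : ℝ) + 1)) := lt_min hη0 (by positivity)
      linarith
    obtain ⟨φ, hφ, hφm, hφE⟩ := exists_energy_lt hN0 hb
    have hφ1 : energy m α β φ ≤ E + η := hφE.le.trans (by gcongr; exact min_le_left _ _)
    have hφ2 : energy m α β φ ≤ E + 1 / ((n : ℝ) + 1) :=
      hφE.le.trans (by gcongr; exact min_le_right _ _)
    have hφT : kinetic 0 φ ≤ T := by
      rw [hT, le_div_iff₀ hq]
      linarith [hK φ hφ hφm.le]
    have hlow := hε φ hφ hφm (by linarith)
    have hex : ∃ a, ENNReal.ofReal c < ∫⁻ y in Metric.ball a R, dens φ y := by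
      by_contra! hcon
      have := hR φ ?_ ?_ hcon
      · exact absurd (ENNReal.toReal_le_of_le_ofReal hε0.le this) (not_le.2 hlow)
      · rw [lintegral_dens_eq_mass, hφm]
        exact ENNReal.ofReal_le_ofReal (by linarith [abs_nonneg T])
      · rw [kinE_eq hφ]
        apply ENNReal.ofReal_le_ofReal
        have h1 : kinetic 0 φ / (2 * Real.pi) ≤ kinetic 0 φ :=
          div_le_self (kinetic_nonneg 0 φ) (by linarith [Real.pi_gt_three])
        linarith [le_abs_self T]
    obtain ⟨a, ha⟩ := hex
    refine ⟨translate a φ, hφ.translate a, by rw [mass_translate, hφm],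
      by rwa [kinetic_translate], by rwa [energy_translate hα0 hα1.le β a hφ], ?_⟩
    rw [setLIntegral_ball_dens_translate]
    exact ha.le
  choose ψ hψ using key
  exact ⟨R, c, T, ψ, hc, hψ⟩

lemma lintegral_dens_le_of_kinetic_le {m : ℝ} (hm : 0 < m) {M : ℝ} {f : L2} (hf : MemHHalf f)
    (h : kinetic m f ≤ M) : ∫⁻ x, dens f x ≤ (M / m + M).toNNReal := by
  have h0 := (kinetic_nonneg m f).trans h
  rw [lintegral_dens_eq_mass]
  apply ENNReal.ofReal_le_ofReal
  have : mass f ≤ M / m := by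
    rw [le_div_iff₀ hm]
    linarith [mul_mass_le_kinetic m hf]
  linarith

lemma kinE_le_of_kinetic_le {m : ℝ} (hm : 0 < m) {M : ℝ} {f : L2} (hf : MemHHalf f)
    (h : kinetic m f ≤ M) : kinE f ≤ (M / m + M).toNNReal := by
  have h0 := (kinetic_nonneg m f).trans h
  rw [kinE_eq hf]
  apply ENNReal.ofReal_le_ofReal
  have h1 : kinetic 0 f / (2 * Real.pi) ≤ kinetic 0 f :=
    div_le_self (kinetic_nonneg 0 f) (by linarith [Real.pi_gt_three])
  have := kinetic_zero_le m hf
  have : 0 ≤ M / m := by positivity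
  linarith

/-- The energy splits along weakly convergent sequences of bounded kinetic energy. -/
lemma tendsto_energy_split {m α : ℝ} (hm : 0 < m) (hα0 : 0 < α) (hα1 : α ≤ 1) (β : ℝ)
    {G : ℕ → L2} {G₀ : L2} (hG : WeakTo G G₀) {M : ℝ} (hM : ∀ n, ‖G n‖ ≤ M) :
    Tendsto (fun n => energy m α β (invSqrt hm (G n)) - energy m α β (invSqrt hm G₀)
      - energy m α β (invSqrt hm (G n - G₀))) atTop (𝓝 0) := by
  have hM0 : 0 ≤ M := (norm_nonneg _).trans (hM 0)
  set B := (M + ‖G₀‖) ^ 2 with hB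
  have hkin : ∀ H : L2, ‖H‖ ≤ M + ‖G₀‖ → kinetic m (invSqrt hm H) ≤ B := by
    intro H hH
    rw [kinetic_invSqrt, hB]
    gcongr
  have h1 : ∀ n, ‖G n‖ ≤ M + ‖G₀‖ := fun n => (hM n).trans (by linarith [norm_nonneg G₀])
  have h2 : ‖G₀‖ ≤ M + ‖G₀‖ := by linarith
  have h3 : ∀ n, ‖G n - G₀‖ ≤ M + ‖G₀‖ := fun n =>
    (norm_sub_le _ _).trans (by linarith [hM n])
  have hd : ∀ H : L2, ‖H‖ ≤ M + ‖G₀‖ → ∫⁻ x, dens (invSqrt hm H) x ≤ (B / m + B).toNNReal :=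
    fun H hH => lintegral_dens_le_of_kinetic_le hm (memHHalf_invSqrt hm H) (hkin H hH)
  have hk : ∀ H : L2, ‖H‖ ≤ M + ‖G₀‖ → kinE (invSqrt hm H) ≤ (B / m + B).toNNReal :=
    fun H hH => kinE_le_of_kinetic_le hm (memHHalf_invSqrt hm H) (hkin H hH)
  have hadd : ∀ n, invSqrt hm G₀ + invSqrt hm (G n - G₀) = invSqrt hm (G n) := by
    intro n; rw [← map_add, add_sub_cancel]
  have hu : WeakTo (fun n => invSqrt hm (G n - G₀)) 0 := by
    have := hG.sub_limit.map (invSqrt hm)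
    rwa [map_zero] at this
  have hr : ∀ s : ℝ, 0 < s → s ≤ 1 → Tendsto (fun n => riesz s (invSqrt hm (G n))
      - riesz s (invSqrt hm G₀) - riesz s (invSqrt hm (G n - G₀))) atTop (𝓝 0) := by
    intro s hs0 hs1
    have := tendsto_riesz_split hs0 hs1 (invSqrt hm G₀) hu _ (hd _ h2) (hk _ h2)
      (fun n => hd _ (h3 n)) (fun n => hk _ (h3 n)) (fun n => by rw [hadd]; exact hd _ (h1 n))
      (fun n => by rw [hadd]; exact hk _ (h1 n))
    simpa only [hadd] using this
  have hT := hG.tendsto_norm_split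
  have := (hT.const_mul (1 / 2)).add
    ((((hr α hα0 hα1).const_mul β).sub (hr 1 one_pos le_rfl)).const_mul (1 / 4))
  simp only [mul_zero, sub_zero, add_zero] at this
  refine this.congr fun n => ?_
  rw [energy_eq hα0 hα1 m β (memHHalf_invSqrt hm _), energy_eq hα0 hα1 m β (memHHalf_invSqrt hm _),
    energy_eq hα0 hα1 m β (memHHalf_invSqrt hm _), kinetic_invSqrt, kinetic_invSqrt,
    kinetic_invSqrt]
  ring

lemma tendsto_mass_split {m : ℝ} (hm : 0 < m) {G : ℕ → L2} {G₀ : L2} (hG : WeakTo G G₀) :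
    Tendsto (fun n => mass (invSqrt hm (G n)) - mass (invSqrt hm G₀)
      - mass (invSqrt hm (G n - G₀))) atTop (𝓝 0) := by
  simp only [mass_eq, map_sub]
  exact (hG.map (invSqrt hm)).tendsto_norm_split

/-- Along a sequence whose masses converge to `M > 0`, the limit energy is at least the ground
state energy at mass `M`. -/
lemma gs_le_of_tendsto {m α β M e B : ℝ} (hα0 : 0 < α) (hα1 : α < 1) (hM0 : 0 < M)
    (hM : M < criticalMass) {u : ℕ → L2} (hu : ∀ n, MemHHalf (u n))
    (hB : ∀ n, kinetic m (u n) ≤ B) (hmass : Tendsto (fun n => mass (u n)) atTop (𝓝 M))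
    (hE : Tendsto (fun n => energy m α β (u n)) atTop (𝓝 e)) : gs m α β M ≤ e := by
  -- Rescale u n to have mass exactly M; the factors tend to 1, and bounded kinetic energy makes the
  -- change of energy negligible. If finitely many u n vanish, division by zero gives t n = 0 there,
  -- which is harmless in the limit.
  set t : ℕ → ℝ := fun n => √(M / mass (u n)) with ht
  have ht1 : Tendsto t atTop (𝓝 1) := by
    have h1 := ((tendsto_const_nhds (x := M)).div hmass hM0.ne').sqrt
    rwa [div_self hM0.ne', Real.sqrt_one] at h1
  have hkin : Tendsto (fun n => t n ^ 2 * (t n ^ 2 - 1) * (1 / 2 * kinetic m (u n))) atTop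
      (𝓝 0) := by
    have h0 : Tendsto (fun n => t n ^ 2 * (t n ^ 2 - 1)) atTop (𝓝 0) := by
      have := (ht1.pow 2).mul ((ht1.pow 2).sub_const 1)
      simpa using this
    apply squeeze_zero_norm' (a := fun n => ‖t n ^ 2 * (t n ^ 2 - 1)‖ * (1 / 2 * B))
    · apply Eventually.of_forall
      intro n
      have hk := kinetic_nonneg m (u n)
      rw [norm_mul, Real.norm_of_nonneg (show 0 ≤ 1 / 2 * kinetic m (u n) by positivity)]
      gcongr
      exact hB n
    · simpa using h0.norm.mul_const (1 / 2 * B)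
  have hlim : Tendsto (fun n => energy m α β ((t n : ℂ) • u n)) atTop (𝓝 e) := by
    have := ((ht1.pow 4).mul hE).sub hkin
    simp only [one_pow, one_mul, sub_zero] at this
    refine this.congr fun n => ?_
    rw [energy_smul hα0 hα1 (t n) (hu n)]
  apply ge_of_tendsto hlim
  filter_upwards [hmass.eventually_const_lt hM0] with n hn
  apply gs_le hα0 hα1 hM0 hM ((hu n).smul _)
  rw [mass_smul, ht, Real.sq_sqrt (by positivity), div_mul_cancel₀ _ hn.ne']

/-- Vanishing mass with bounded kinetic energy kills both Riesz energies, leaving only the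
nonnegative kinetic term. -/
lemma nonneg_of_tendsto_energy {m α β e B : ℝ} (hα0 : 0 < α) (hα1 : α < 1) {u : ℕ → L2}
    (hu : ∀ n, MemHHalf (u n)) (hB : ∀ n, kinetic m (u n) ≤ B)
    (hmass : Tendsto (fun n => mass (u n)) atTop (𝓝 0))
    (hE : Tendsto (fun n => energy m α β (u n)) atTop (𝓝 e)) : 0 ≤ e := by
  obtain ⟨C, hC0, hC⟩ := exists_riesz_one_le
  have h1 : Tendsto (fun n => riesz 1 (u n)) atTop (𝓝 0) := by
    apply squeeze_zero (g := fun n => C * B * mass (u n)) (fun n => riesz_nonneg _ _)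
    · intro n
      refine (hC _ (hu n)).trans ?_
      gcongr
      · exact mass_nonneg _
      · exact (kinetic_zero_le m (hu n)).trans (hB n)
    · simpa using hmass.const_mul (C * B)
  have h2 : Tendsto (fun n => riesz α (u n)) atTop (𝓝 0) := by
    apply squeeze_zero (g := fun n => riesz 1 (u n) + mass (u n) ^ 2) (fun n => riesz_nonneg _ _)
    · intro n
      have := riesz_le hα0 hα1.le one_pos (hu n)
      simpa using this
    · simpa using h1.add (hmass.pow 2)
  have h3 := ((h2.const_mul β).sub h1).const_mul (1 / 4)
  simp only [mul_zero, sub_zero] at h3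
  refine le_of_tendsto_of_tendsto' h3 hE fun n => ?_
  rw [energy_eq hα0 hα1.le m β (hu n)]
  linarith [kinetic_nonneg m (u n)]

/-- Strict binding inequalities imply existence of a minimizer. -/
theorem exists_isMinimizer {m α β N : ℝ} (hm : 0 < m) (hα0 : 0 < α) (hα1 : α < 1)
    (hN0 : 0 < N) (hN : N < criticalMass) (hlt : gs m α β N < 1 / 2 * (m * N))
    (hsub : ∀ l, 0 < l → l < N → gs m α β N < gs m α β l + gs m α β (N - l)) :
    ∃ φ : L2, IsMinimizer m α β N φ := by
  obtain ⟨R, c, K, ψ, hc, hψ⟩ := exists_minimizing_seq hα0 hα1 hN0 hN hlt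
  choose G' hG' using fun n => exists_eq_invSqrt hm (hψ n).1
  have hbd : ∀ n, ‖G' n‖ ≤ √(K + m * N) := by
    intro n
    apply Real.le_sqrt_of_sq_le
    rw [← kinetic_invSqrt hm, ← hG']
    have := kinetic_le hm.le (hψ n).1
    rw [(hψ n).2.1] at this
    linarith [(hψ n).2.2.1]
  obtain ⟨k, G₀, hk, hweak⟩ := exists_weakTo_subseq G' hbd
  set G : ℕ → L2 := fun n => G' (k n) with hG
  set f := invSqrt hm G₀ with hf
  set u : ℕ → L2 := fun n => invSqrt hm (G n - G₀) with hu
  have hGψ : ∀ n, invSqrt hm (G n) = ψ (k n) := fun n => (hG' (k n)).symm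
  have hfH : MemHHalf f := memHHalf_invSqrt hm _
  have huH : ∀ n, MemHHalf (u n) := fun n => memHHalf_invSqrt hm _
  set B := (√(K + m * N) + ‖G₀‖) ^ 2 with hB
  have huB : ∀ n, kinetic m (u n) ≤ B := by
    intro n
    rw [hu, kinetic_invSqrt, hB]
    have := (norm_sub_le (G n) G₀).trans (add_le_add_left (hbd (k n)) ‖G₀‖)
    gcongr
  have hmass : Tendsto (fun n => mass (u n)) atTop (𝓝 (N - mass f)) := by
    have h1 := (tendsto_mass_split hm hweak).const_sub (N - mass f)
    rw [sub_zero] at h1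
    refine h1.congr fun n => ?_
    rw [hGψ, (hψ (k n)).2.1]
    ring
  have hEψ : Tendsto (fun n => energy m α β (ψ (k n))) atTop (𝓝 (gs m α β N)) := by
    have h1 : Tendsto (fun n : ℕ => gs m α β N + 1 / ((n : ℝ) + 1)) atTop
        (𝓝 (gs m α β N)) := by
      simpa using tendsto_one_div_add_atTop_nhds_zero_nat.const_add (gs m α β N)
    exact tendsto_of_tendsto_of_tendsto_of_le_of_le tendsto_const_nhds
      (h1.comp hk.tendsto_atTop) (fun n => gs_le hα0 hα1 hN0 hN (hψ (k n)).1 (hψ (k n)).2.1)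
      (fun n => (hψ (k n)).2.2.2.1)
  have hE : Tendsto (fun n => energy m α β (u n)) atTop (𝓝 (gs m α β N - energy m α β f)) := by
    have h1 := (hEψ.sub_const (energy m α β f)).sub
      (tendsto_energy_split hm hα0 hα1.le β hweak fun n => hbd (k n))
    rw [sub_zero] at h1
    refine h1.congr fun n => ?_
    rw [hGψ]
    ring
  -- If the weak limit were 0, Rellich would empty the ball that carries mass at least c along the
  -- whole sequence.
  have hf0 : f ≠ 0 := by
    intro h0
    have hw : WeakTo (fun n => ψ (k n)) 0 := by
      have := hweak.map (invSqrt hm)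
      rw [← hf, h0] at this
      simpa only [hGψ] using this
    have hkin : ∀ n, kinetic m (ψ (k n)) ≤ √(K + m * N) ^ 2 := by
      intro n
      rw [← hGψ, kinetic_invSqrt]
      gcongr
      exact hbd (k n)
    have h1 := tendsto_lintegral_ball hw _
      (fun n => lintegral_dens_le_of_kinetic_le hm (hψ (k n)).1 (hkin n))
      (fun n => kinE_le_of_kinetic_le hm (hψ (k n)).1 (hkin n)) R
    have h2 := ge_of_tendsto' h1 fun n => (hψ (k n)).2.2.2.2
    exact absurd h2 (not_le.2 (by simpa using hc))
  have hμ0 := mass_pos hf0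
  have hμN : mass f ≤ N := by
    have := ge_of_tendsto' hmass fun n => mass_nonneg (u n)
    linarith
  rcases hμN.lt_or_eq with hμ | hμ
  -- Dichotomy: the remainders have masses tending to N - mass f > 0, so their limiting energy is at
  -- least E(N - mass f). Together with the energy of f this contradicts strict subadditivity.
  · exfalso
    have h1 := gs_le_of_tendsto hα0 hα1 (sub_pos.2 hμ) (by linarith) huH huB hmass hE
    have h2 := gs_le (m := m) (β := β) hα0 hα1 hμ0 (hμ.trans hN) hfH rfl
    have h3 := hsub _ hμ0 hμ
    linarith
  -- No mass is lost: the remainders have limiting energy at least 0, so the energy of f is at most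
  -- E(N).
  · rw [hμ, sub_self] at hmass
    have h1 := nonneg_of_tendsto_energy hα0 hα1 huH huB hmass hE
    exact ⟨f, isMinimizer_of_energy_le hα0 hα1 hN0 hN hfH hμ (by linarith)⟩

end BosonStar

end

/-! ### The theorem -/

theorem theorem1p1 (m α : ℝ) (hm : 0 < m) (hα0 : 0 < α) (hα1 : α < 1) :
    (∀ β N : ℝ, β ≤ 0 → 0 < N → N < BosonStar.criticalMass →
      ∃ φ : BosonStar.L2, BosonStar.IsMinimizer m α β N φ) ∧
    (∃ β₀ : ℝ, 0 < β₀ ∧ ∃ δ : ℝ, 0 < δ ∧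
      ∀ β N : ℝ, 0 < β → β < β₀ → 0 < N → BosonStar.criticalMass - δ < N →
        N < BosonStar.criticalMass →
        ∃ φ : BosonStar.L2, BosonStar.IsMinimizer m α β N φ) ∧
    (∀ β N : ℝ, BosonStar.criticalMass < N →
      BosonStar.groundEnergy m α β N = ⊥ ∧
      ¬ ∃ φ : BosonStar.L2, BosonStar.IsMinimizer m α β N φ) := by
  refine ⟨fun β N hβ hN0 hN => ?_, ?_, fun β N hN => ?_⟩
  · exact BosonStar.exists_isMinimizer hm hα0 hα1 hN0 hN (BosonStar.gs_lt_of_nonpos hm hα0 hα1 hβ hN0 hN)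
      fun l hl0 hlN => BosonStar.gs_subadditive_of_nonpos hm hα0 hα1 hβ hN hl0 hlN
  · obtain ⟨β₀, δ, hβ₀, hδ, h⟩ := BosonStar.exists_gs_lt hm hα0 hα1 BosonStar.criticalMass_pos
    refine ⟨β₀, hβ₀, δ, hδ, fun β N hβ hββ hN0 hNδ hN => ?_⟩
    have hE := h β N hβ hββ hN0 hNδ hN
    refine BosonStar.exists_isMinimizer hm hα0 hα1 hN0 hN ?_
      -- The one bound E(N) < mN/6 serves twice: for strict subadditivity, and, since mN > 0, for
      -- E(N) < mN/2.
      fun l hl0 hlN => BosonStar.gs_subadditive_of_lt hα0 hα1 hβ.le hN hE hl0 hlN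
    have : 0 < m * N := mul_pos hm hN0
    linarith
  · have hbot := BosonStar.groundEnergy_eq_bot hm hα0 hα1 β hN
    refine ⟨hbot, fun ⟨φ, _, _, h⟩ => ?_⟩
    rw [hbot] at h
    exact EReal.coe_ne_bot _ h
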